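/- Let $\mathcal C$ be a premodular category, i.e. a ribbon fusion category over $\mathbb C$ (equivalently, a braided spherical fusion category), with braiding $c$ and twist $\theta$. Let $G$ be a Tannakian subgroup of $\mathcal C$: a finite group of isomorphism classes of invertible objects (under $\otimes$) such that the full subcategory of $\mathcal C$ of finite direct sums of objects with classes in $G$ is equivalent, as a premodular category, to $\operatorname{Rep}(H)$ for some finite group $H$, where $\operatorname{Rep}(H)$ has its usual symmetric braiding and the identity twist. Fix such an equivalence, and let $A\in\mathcal C$ be the image of the commutative algebra $\operatorname{Fun}(H)$ of complex functions on $H$ with the translation action. Let $\mathcal C_G^0$ be the category of local left $A$-modules in $\mathcal C$, i.e. of modules $(M,\rho\colon A\otimes M\to M)$ with $\rho\circ c_{M,A}\circ c_{A,M}=\rho$; it is a premodular category with tensor product $\otimes_A$ and with the braiding and the twist inherited from $\mathcal C$. For a premodular category $\mathcal D$ with set $\mathcal O(\mathcal D)$ of isomorphism classes of simple objects, and $n\in\mathbb Z$, put $$\tau_n(\mathcal D)=\sum_{X\in\mathcal O(\mathcal D)}\theta_X^{\,n}\,\dim(X)^2,\qquad \xi_n(\mathcal D)=\frac{\tau_n(\mathcal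 D)}{|\tau_n(\mathcal D)|}\ \text{ if }\tau_n(\mathcal D)\neq 0,$$ where $\theta_X$ is the scalar by which the twist of $\mathcal D$ acts on $X$ and $\dim(X)$ is the categorical dimension of $X$ in $\mathcal D$. Let $\operatorname{ord}(T_{\mathcal C})$ be the order of the diagonal matrix $T_{\mathcal C}=(\delta_{X,Y}\theta_X)_{X,Y\in\mathcal O(\mathcal C)}$. Then, for every $n\in\mathbb Z$ coprime to $\operatorname{ord}(T_{\mathcal C})$, $$\tau_n(\mathcal C)=|G|\,\tau_n(\mathcal C_G^0),$$ and if moreover $\tau_n(\mathcal C)\neq0$, then $\xi_n(\mathcal C_G^0)=\xi_n(\mathcal C)$. -/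

import Mathlib

open CategoryTheory MonoidalCategory Limits

universe v u

namespace Premodular

noncomputable section

section Twists

/-- A twist (balancing) on a braided monoidal category: a natural automorphism `θ` of the identity
functor with `θ_{X ⊗ Y} = c_{Y,X} ∘ c_{X,Y} ∘ (θ_X ⊗ θ_Y)`. -/
class Twist (C : Type u) [Category.{v} C] [MonoidalCategory C] [BraidedCategory C] where
  /-- the automorphism `θ_X` -/
  twist (X : C) : X ≅ X
  naturality {X Y : C} (f : X ⟶ Y) : f ≫ (twist Y).hom = (twist X).hom ≫ f
  twist_tensor (X Y : C) : (twist (X ⊗ Y)).hom =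
    ((twist X).hom ⊗ₘ (twist Y).hom) ≫ (β_ X Y).hom ≫ (β_ Y X).hom

/-- The twist automorphism `θ_X`. -/
def θ {C : Type u} [Category.{v} C] [MonoidalCategory C] [BraidedCategory C] [Twist C] (X : C) :
    X ≅ X := Twist.twist X

variable {C : Type u} [Category.{v} C] [MonoidalCategory C] [BraidedCategory C] [Twist C]

lemma θ_naturality {X Y : C} (f : X ⟶ Y) : f ≫ (θ Y).hom = (θ X).hom ≫ f := Twist.naturality f

lemma θ_tensor (X Y : C) : (θ (X ⊗ Y)).hom =
    ((θ X).hom ⊗ₘ (θ Y).hom) ≫ (β_ X Y).hom ≫ (β_ Y X).hom := Twist.twist_tensor X Y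

/-- An object on which the twist is the identity. -/
class TrivialTwist (X : C) : Prop where
  twist_eq : (θ X).hom = 𝟙 X

end Twists

section GaussSums

variable {D : Type u} [Category.{v} D] [Preadditive D] [Linear ℂ D] [MonoidalCategory D]
  [BraidedCategory D] [Twist D]

/-- The scalar `c` with `f = c • 𝟙`, for an endomorphism `f` that is a multiple of the identity
(every endomorphism of a simple object over `ℂ`); `0` for other endomorphisms. -/
def scalar {X : D} (f : X ⟶ X) : ℂ :=
  open Classical in if h : ∃ c : ℂ, f = c • 𝟙 X then h.choose else 0

/-- The categorical trace of `f : X ⟶ X`, computed with a dual `Y` of `X`: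
`1 ⟶ X ⊗ Y ⟶ X ⊗ Y ⟶ Y ⊗ X ⟶ 1`, by coevaluation, `(θ_X ∘ f) ⊗ Y`, braiding and evaluation. -/
def traceHom (X Y : D) [ExactPairing X Y] (f : X ⟶ X) : 𝟙_ D ⟶ 𝟙_ D :=
  η_ X Y ≫ (f ≫ (θ X).hom) ▷ Y ≫ (β_ X Y).hom ≫ ε_ X Y

/-- The categorical dimension `dim(X) = Tr(𝟙_X)` of an object that has a dual. -/
def qdim (X : D) : ℂ :=
  open Classical in
  if h : ∃ Y : D, Nonempty (ExactPairing X Y) then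
    letI := h.choose_spec.some
    scalar (traceHom X h.choose (𝟙 X))
  else 0

variable (D)

/-- The set `𝒪(D)` of isomorphism classes of simple objects. -/
def SimpleClass := {X : Skeleton D // Simple ((fromSkeleton D).obj X)}

variable {D}

/-- An object representing an isomorphism class of simple objects. -/
def SimpleClass.rep (X : SimpleClass D) : D := (fromSkeleton D).obj X.1

variable (D)

/-- The `n`-th Gauss sum `τ_n(D) = ∑_{X ∈ 𝒪(D)} θ_X ^ n * dim(X) ^ 2`. -/
def gaussSum (n : ℤ) : ℂ :=
  ∑ᶠ X : SimpleClass D, scalar (θ X.rep).hom ^ n * qdim X.rep ^ 2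

/-- The `n`-th central charge `ξ_n(D) = τ_n(D) / |τ_n(D)|`, meaningful when `τ_n(D) ≠ 0`. -/
def centralCharge (n : ℤ) : ℂ := gaussSum D n / (‖gaussSum D n‖ : ℂ)

/-- The order of the `T`-matrix `(δ_{X,Y} θ_X)_{X,Y ∈ 𝒪(D)}`. -/
def ordT [Finite (SimpleClass D)] : ℕ :=
  open Classical in
  letI := Fintype.ofFinite (SimpleClass D)
  orderOf (Matrix.diagonal fun X : SimpleClass D => scalar (θ X.rep).hom)

end GaussSums

section PremodularCategories

attribute [local instance] Abelian.hasFiniteBiproducts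

/-- A premodular category: a ribbon fusion category over `ℂ`. Equivalently, a braided fusion
category with a spherical structure `j`, where `θ = u⁻¹ ∘ j` for the Drinfeld isomorphism `u`; the
dimension `dim(X)` defined above is then the pivotal dimension. -/
class IsPremodular (C : Type u) [Category.{v} C] [Abelian C] [Linear ℂ C] [MonoidalCategory C]
    [MonoidalPreadditive C] [MonoidalLinear ℂ C] [RigidCategory C] [BraidedCategory C]
    [Twist C] : Prop where
  /-- every object is a finite direct sum of simple objects -/
  semisimple (X : C) : ∃ (m : ℕ) (S : Fin m → C), (∀ i, Simple (S i)) ∧ Nonempty (X ≅ ⨁ S)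
  finite_hom (X Y : C) : FiniteDimensional ℂ (X ⟶ Y)
  finite_simples : Finite (SimpleClass C)
  simple_unit : Simple (𝟙_ C)
  /-- the twist is a ribbon structure: `θ_{X*} = (θ_X)*` -/
  ribbon (X : C) : (θ (Xᘁ)).hom = rightAdjointMate (θ X).hom

instance (C : Type u) [Category.{v} C] [Abelian C] [Linear ℂ C] [MonoidalCategory C]
    [MonoidalPreadditive C] [MonoidalLinear ℂ C] [RigidCategory C] [BraidedCategory C]
    [Twist C] [IsPremodular C] : Finite (SimpleClass C) := IsPremodular.finite_simples

/-- In a rigid category `X ⊗ -` has a right adjoint. -/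
instance {C : Type u} [Category.{v} C] [MonoidalCategory C] [RigidCategory C] (X : C) :
    PreservesColimitsOfSize.{0, 0} (tensorLeft X) :=
  (tensorLeftAdjunction (ᘁX) X).leftAdjoint_preservesColimits

/-- In a rigid category `- ⊗ X` has a right adjoint. -/
instance {C : Type u} [Category.{v} C] [MonoidalCategory C] [RigidCategory C] (X : C) :
    PreservesColimitsOfSize.{0, 0} (tensorRight X) :=
  (tensorRightAdjunction X (Xᘁ)).leftAdjoint_preservesColimits

end PremodularCategories

section RelativeTensor

variable {C : Type u} [Category.{v} C] [MonoidalCategory C] [HasCoequalizers C]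
  [∀ X : C, PreservesColimitsOfSize.{0, 0} (tensorLeft X)]
  [∀ X : C, PreservesColimitsOfSize.{0, 0} (tensorRight X)]

/-- The monoidal category of `A`-bimodules under the relative tensor product `⊗_A`. -/
instance bimodMonoidal (A : Mon C) : MonoidalCategory (Bimod A A) where
  tensorObj M N := M.tensorBimod N
  whiskerLeft M _ _ f := Bimod.whiskerLeft M f
  whiskerRight f N := Bimod.whiskerRight f N
  tensorHom f g := Bimod.whiskerRight f _ ≫ Bimod.whiskerLeft _ g
  tensorUnit := Bimod.regular A
  associator := Bimod.associatorBimod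
  leftUnitor := Bimod.leftUnitorBimod
  rightUnitor := Bimod.rightUnitorBimod
  tensorHom_def _ _ := rfl
  id_tensorHom_id _ _ := by
    rw [Bimod.id_whiskerRight_bimod, Bimod.whiskerLeft_id_bimod, Category.id_comp]
  tensorHom_comp_tensorHom f₁ f₂ g₁ g₂ := by
    rw [Bimod.comp_whiskerRight_bimod, Bimod.whiskerLeft_comp_bimod, Category.assoc,
      Category.assoc, ← Category.assoc (Bimod.whiskerLeft _ _) (Bimod.whiskerRight _ _),
      Bimod.whisker_exchange_bimod, Category.assoc]
  whiskerLeft_id _ _ := Bimod.whiskerLeft_id_bimod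
  id_whiskerRight _ _ := Bimod.id_whiskerRight_bimod
  associator_naturality {M₁ M₂ M₃ N₁ N₂ N₃} f₁ f₂ f₃ := by
    rw [Bimod.comp_whiskerRight_bimod, Bimod.whisker_assoc_bimod, Bimod.comp_whiskerLeft_bimod,
      Bimod.whiskerRight_comp_bimod, Bimod.whiskerLeft_comp_bimod]
    simp only [Category.assoc, Iso.inv_hom_id, Iso.inv_hom_id_assoc, Category.comp_id]
    rw [Iso.hom_inv_id_assoc]
  leftUnitor_naturality f := by
    rw [Bimod.id_whiskerLeft_bimod]
    simp
  rightUnitor_naturality f := by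
    rw [Bimod.whiskerRight_id_bimod]
    simp
  pentagon M N P Q := Bimod.pentagon_bimod M N P Q
  triangle M N := Bimod.triangle_bimod M N

variable {A : Mon C}

/-- The canonical projection `M ⊗ N ⟶ M ⊗_A N`. -/
def proj (M N : Bimod A A) : M.X ⊗ N.X ⟶ (M ⊗ N).X :=
  coequalizer.π (M.actRight ▷ N.X) ((α_ _ _ _).hom ≫ (M.X ◁ N.actLeft))

instance (M N : Bimod A A) : Epi (proj M N) :=
  inferInstanceAs (Epi (coequalizer.π (M.actRight ▷ N.X) ((α_ _ _ _).hom ≫ (M.X ◁ N.actLeft))))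

instance epi_whiskerLeft_proj (X : C) (M N : Bimod A A) : Epi (X ◁ proj M N) :=
  inferInstanceAs (Epi ((tensorLeft X).map
    (coequalizer.π (M.actRight ▷ N.X) ((α_ _ _ _).hom ≫ (M.X ◁ N.actLeft)))))

instance epi_proj_whiskerRight (X : C) (M N : Bimod A A) : Epi (proj M N ▷ X) :=
  inferInstanceAs (Epi ((tensorRight X).map
    (coequalizer.π (M.actRight ▷ N.X) ((α_ _ _ _).hom ≫ (M.X ◁ N.actLeft)))))

lemma proj_condition (M N : Bimod A A) :
    M.actRight ▷ N.X ≫ proj M N = (α_ _ _ _).hom ≫ (M.X ◁ N.actLeft) ≫ proj M N := by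
  rw [← Category.assoc]
  exact coequalizer.condition (M.actRight ▷ N.X) ((α_ _ _ _).hom ≫ (M.X ◁ N.actLeft))

/-- The map out of `M ⊗_A N` induced by an `A`-balanced map out of `M ⊗ N`. -/
def descTensor {M N : Bimod A A} {Z : C} (f : M.X ⊗ N.X ⟶ Z)
    (h : M.actRight ▷ N.X ≫ f = (α_ _ _ _).hom ≫ (M.X ◁ N.actLeft) ≫ f) : (M ⊗ N).X ⟶ Z :=
  coequalizer.desc f (by simpa using h)

@[simp]
lemma proj_descTensor {M N : Bimod A A} {Z : C} (f : M.X ⊗ N.X ⟶ Z)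
    (h : M.actRight ▷ N.X ≫ f = (α_ _ _ _).hom ≫ (M.X ◁ N.actLeft) ≫ f) :
    proj M N ≫ descTensor f h = f :=
  coequalizer.π_desc _ _

lemma proj_whiskerLeft (M : Bimod A A) {N₁ N₂ : Bimod A A} (f : N₁ ⟶ N₂) :
    proj M N₁ ≫ (M ◁ f).hom = (M.X ◁ f.hom) ≫ proj M N₂ :=
  ι_colimMap _ _

lemma proj_whiskerRight {M₁ M₂ : Bimod A A} (f : M₁ ⟶ M₂) (N : Bimod A A) :
    proj M₁ N ≫ (f ▷ N).hom = (f.hom ▷ N.X) ≫ proj M₂ N :=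
  ι_colimMap _ _

lemma whiskerLeft_proj_actLeft (M N : Bimod A A) :
    A.X ◁ proj M N ≫ (M ⊗ N).actLeft = (α_ _ _ _).inv ≫ (M.actLeft ▷ N.X) ≫ proj M N :=
  Bimod.TensorBimod.whiskerLeft_π_actLeft M N

lemma proj_whiskerRight_actRight (M N : Bimod A A) :
    proj M N ▷ A.X ≫ (M ⊗ N).actRight = (α_ _ _ _).hom ≫ (M.X ◁ N.actRight) ≫ proj M N :=
  Bimod.TensorBimod.π_tensor_id_actRight M N

lemma proj_associator (M N P : Bimod A A) :
    proj M N ▷ P.X ≫ proj (M ⊗ N) P ≫ (α_ M N P).hom.hom =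
      (α_ M.X N.X P.X).hom ≫ M.X ◁ proj N P ≫ proj M (N ⊗ P) := by
  have h1 : proj (M ⊗ N) P ≫ (α_ M N P).hom.hom = Bimod.AssociatorBimod.homAux M N P :=
    coequalizer.π_desc _ _
  rw [h1]
  exact π_tensor_id_preserves_coequalizer_inv_desc _ _ _ _

lemma proj_associator_inv (M N P : Bimod A A) :
    M.X ◁ proj N P ≫ proj M (N ⊗ P) ≫ (α_ M N P).inv.hom =
      (α_ M.X N.X P.X).inv ≫ proj M N ▷ P.X ≫ proj (M ⊗ N) P := by
  have h : (α_ M N P).hom.hom ≫ (α_ M N P).inv.hom = 𝟙 _ :=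
    congrArg Bimod.Hom.hom (α_ M N P).hom_inv_id
  have h' := proj_associator M N P =≫ (α_ M N P).inv.hom
  simp only [Category.assoc] at h'
  rw [h, Category.comp_id] at h'
  rw [h', Iso.inv_hom_id_assoc]

lemma tensor_hom_ext {M N : Bimod A A} {Z : C} {f g : (M ⊗ N).X ⟶ Z}
    (h : proj M N ≫ f = proj M N ≫ g) : f = g := (cancel_epi _).1 h

end RelativeTensor

section Local

open BraidedCategory

variable {C : Type u} [Category.{v} C] [MonoidalCategory C] [BraidedCategory C]

/-- Local left `A`-modules `(M, ρ)`, regarded as `A`-bimodules: the right action is `ρ ∘ c_{M,A}`, and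
`ρ ∘ c_{M,A} ∘ c_{A,M} = ρ`. -/
def isLocal (A : Mon C) : ObjectProperty (Bimod A A) := fun M =>
  M.actRight = (β_ M.X A.X).hom ≫ M.actLeft ∧
    (β_ A.X M.X).hom ≫ (β_ M.X A.X).hom ≫ M.actLeft = M.actLeft

variable {A : Mon C}

lemma isLocal.right {M : Bimod A A} (h : isLocal A M) :
    (β_ M.X A.X).hom ≫ M.actLeft = M.actRight := h.1.symm

lemma isLocal.left {M : Bimod A A} (h : isLocal A M) :
    (β_ A.X M.X).hom ≫ M.actRight = M.actLeft := by rw [h.1]; exact h.2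

variable (A) in
/-- The category `C_A^0` of local `A`-modules. Its tensor product is `⊗_A`, and its braiding and
twist are induced by those of `C` (instances below). -/
abbrev LocalModule := (isLocal A).FullSubcategory

open MonObj in
lemma left_middle_assoc [IsCommMonObj A.X] (X : C) (ρ : A.X ⊗ X ⟶ X)
    (assoc : μ[A.X] ▷ X ≫ ρ = (α_ A.X A.X X).hom ≫ A.X ◁ ρ ≫ ρ) :
    ρ ▷ A.X ≫ (β_ X A.X).hom ≫ ρ =
      (α_ A.X X A.X).hom ≫ A.X ◁ ((β_ X A.X).hom ≫ ρ) ≫ ρ := by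
  have assoc' : A.X ◁ ρ ≫ ρ = (α_ A.X A.X X).inv ≫ μ[A.X] ▷ X ≫ ρ := by
    rw [assoc, Iso.inv_hom_id_assoc]
  rw [braiding_naturality_left_assoc, assoc', braiding_tensor_left_hom, whiskerLeft_comp_assoc,
    assoc']
  simp only [Category.assoc, Iso.hom_inv_id_assoc]
  rw [← comp_whiskerRight_assoc, IsCommMonObj.mul_comm]

open MonObj in
/-- A left module `ρ : A ⊗ X ⟶ X` over a commutative algebra with `ρ ∘ c_{X,A} ∘ c_{A,X} = ρ`
is a local module, with the right action `ρ ∘ c_{X,A}`. -/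
def LocalModule.ofLeft [IsCommMonObj A.X] (X : C) (ρ : A.X ⊗ X ⟶ X)
    (one_act : η[A.X] ▷ X ≫ ρ = (λ_ X).hom)
    (assoc : μ[A.X] ▷ X ≫ ρ = (α_ A.X A.X X).hom ≫ A.X ◁ ρ ≫ ρ)
    (loc : (β_ A.X X).hom ≫ (β_ X A.X).hom ≫ ρ = ρ) : LocalModule A where
  obj :=
    { X := X
      actLeft := ρ
      one_actLeft := one_act
      left_assoc := assoc
      actRight := (β_ X A.X).hom ≫ ρ
      actRight_one := by
        rw [braiding_naturality_right_assoc, one_act]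
        simp
      right_assoc := by
        rw [braiding_naturality_right_assoc, assoc, comp_whiskerRight_assoc,
          left_middle_assoc X ρ assoc, braiding_tensor_right_hom]
        simp only [Category.assoc, Iso.inv_hom_id_assoc, whiskerLeft_comp_assoc]
      middle_assoc := left_middle_assoc X ρ assoc }
  property := ⟨rfl, loc⟩

/-- A morphism of left modules between local modules is a morphism of local modules. -/
def LocalModule.homOfLeft {M N : LocalModule A} (f : M.obj.X ⟶ N.obj.X)
    (h : M.obj.actLeft ≫ f = A.X ◁ f ≫ N.obj.actLeft) : M ⟶ N :=
  ObjectProperty.homMk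
    { hom := f
      left_act_hom := h
      right_act_hom := by
        rw [M.property.1, N.property.1, Category.assoc, h, braiding_naturality_left_assoc] }

end Local

section LocalModules

variable {C : Type u} [Category.{v} C] [MonoidalCategory C] [BraidedCategory C] [HasCoequalizers C]
  [∀ X : C, PreservesColimitsOfSize.{0, 0} (tensorLeft X)]
  [∀ X : C, PreservesColimitsOfSize.{0, 0} (tensorRight X)]

open BraidedCategory

variable {A : Mon C}

lemma isLocal.tensor {M N : Bimod A A} (hM : isLocal A M) (hN : isLocal A N) :
    isLocal A (M ⊗ N) := by
  have h1 : (M ⊗ N).actRight = (β_ (M ⊗ N).X A.X).hom ≫ (M ⊗ N).actLeft := by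
    rw [← cancel_epi (proj M N ▷ A.X), proj_whiskerRight_actRight,
      braiding_naturality_left_assoc, whiskerLeft_proj_actLeft, braiding_tensor_left_hom]
    simp only [Category.assoc, Iso.hom_inv_id_assoc]
    rw [← comp_whiskerRight_assoc, hM.right, proj_condition, Iso.inv_hom_id_assoc,
      ← whiskerLeft_comp_assoc, hN.right]
  refine ⟨h1, ?_⟩
  rw [← h1, ← cancel_epi (A.X ◁ proj M N), whiskerLeft_proj_actLeft,
    braiding_naturality_right_assoc, proj_whiskerRight_actRight, braiding_tensor_right_hom]
  simp only [Category.assoc, Iso.inv_hom_id_assoc]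
  rw [← whiskerLeft_comp_assoc, hN.left, ← proj_condition, ← comp_whiskerRight_assoc, hM.left]

instance [IsCommMonObj A.X] : (isLocal A).IsMonoidal where
  prop_unit := by
    have h : (β_ A.X A.X).hom ≫ MonObj.mul (X := A.X) = MonObj.mul := IsCommMonObj.mul_comm _
    refine ⟨h.symm, ?_⟩
    change (β_ A.X A.X).hom ≫ (β_ A.X A.X).hom ≫ MonObj.mul (X := A.X) = MonObj.mul
    rw [h, h]
  prop_tensor _ _ := isLocal.tensor

lemma braid_aux {M N : Bimod A A} (hM : isLocal A M) (hN : isLocal A N) :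
    M.actRight ▷ N.X ≫ (β_ M.X N.X).hom ≫ proj N M =
      (α_ _ _ _).hom ≫ (M.X ◁ N.actLeft) ≫ (β_ M.X N.X).hom ≫ proj N M := by
  rw [braiding_naturality_left_assoc, braiding_naturality_right_assoc, ← hM.right, ← hN.left,
    comp_whiskerRight_assoc, proj_condition, whiskerLeft_comp_assoc,
    braiding_tensor_left_hom, braiding_tensor_right_hom]
  have := yang_baxter_assoc M.X A.X N.X (N.X ◁ M.actLeft ≫ proj N M)
  simp only [Category.assoc] at this ⊢
  rw [← this]

lemma braid_inv_aux {M N : Bimod A A} (hM : isLocal A M) (hN : isLocal A N) :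
    N.actRight ▷ M.X ≫ (β_ M.X N.X).inv ≫ proj M N =
      (α_ _ _ _).hom ≫ (N.X ◁ M.actLeft) ≫ (β_ M.X N.X).inv ≫ proj M N := by
  have hN' : N.actRight = (β_ A.X N.X).inv ≫ N.actLeft := by
    rw [← hN.left, Iso.inv_hom_id_assoc]
  have hM' : M.actLeft = (β_ M.X A.X).inv ≫ M.actRight := by
    rw [← hM.right, Iso.inv_hom_id_assoc]
  rw [braiding_inv_naturality_right_assoc, braiding_inv_naturality_left_assoc, hN', hM',
    whiskerLeft_comp_assoc, comp_whiskerRight_assoc, proj_condition,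
    braiding_tensor_left_inv, braiding_tensor_right_inv]
  have h := IsIso.inv_eq_inv.2 (yang_baxter M.X A.X N.X)
  simp only [IsIso.inv_comp, inv_whiskerLeft, inv_whiskerRight, IsIso.Iso.inv_hom,
    IsIso.Iso.inv_inv, Category.assoc] at h
  have h' := h =≫ (M.X ◁ N.actLeft ≫ proj M N)
  simp only [Category.assoc] at h' ⊢
  rw [← cancel_epi (α_ N.X A.X M.X).inv]
  simp only [Iso.inv_hom_id_assoc]
  simpa using h'.symm

/-- The morphism `M ⊗_A N ⟶ N ⊗_A M` induced by `c_{M,N}`. -/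
def localBraidingHom (M N : LocalModule A) : (M.obj ⊗ N.obj).X ⟶ (N.obj ⊗ M.obj).X :=
  descTensor ((β_ M.obj.X N.obj.X).hom ≫ proj N.obj M.obj) (braid_aux M.property N.property)

/-- The morphism `N ⊗_A M ⟶ M ⊗_A N` induced by the inverse of `c_{M,N}`. -/
def localBraidingInv (M N : LocalModule A) : (N.obj ⊗ M.obj).X ⟶ (M.obj ⊗ N.obj).X :=
  descTensor ((β_ M.obj.X N.obj.X).inv ≫ proj M.obj N.obj) (braid_inv_aux M.property N.property)

@[simp]
lemma proj_localBraidingHom (M N : LocalModule A) :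
    proj M.obj N.obj ≫ localBraidingHom M N = (β_ M.obj.X N.obj.X).hom ≫ proj N.obj M.obj :=
  proj_descTensor _ _

@[simp]
lemma proj_localBraidingInv (M N : LocalModule A) :
    proj N.obj M.obj ≫ localBraidingInv M N = (β_ M.obj.X N.obj.X).inv ≫ proj M.obj N.obj :=
  proj_descTensor _ _

/-- The braiding `M ⊗_A N ≅ N ⊗_A M` of local modules, induced by `c_{M,N}`. -/
def localBraiding (M N : LocalModule A) : M.obj ⊗ N.obj ≅ N.obj ⊗ M.obj :=
  Bimod.isoOfIso
    { hom := localBraidingHom M N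
      inv := localBraidingInv M N
      hom_inv_id := tensor_hom_ext (by simp [reassoc_of% proj_localBraidingHom])
      inv_hom_id := tensor_hom_ext (by simp [reassoc_of% proj_localBraidingInv]) }
    (by
      change _ ≫ localBraidingHom M N = A.X ◁ localBraidingHom M N ≫ _
      rw [← cancel_epi (A.X ◁ proj M.obj N.obj), reassoc_of% whiskerLeft_proj_actLeft,
        proj_localBraidingHom, ← whiskerLeft_comp_assoc, proj_localBraidingHom,
        whiskerLeft_comp_assoc, whiskerLeft_proj_actLeft, braiding_naturality_left_assoc,
        braiding_tensor_left_hom]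
      simp only [Category.assoc, Iso.inv_hom_id_assoc]
      rw [← proj_condition, ← comp_whiskerRight_assoc, N.property.left])
    (by
      change _ ≫ localBraidingHom M N = localBraidingHom M N ▷ A.X ≫ _
      rw [← cancel_epi (proj M.obj N.obj ▷ A.X), reassoc_of% proj_whiskerRight_actRight,
        proj_localBraidingHom, ← comp_whiskerRight_assoc, proj_localBraidingHom,
        comp_whiskerRight_assoc, proj_whiskerRight_actRight, braiding_naturality_right_assoc,
        braiding_tensor_right_hom]
      simp only [Category.assoc, Iso.hom_inv_id_assoc]
      rw [proj_condition, Iso.inv_hom_id_assoc, ← whiskerLeft_comp_assoc, M.property.right])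

@[simp]
lemma proj_localBraiding (M N : LocalModule A) :
    proj M.obj N.obj ≫ (localBraiding M N).hom.hom =
      (β_ M.obj.X N.obj.X).hom ≫ proj N.obj M.obj :=
  proj_localBraidingHom M N

variable [IsCommMonObj A.X]

lemma local_hom_ext {M N P : LocalModule A} {f g : M ⊗ N ⟶ P}
    (h : proj M.obj N.obj ≫ f.hom.hom = proj M.obj N.obj ≫ g.hom.hom) : f = g := by
  apply ObjectProperty.hom_ext
  apply Bimod.hom_ext
  exact tensor_hom_ext h

lemma local_hom_ext₂ {M N P Q : LocalModule A} {f g : (M ⊗ N) ⊗ P ⟶ Q}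
    (h : proj M.obj N.obj ▷ P.obj.X ≫ proj (M.obj ⊗ N.obj) P.obj ≫ f.hom.hom =
      proj M.obj N.obj ▷ P.obj.X ≫ proj (M.obj ⊗ N.obj) P.obj ≫ g.hom.hom) : f = g := by
  apply local_hom_ext
  exact (cancel_epi (proj M.obj N.obj ▷ P.obj.X)).1 h

lemma local_hom_ext₂' {M N P Q : LocalModule A} {f g : M ⊗ (N ⊗ P) ⟶ Q}
    (h : M.obj.X ◁ proj N.obj P.obj ≫ proj M.obj (N.obj ⊗ P.obj) ≫ f.hom.hom =
      M.obj.X ◁ proj N.obj P.obj ≫ proj M.obj (N.obj ⊗ P.obj) ≫ g.hom.hom) : f = g := by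
  apply local_hom_ext
  exact (cancel_epi (M.obj.X ◁ proj N.obj P.obj)).1 h

instance : BraidedCategory (LocalModule A) where
  braiding M N := (isLocal A).isoMk (localBraiding M N)
  braiding_naturality_right M N₁ N₂ f := by
    apply local_hom_ext
    change proj M.obj N₁.obj ≫ (M.obj ◁ f.hom).hom ≫ (localBraiding M N₂).hom.hom =
      proj M.obj N₁.obj ≫ (localBraiding M N₁).hom.hom ≫ (f.hom ▷ M.obj).hom
    rw [reassoc_of% proj_whiskerLeft, proj_localBraiding, reassoc_of% proj_localBraiding, proj_whiskerRight,
      braiding_naturality_right_assoc]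
  braiding_naturality_left {M₁ M₂} f N := by
    apply local_hom_ext
    change proj M₁.obj N.obj ≫ (f.hom ▷ N.obj).hom ≫ (localBraiding M₂ N).hom.hom =
      proj M₁.obj N.obj ≫ (localBraiding M₁ N).hom.hom ≫ (N.obj ◁ f.hom).hom
    rw [reassoc_of% proj_whiskerRight, proj_localBraiding, reassoc_of% proj_localBraiding, proj_whiskerLeft,
      braiding_naturality_left_assoc]
  hexagon_forward M N P := by
    apply local_hom_ext₂
    change proj M.obj N.obj ▷ P.obj.X ≫ proj (M.obj ⊗ N.obj) P.obj ≫
        (α_ M.obj N.obj P.obj).hom.hom ≫ (localBraiding M (N ⊗ P)).hom.hom ≫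
          (α_ N.obj P.obj M.obj).hom.hom =
      proj M.obj N.obj ▷ P.obj.X ≫ proj (M.obj ⊗ N.obj) P.obj ≫
        ((localBraiding M N).hom ▷ P.obj).hom ≫ (α_ N.obj M.obj P.obj).hom.hom ≫
          (N.obj ◁ (localBraiding M P).hom).hom
    have h1 : proj M.obj (N.obj ⊗ P.obj) ≫ (localBraiding M (N ⊗ P)).hom.hom =
      (β_ M.obj.X (N.obj ⊗ P.obj).X).hom ≫ proj (N.obj ⊗ P.obj) M.obj :=
      proj_localBraiding M (N ⊗ P)
    rw [reassoc_of% proj_associator, reassoc_of% h1, braiding_naturality_right_assoc, proj_associator,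
      hexagon_forward_assoc, reassoc_of% proj_whiskerRight, ← comp_whiskerRight_assoc,
      proj_localBraiding, comp_whiskerRight_assoc, reassoc_of% proj_associator, proj_whiskerLeft,
      ← whiskerLeft_comp_assoc, ← proj_localBraiding, whiskerLeft_comp_assoc]
  hexagon_reverse M N P := by
    apply local_hom_ext₂'
    change M.obj.X ◁ proj N.obj P.obj ≫ proj M.obj (N.obj ⊗ P.obj) ≫
        (α_ M.obj N.obj P.obj).inv.hom ≫ (localBraiding (M ⊗ N) P).hom.hom ≫
          (α_ P.obj M.obj N.obj).inv.hom =
      M.obj.X ◁ proj N.obj P.obj ≫ proj M.obj (N.obj ⊗ P.obj) ≫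
        (M.obj ◁ (localBraiding N P).hom).hom ≫ (α_ M.obj P.obj N.obj).inv.hom ≫
          ((localBraiding M P).hom ▷ N.obj).hom
    have h1 : proj (M.obj ⊗ N.obj) P.obj ≫ (localBraiding (M ⊗ N) P).hom.hom =
      (β_ (M.obj ⊗ N.obj).X P.obj.X).hom ≫ proj P.obj (M.obj ⊗ N.obj) :=
      proj_localBraiding (M ⊗ N) P
    rw [reassoc_of% proj_associator_inv, reassoc_of% h1, braiding_naturality_left_assoc,
      proj_associator_inv, hexagon_reverse_assoc, reassoc_of% proj_whiskerLeft,
      ← whiskerLeft_comp_assoc, proj_localBraiding, whiskerLeft_comp_assoc,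
      reassoc_of% proj_associator_inv, proj_whiskerRight, ← comp_whiskerRight_assoc,
      ← proj_localBraiding, comp_whiskerRight_assoc]

end LocalModules

section LocalTwist

variable {C : Type u} [Category.{v} C] [MonoidalCategory C] [BraidedCategory C] [Twist C]

variable {A : Mon C} [TrivialTwist A.X]

lemma θ_actLeft {M : Bimod A A} (hM : isLocal A M) :
    M.actLeft ≫ (θ M.X).hom = A.X ◁ (θ M.X).hom ≫ M.actLeft := by
  rw [θ_naturality, θ_tensor, TrivialTwist.twist_eq, id_tensorHom, Category.assoc, Category.assoc,
    hM.2]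

lemma θ_actRight {M : Bimod A A} (hM : isLocal A M) :
    M.actRight ≫ (θ M.X).hom = (θ M.X).hom ▷ A.X ≫ M.actRight := by
  rw [← hM.right, Category.assoc, θ_actLeft hM,
    BraidedCategory.braiding_naturality_left_assoc]

/-- The twist of a local module is the twist of its underlying object. -/
def localTwist (M : LocalModule A) : M ≅ M :=
  (isLocal A).isoMk (Bimod.isoOfIso (θ M.obj.X) (θ_actLeft M.property) (θ_actRight M.property))

variable [HasCoequalizers C] [∀ X : C, PreservesColimitsOfSize.{0, 0} (tensorLeft X)]
  [∀ X : C, PreservesColimitsOfSize.{0, 0} (tensorRight X)] [IsCommMonObj A.X]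

instance : Twist (LocalModule A) where
  twist M := localTwist M
  naturality f := by
    apply ObjectProperty.hom_ext
    apply Bimod.hom_ext
    exact θ_naturality f.hom.hom
  twist_tensor M N := by
    apply local_hom_ext
    change proj M.obj N.obj ≫ (θ (M.obj ⊗ N.obj).X).hom = proj M.obj N.obj ≫
      (((localTwist M).hom ⊗ₘ (localTwist N).hom).hom.hom ≫ (localBraiding M N).hom.hom ≫
        (localBraiding N M).hom.hom)
    have h : proj M.obj N.obj ≫ ((localTwist M).hom ⊗ₘ (localTwist N).hom).hom.hom =
        ((θ M.obj.X).hom ⊗ₘ (θ N.obj.X).hom) ≫ proj M.obj N.obj := by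
      change proj M.obj N.obj ≫ ((localTwist M).hom.hom ▷ N.obj).hom ≫
        (M.obj ◁ (localTwist N).hom.hom).hom = _
      rw [reassoc_of% proj_whiskerRight, proj_whiskerLeft, MonoidalCategory.tensorHom_def, Category.assoc]
      rfl
    rw [reassoc_of% h, θ_naturality, θ_tensor, reassoc_of% proj_localBraiding, proj_localBraiding]
    simp only [Category.assoc]

end LocalTwist

section Linear

variable {C : Type u} [Category.{v} C] [MonoidalCategory C] [Preadditive C] [MonoidalPreadditive C]
  {A B : Mon C}

lemma whiskerLeft_neg' (X : C) {Y Z : C} (f : Y ⟶ Z) : X ◁ (-f) = -(X ◁ f) :=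
  (tensorLeft X).map_neg (f := f)

lemma neg_whiskerRight' (X : C) {Y Z : C} (f : Y ⟶ Z) : (-f) ▷ X = -(f ▷ X) :=
  (tensorRight X).map_neg (f := f)

instance (M N : Bimod A B) : Zero (M ⟶ N) := ⟨⟨0, by simp, by simp⟩⟩

instance (M N : Bimod A B) : Add (M ⟶ N) := ⟨fun f g => ⟨f.hom + g.hom,
  by simp [Preadditive.comp_add, Preadditive.add_comp, MonoidalPreadditive.whiskerLeft_add],
  by simp [Preadditive.comp_add, Preadditive.add_comp, MonoidalPreadditive.add_whiskerRight]⟩⟩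

instance (M N : Bimod A B) : Neg (M ⟶ N) :=
  ⟨fun f => ⟨-f.hom, by simp [whiskerLeft_neg'], by simp [neg_whiskerRight']⟩⟩

instance (M N : Bimod A B) : AddCommGroup (M ⟶ N) where
  add_assoc f g h := Bimod.hom_ext _ _ (add_assoc f.hom g.hom h.hom)
  zero_add f := Bimod.hom_ext _ _ (zero_add f.hom)
  add_zero f := Bimod.hom_ext _ _ (add_zero f.hom)
  neg_add_cancel f := Bimod.hom_ext _ _ (neg_add_cancel f.hom)
  add_comm f g := Bimod.hom_ext _ _ (add_comm f.hom g.hom)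
  nsmul := nsmulRec
  zsmul := zsmulRec

instance : Preadditive (Bimod A B) where
  homGroup := inferInstance
  add_comp _ _ _ f g h := Bimod.hom_ext _ _ (Preadditive.add_comp _ _ _ f.hom g.hom h.hom)
  comp_add _ _ _ f g h := Bimod.hom_ext _ _ (Preadditive.comp_add _ _ _ f.hom g.hom h.hom)

variable [Linear ℂ C] [MonoidalLinear ℂ C]

instance (M N : Bimod A B) : Module ℂ (M ⟶ N) where
  smul c f := ⟨c • f.hom, by simp, by simp⟩
  one_smul f := Bimod.hom_ext _ _ (one_smul ℂ f.hom)
  mul_smul c d f := Bimod.hom_ext _ _ (mul_smul c d f.hom)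
  smul_zero c := Bimod.hom_ext _ _ (smul_zero c)
  smul_add c f g := Bimod.hom_ext _ _ (smul_add c f.hom g.hom)
  add_smul c d f := Bimod.hom_ext _ _ (add_smul c d f.hom)
  zero_smul f := Bimod.hom_ext _ _ (zero_smul ℂ f.hom)

instance : Linear ℂ (Bimod A B) where
  homModule := inferInstance
  smul_comp _ _ _ c f g := Bimod.hom_ext _ _ (Linear.smul_comp _ _ _ c f.hom g.hom)
  comp_smul _ _ _ f c g := Bimod.hom_ext _ _ (Linear.comp_smul _ _ _ f.hom c g.hom)

end Linear

section Rep
open TannakaDuality.FiniteGroup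
variable (H : Type) [Group H] [Finite H]

/-- The algebra `Fun(H)` of complex functions on `H`, with pointwise multiplication and `H` acting
by translations, as an object of `Rep(H)`. -/
abbrev funRep : FDRep ℂ H := rightFDRep (k := ℂ) (G := H)

/-- The unit of `Fun(H)`: the inclusion of the constant functions. -/
def funUnit : 𝟙_ (FDRep ℂ H) ⟶ funRep H where
  hom := InducedCategory.homMk (ModuleCat.ofHom (Algebra.linearMap ℂ (H → ℂ)))
  comm := by
    intro
    ext
    rfl

instance : MonObj (funRep H) where
  one := funUnit H
  mul := mulRepHom
  one_mul := by
    apply Action.Hom.ext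
    apply ObjectProperty.hom_ext
    apply ModuleCat.hom_ext
    apply TensorProduct.ext'
    intro (a : ℂ) (f : H → ℂ)
    exact (Algebra.smul_def a f).symm
  mul_one := by
    apply Action.Hom.ext
    apply ObjectProperty.hom_ext
    apply ModuleCat.hom_ext
    apply TensorProduct.ext'
    intro (f : H → ℂ) (a : ℂ)
    exact (Algebra.commutes a f).symm.trans (Algebra.smul_def a f).symm
  mul_assoc := by
    apply Action.Hom.ext
    apply ObjectProperty.hom_ext
    apply ModuleCat.hom_ext
    apply TensorProduct.ext_threefold
    intro (f : H → ℂ) (g : H → ℂ) (h : H → ℂ)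
    exact mul_assoc f g h

instance : IsCommMonObj (funRep H) where
  mul_comm := by
    apply Action.Hom.ext
    apply ObjectProperty.hom_ext
    apply ModuleCat.hom_ext
    apply TensorProduct.ext'
    intro (f : H → ℂ) (g : H → ℂ)
    exact mul_comm g f

/-- The twist of `Rep(H)` is the identity. -/
instance (H : Type) [Group H] : Twist (FDRep ℂ H) where
  twist X := Iso.refl X
  naturality _ := by simp
  twist_tensor _ _ := by simp

end Rep
section Tannakian

attribute [local instance] Abelian.hasFiniteBiproducts

variable {C : Type u} [Category.{v} C] [Abelian C] [Linear ℂ C] [MonoidalCategory C]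
  [BraidedCategory C] [Twist C]

/-- The full subcategory generated by a group `G` of isomorphism classes of invertible objects: the
finite direct sums of objects whose classes lie in `G`. -/
def generatedBy (G : Subgroup (Skeleton C)ˣ) : ObjectProperty C := fun X =>
  ∃ (m : ℕ) (L : Fin m → C), (∀ i, ∃ g ∈ G, toSkeleton (L i) = (g : Skeleton C)) ∧
    Nonempty (X ≅ ⨁ L)

/-- An equivalence of premodular categories (`ℂ`-linear, braided monoidal and compatible with
twists) from `Rep(H)`, for a finite group `H`, to the full subcategory of `C` generated by `G`.
The group `G` is Tannakian when such an equivalence exists. -/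
structure TannakianEquivalence (G : Subgroup (Skeleton C)ˣ) where
  /-- the finite group -/
  H : Type
  [group : Group H]
  [finite : Finite H]
  /-- the equivalence, as a functor to `C` -/
  F : FDRep ℂ H ⥤ C
  [braided : F.Braided]
  [additive : F.Additive]
  [linear : F.Linear ℂ]
  [full : F.Full]
  [faithful : F.Faithful]
  map_twist (V : FDRep ℂ H) : F.map (θ V).hom = (θ (F.obj V)).hom
  essImage_eq : F.essImage = generatedBy G

attribute [instance] TannakianEquivalence.group TannakianEquivalence.finite
  TannakianEquivalence.braided TannakianEquivalence.additive TannakianEquivalence.linear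
  TannakianEquivalence.full TannakianEquivalence.faithful

variable {G : Subgroup (Skeleton C)ˣ}

open scoped Obj in
/-- The regular algebra `A ∈ C` of the Tannakian subcategory: the image of `Fun(H)`. -/
def TannakianEquivalence.regularAlgebra (E : TannakianEquivalence G) : Mon C :=
  Mon.mk (E.F.obj (funRep E.H))

open scoped Obj in
instance (E : TannakianEquivalence G) : IsCommMonObj E.regularAlgebra.X :=
  inferInstanceAs (IsCommMonObj (E.F.obj (funRep E.H)))

instance (E : TannakianEquivalence G) : TrivialTwist E.regularAlgebra.X where
  twist_eq := (E.map_twist (funRep E.H)).symm.trans (E.F.map_id _)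

/-- The category `C_G^0` of local modules over the regular algebra. -/
abbrev TannakianEquivalence.Condensation (E : TannakianEquivalence G) :=
  LocalModule E.regularAlgebra

end Tannakian

end

end Premodular

/-!
Write `A` for the regular algebra, `θ_X` and `d_X` for twists and dimensions of simple objects of
`C`, and `θ_M`, `d_M` for those of simple local modules. Both sides of the identity
`τ_n(C) = |G| τ_n(C_G^0)` are equal to the sum of `θ_X ^ n * d_X ^ 2` over the simple objects `X`
that centralize `G`.

*The category `C`* (`gaussSum_eq_sum_centralizing`). For `g ∈ G` and `X` simple, the double braiding
of `g` and `X` is a scalar `b(g, X)`, and `b(·, X)` is a character of `G`. Since `g` has twist and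
dimension `1`, one has `θ_{gX} = θ_X b(g, X)` and `d_{gX} = d_X`. As `X ↦ gX` permutes the simple
objects, averaging over `g` gives `|G| τ_n(C) = ∑_X θ_X ^ n d_X ^ 2 ∑_g b(g, X) ^ n`. The inner sum
is `0` unless `b(·, X) ^ n` is trivial. As `b(g, X) ^ ord(T) = 1` and `n` is coprime to `ord(T)`,
this happens only if `b(·, X)` itself is trivial.

*The category `C_G^0`* (`card_mul_gaussSum`). Let `m(X, M) = dim Hom_C(X, M)`. If it is nonzero,
then `θ_X = θ_M`, and `X` centralizes `A`. The identity follows by double counting from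
`|G| d_M = ∑_X m(X, M) d_X` and, for `X` centralizing `A`, from `d_X = ∑_M m(X, M) d_M`; the second
formula is the decomposition of the free module `A ⊗ X`, which is local, by Frobenius reciprocity.

Behind these formulas are three facts about local modules, all consequences of the
comultiplication `δ_h ↦ δ_h ⊗ δ_h` of `Fun(H)`, which makes `A` a special Frobenius algebra.
* Averaging over the Casimir element splits monomorphisms (Maschke), so that local modules are
  semisimple: `SpecialFrobenius.nonempty_simpleDecomposition`.
* The translations by elements of `H` show that `A` is a Galois algebra, and therefore the double
  braiding of `A` with every local module is the identity, not only after acting: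
  `GaloisFrobenius.monodromy_eq_id`. In particular, duals of local modules are local.
* The dual of a local module `M` in `C` is its dual over `A`, and the evaluations are related by the
  counit; as `A` is connected and the counit takes the unit to `|H|`, the dimension of `M` in `C` is
  `|H| d_M`: `exists_dual_qdim_eq`. For `M = A` this gives `|H| = dim A = |G|`.
-/

open CategoryTheory MonoidalCategory Limits

namespace Premodular

noncomputable section

/-! ### Traces and dimensions in braided categories with a twist -/

section Traces

open ExactPairing BraidedCategory

variable {C : Type u} [Category.{v} C] [MonoidalCategory C]

/-- The evaluation is nondegenerate. -/
lemma leftDual_hom_ext {X Y W : C} [ExactPairing X Y] {f g : W ⟶ X}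
    (h : Y ◁ f ≫ ε_ X Y = Y ◁ g ≫ ε_ X Y) : f = g := by
  have key : ∀ k : W ⟶ X, k = 𝟙 _ ⊗≫ η_ X Y ▷ W ⊗≫ X ◁ (Y ◁ k ≫ ε_ X Y) ⊗≫ 𝟙 _ := by
    intro k
    calc k = k ⊗≫ (η_ X Y ▷ X ⊗≫ X ◁ ε_ X Y) ⊗≫ 𝟙 _ := by
          rw [evaluation_coevaluation'']; monoidal
      _ = 𝟙 _ ⊗≫ (𝟙_ C ◁ k ≫ η_ X Y ▷ X) ⊗≫ X ◁ ε_ X Y ⊗≫ 𝟙 _ := by monoidal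
      _ = _ := by rw [whisker_exchange]; monoidal
  rw [key f, key g, h]

/-- The transpose `Y₂ ⟶ Y₁` of a morphism `X₁ ⟶ X₂` between objects with duals `Y₁` and `Y₂`. -/
def transpose {X₁ Y₁ X₂ Y₂ : C} [ExactPairing X₁ Y₁] [ExactPairing X₂ Y₂] (f : X₁ ⟶ X₂) :
    Y₂ ⟶ Y₁ :=
  letI : HasRightDual X₁ := ⟨Y₁⟩
  letI : HasRightDual X₂ := ⟨Y₂⟩
  rightAdjointMate f

lemma transpose_evaluation {X₁ Y₁ X₂ Y₂ : C} [ExactPairing X₁ Y₁] [ExactPairing X₂ Y₂]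
    (f : X₁ ⟶ X₂) : (transpose f : Y₂ ⟶ Y₁) ▷ X₁ ≫ ε_ X₁ Y₁ = Y₂ ◁ f ≫ ε_ X₂ Y₂ :=
  letI : HasRightDual X₁ := ⟨Y₁⟩
  letI : HasRightDual X₂ := ⟨Y₂⟩
  rightAdjointMate_comp_evaluation f

lemma coevaluation_transpose {X₁ Y₁ X₂ Y₂ : C} [ExactPairing X₁ Y₁] [ExactPairing X₂ Y₂]
    (f : X₁ ⟶ X₂) : η_ X₂ Y₂ ≫ X₂ ◁ (transpose f : Y₂ ⟶ Y₁) = η_ X₁ Y₁ ≫ f ▷ Y₁ :=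
  letI : HasRightDual X₁ := ⟨Y₁⟩
  letI : HasRightDual X₂ := ⟨Y₂⟩
  coevaluation_comp_rightAdjointMate f

variable [BraidedCategory C]

/-- The hexagon and Yang–Baxter equations rearrange the braidings that occur in the trace of `X ⊗ Y`
so that `X` crosses `Y ⊗ Z` as a whole, and `Y` crosses `X ⊗ W`. With `Z` and `W` dual to `Y` and
`X`, naturality applies to the coevaluations `𝟙_ ⟶ Y ⊗ Z` and `𝟙_ ⟶ X ⊗ W`. -/
lemma double_braiding_tensor (X Y Z W : C) :
    ((β_ X Y).hom ≫ (β_ Y X).hom) ▷ (Z ⊗ W) ≫ (β_ (X ⊗ Y) (Z ⊗ W)).hom =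
      𝟙 _ ⊗≫ (β_ X (Y ⊗ Z)).hom ▷ W ⊗≫ (β_ Y Z).hom ▷ X ▷ W ⊗≫ Z ◁ (β_ Y (X ⊗ W)).hom ⊗≫
        Z ◁ (β_ X W).hom ▷ Y ⊗≫ 𝟙 _ := by
  calc _ = 𝟙 _ ⊗≫ (β_ X Y).hom ▷ Z ▷ W ⊗≫ ((β_ Y X).hom ▷ Z ⊗≫ X ◁ (β_ Y Z).hom ⊗≫
        (β_ X Z).hom ▷ Y) ▷ W ⊗≫ Z ◁ X ◁ (β_ Y W).hom ⊗≫
        Z ◁ (β_ X W).hom ▷ Y ⊗≫ 𝟙 _ := by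
        simp only [braiding_tensor_left_hom, braiding_tensor_right_hom]
        monoidal
    _ = _ := by
        rw [yang_baxter']
        simp only [braiding_tensor_right_hom]
        monoidal

variable [Twist C]

/-- The trace is cyclic; in particular it does not depend on the choice of duals. -/
lemma traceHom_comp_comm {X₁ Y₁ X₂ Y₂ : C} [ExactPairing X₁ Y₁] [ExactPairing X₂ Y₂]
    (f : X₁ ⟶ X₂) (g : X₂ ⟶ X₁) : traceHom X₁ Y₁ (f ≫ g) = traceHom X₂ Y₂ (g ≫ f) := by
  unfold traceHom
  rw [Category.assoc, θ_naturality, comp_whiskerRight, comp_whiskerRight, Category.assoc,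
    Category.assoc, braiding_naturality_left_assoc, ← transpose_evaluation (Y₁ := Y₂) (Y₂ := Y₁) g,
    ← braiding_naturality_right_assoc, ← whisker_exchange_assoc, ← whisker_exchange_assoc,
    reassoc_of% coevaluation_transpose (Y₁ := Y₂) (Y₂ := Y₁) g, comp_whiskerRight,
    comp_whiskerRight, Category.assoc, Category.assoc]

/-- The coevaluation on the other side of an object with a dual, built from the twist and the
braiding. -/
def curl (X Y : C) [ExactPairing X Y] : 𝟙_ C ⟶ Y ⊗ X :=
  η_ X Y ≫ (θ X).hom ▷ Y ≫ (β_ X Y).hom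

lemma traceHom_id (X Y : C) [ExactPairing X Y] : traceHom X Y (𝟙 X) = curl X Y ≫ ε_ X Y := by
  simp [traceHom, curl]

/-- The curls of `X₁` and `X₂` are nested, not linked. -/
lemma curl_tensor (X₁ Y₁ X₂ Y₂ : C) [ExactPairing X₁ Y₁] [ExactPairing X₂ Y₂] :
    curl (X₁ ⊗ X₂) (Y₂ ⊗ Y₁) = curl X₂ Y₂ ⊗≫ Y₂ ◁ (curl X₁ Y₁) ▷ X₂ ⊗≫ 𝟙 _ := by
  calc _ = η_ X₁ Y₁ ⊗≫ (X₁ ◁ η_ X₂ Y₂) ▷ Y₁ ⊗≫ ((θ X₁).hom ⊗ₘ (θ X₂).hom) ▷ (Y₂ ⊗ Y₁) ≫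
        (((β_ X₁ X₂).hom ≫ (β_ X₂ X₁).hom) ▷ (Y₂ ⊗ Y₁) ≫ (β_ (X₁ ⊗ X₂) (Y₂ ⊗ Y₁)).hom) := by
        rw [curl, tensor_coevaluation, θ_tensor]
        monoidal
    _ = (η_ X₁ Y₁ ≫ (θ X₁).hom ▷ Y₁) ⊗≫ (X₁ ◁ (η_ X₂ Y₂ ≫ (θ X₂).hom ▷ Y₂) ≫
          (β_ X₁ (X₂ ⊗ Y₂)).hom) ▷ Y₁ ⊗≫ (β_ X₂ Y₂).hom ▷ X₁ ▷ Y₁ ⊗≫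
          Y₂ ◁ (β_ X₂ (X₁ ⊗ Y₁)).hom ⊗≫ Y₂ ◁ (β_ X₁ Y₁).hom ▷ X₂ ⊗≫ 𝟙 _ := by
        rw [double_braiding_tensor]
        calc _ = η_ X₁ Y₁ ⊗≫ (X₁ ◁ η_ X₂ Y₂ ≫ (θ X₁).hom ▷ (X₂ ⊗ Y₂)) ▷ Y₁ ⊗≫
              X₁ ◁ (θ X₂).hom ▷ Y₂ ▷ Y₁ ⊗≫ (β_ X₁ (X₂ ⊗ Y₂)).hom ▷ Y₁ ⊗≫
              (β_ X₂ Y₂).hom ▷ X₁ ▷ Y₁ ⊗≫ Y₂ ◁ (β_ X₂ (X₁ ⊗ Y₁)).hom ⊗≫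
              Y₂ ◁ (β_ X₁ Y₁).hom ▷ X₂ ⊗≫ 𝟙 _ := by
              rw [MonoidalCategory.tensorHom_def]
              monoidal
          _ = _ := by
              rw [whisker_exchange]
              monoidal
    _ = 𝟙 _ ⊗≫ (𝟙_ C ◁ (η_ X₁ Y₁ ≫ (θ X₁).hom ▷ Y₁) ≫ curl X₂ Y₂ ▷ (X₁ ⊗ Y₁)) ⊗≫
          Y₂ ◁ (β_ X₂ (X₁ ⊗ Y₁)).hom ⊗≫ Y₂ ◁ (β_ X₁ Y₁).hom ▷ X₂ ⊗≫ 𝟙 _ := by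
        rw [braiding_naturality_right, braiding_tensorUnit_right, curl]
        monoidal
    _ = curl X₂ Y₂ ⊗≫ Y₂ ◁ (X₂ ◁ (η_ X₁ Y₁ ≫ (θ X₁).hom ▷ Y₁) ≫ (β_ X₂ (X₁ ⊗ Y₁)).hom) ⊗≫
          Y₂ ◁ (β_ X₁ Y₁).hom ▷ X₂ ⊗≫ 𝟙 _ := by
        rw [whisker_exchange]
        monoidal
    _ = _ := by
        rw [braiding_naturality_right, braiding_tensorUnit_right]
        simp only [curl]
        monoidal

/-- The dimension of `X₁ ⊗ X₂` is a circle for `X₁` inside a circle for `X₂`; therefore dimensions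
are multiplicative once endomorphisms of the unit are scalars. -/
lemma traceHom_tensor (X₁ Y₁ X₂ Y₂ : C) [ExactPairing X₁ Y₁] [ExactPairing X₂ Y₂] :
    traceHom (X₁ ⊗ X₂) (Y₂ ⊗ Y₁) (𝟙 _) =
      curl X₂ Y₂ ⊗≫ Y₂ ◁ (traceHom X₁ Y₁ (𝟙 X₁)) ▷ X₂ ⊗≫ ε_ X₂ Y₂ := by
  simp only [traceHom_id, curl_tensor, tensor_evaluation]
  monoidal

end Traces

section Scalars

variable {D : Type u} [Category.{v} D] [Preadditive D] [Linear ℂ D]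

lemma scalar_smul_id {X : D} (hX : 𝟙 X ≠ 0) (c : ℂ) : scalar (c • 𝟙 X) = c := by
  have h : ∃ d : ℂ, c • 𝟙 X = d • 𝟙 X := ⟨c, rfl⟩
  rw [scalar, dif_pos h]
  exact (smul_left_injective ℂ hX h.choose_spec).symm

lemma eq_scalar_smul {X : D} {f : X ⟶ X} (h : ∃ c : ℂ, f = c • 𝟙 X) :
    f = scalar f • 𝟙 X := by
  rw [scalar, dif_pos h]
  exact h.choose_spec

lemma scalar_conj {X Y : D} (e : X ≅ Y) (hX : 𝟙 X ≠ 0) {f : X ⟶ X} {g : Y ⟶ Y}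
    (h : f ≫ e.hom = e.hom ≫ g) (hg : ∃ c : ℂ, g = c • 𝟙 Y) : scalar f = scalar g := by
  obtain ⟨c, rfl⟩ := hg
  have hf : f = c • 𝟙 X := by
    rw [← cancel_mono e.hom, h]
    simp
  have hY : 𝟙 Y ≠ 0 := fun h0 => hX (by
    rw [← e.hom_inv_id, ← Category.id_comp e.inv, h0]
    simp)
  rw [hf, scalar_smul_id hX, scalar_smul_id hY]

end Scalars

section Dimensions

open ExactPairing

variable {D : Type u} [Category.{v} D] [Preadditive D] [MonoidalCategory D]
  [BraidedCategory D] [Twist D]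

lemma traceHom_sum [MonoidalPreadditive D] (X Y : D) [ExactPairing X Y] {ι : Type*}
    (s : Finset ι) (f : ι → (X ⟶ X)) :
    traceHom X Y (∑ i ∈ s, f i) = ∑ i ∈ s, traceHom X Y (f i) := by
  simp only [traceHom, Preadditive.sum_comp, Preadditive.comp_sum, sum_whiskerRight]

variable [Linear ℂ D]

lemma qdim_eq_scalar_traceHom (X Y : D) [ExactPairing X Y] :
    qdim X = scalar (traceHom X Y (𝟙 X)) := by
  have h : ∃ Y : D, Nonempty (ExactPairing X Y) := ⟨Y, ⟨inferInstance⟩⟩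
  rw [qdim, dif_pos h]
  let := h.choose_spec.some
  have := traceHom_comp_comm (Y₁ := h.choose) (Y₂ := Y) (𝟙 X) (𝟙 X)
  rw [Category.comp_id] at this
  rw [← this]

lemma qdim_congr {X Y : D} (e : X ≅ Y) [HasRightDual X] [HasRightDual Y] : qdim X = qdim Y := by
  have h := traceHom_comp_comm (Y₁ := Xᘁ) (Y₂ := Yᘁ) e.hom e.inv
  rw [e.hom_inv_id, e.inv_hom_id] at h
  rw [qdim_eq_scalar_traceHom X Xᘁ, qdim_eq_scalar_traceHom Y Yᘁ, h]

variable (hend : ∀ f : 𝟙_ D ⟶ 𝟙_ D, ∃ c : ℂ, f = c • 𝟙 (𝟙_ D))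
include hend

lemma traceHom_id_eq_qdim_smul (X Y : D) [ExactPairing X Y] :
    traceHom X Y (𝟙 X) = qdim X • 𝟙 (𝟙_ D) := by
  rw [qdim_eq_scalar_traceHom X Y]
  exact eq_scalar_smul (hend _)

variable [MonoidalPreadditive D]

lemma qdim_eq_sum (h1 : 𝟙 (𝟙_ D) ≠ 0) [RightRigidCategory D] {X : D} {ι : Type*} [Fintype ι]
    {S : ι → D} (i : ∀ j, S j ⟶ X) (p : ∀ j, X ⟶ S j) (hip : ∀ j, i j ≫ p j = 𝟙 (S j))
    (hpi : ∑ j, p j ≫ i j = 𝟙 X) : qdim X = ∑ j, qdim (S j) := by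
  have h : traceHom X Xᘁ (𝟙 X) = (∑ j, qdim (S j)) • 𝟙 (𝟙_ D) := by
    rw [← hpi, traceHom_sum, Finset.sum_smul]
    refine Finset.sum_congr rfl fun j _ => ?_
    rw [traceHom_comp_comm (Y₁ := Xᘁ) (Y₂ := (S j)ᘁ), hip, traceHom_id_eq_qdim_smul hend]
  rw [qdim_eq_scalar_traceHom X Xᘁ, h, scalar_smul_id h1]

lemma qdim_tensor [MonoidalLinear ℂ D] (h1 : 𝟙 (𝟙_ D) ≠ 0) (X Y : D) [HasRightDual X]
    [HasRightDual Y] : qdim (X ⊗ Y) = qdim X * qdim Y := by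
  have h : traceHom (X ⊗ Y) (Yᘁ ⊗ Xᘁ) (𝟙 _) = (qdim X * qdim Y) • 𝟙 (𝟙_ D) := by
    calc _ = qdim X • (curl Y Yᘁ ⊗≫ ε_ Y Yᘁ) := by
          rw [traceHom_tensor, traceHom_id_eq_qdim_smul hend]
          simp [monoidalComp]
      _ = qdim X • traceHom Y Yᘁ (𝟙 Y) := by
          rw [traceHom_id]
          simp [monoidalComp]
      _ = _ := by rw [traceHom_id_eq_qdim_smul hend, smul_smul]
  rw [qdim_eq_scalar_traceHom (X ⊗ Y) (Yᘁ ⊗ Xᘁ), h, scalar_smul_id h1]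

/-- An object on which the twist and the self-braiding are trivial has dimension `1`. -/
lemma qdim_eq_one [MonoidalLinear ℂ D] (X : D) [HasRightDual X] (hX : 𝟙 X ≠ 0)
    (hθ : (θ X).hom = 𝟙 X) (hβ : (β_ X X).hom = 𝟙 (X ⊗ X)) : qdim X = 1 := by
  have hcurl : X ◁ curl X Xᘁ = (ρ_ X).hom ≫ (λ_ X).inv ≫ η_ X Xᘁ ▷ X ≫ (α_ _ _ _).hom := by
    have h := BraidedCategory.braiding_naturality_right X (η_ X Xᘁ)
    rw [BraidedCategory.braiding_tensor_right_hom, hβ] at h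
    simp only [id_whiskerRight, Category.id_comp, braiding_tensorUnit_right,
      Category.assoc, Iso.inv_hom_id_assoc] at h
    rw [curl, hθ, id_whiskerRight, Category.id_comp, whiskerLeft_comp,
      ← cancel_mono (α_ X Xᘁ X).inv]
    simp only [Category.assoc, Iso.hom_inv_id, Category.comp_id]
    exact h
  have h : X ◁ traceHom X Xᘁ (𝟙 X) = 𝟙 _ := by
    rw [traceHom_id, whiskerLeft_comp, hcurl]
    simp
  rw [traceHom_id_eq_qdim_smul hend] at h
  have h2 : (qdim X) • 𝟙 (X ⊗ 𝟙_ D) = (1 : ℂ) • 𝟙 (X ⊗ 𝟙_ D) := by simpa using h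
  refine smul_left_injective ℂ (m := 𝟙 (X ⊗ 𝟙_ D)) (fun h0 => hX ?_) h2
  rw [← cancel_epi (ρ_ X).hom, ← Category.id_comp (ρ_ X).hom, h0]
  simp

end Dimensions

/-! ### Direct sums of simple objects -/

section Decompositions

variable {D : Type u} [Category.{v} D] [Preadditive D]

/-- A decomposition of `X` as a finite direct sum of simple objects, given by the inclusions and
projections; the ambient category need not have biproducts. -/
structure SimpleDecomposition (X : D) where
  /-- the index set of the summands -/
  ι : Type
  [fintype : Fintype ι]
  /-- the summands -/
  S : ι → D
  simple (j : ι) : Simple (S j)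
  /-- the inclusions -/
  incl (j : ι) : S j ⟶ X
  /-- the projections -/
  pr (j : ι) : X ⟶ S j
  incl_pr_self (j : ι) : incl j ≫ pr j = 𝟙 (S j)
  incl_pr_ne {j k : ι} (h : j ≠ k) : incl j ≫ pr k = 0
  sum_pr_incl : ∑ j, pr j ≫ incl j = 𝟙 X

attribute [instance] SimpleDecomposition.fintype

namespace SimpleDecomposition

variable {X : D} (d : SimpleDecomposition X)

lemma sum_comp {T : D} (f : T ⟶ X) : ∑ j, (f ≫ d.pr j) ≫ d.incl j = f := by
  simp_rw [Category.assoc, ← Preadditive.comp_sum, d.sum_pr_incl, Category.comp_id]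

lemma comp_sum {T : D} (f : X ⟶ T) : ∑ j, d.pr j ≫ d.incl j ≫ f = f := by
  simp_rw [← Category.assoc, ← Preadditive.sum_comp, d.sum_pr_incl, Category.id_comp]

lemma exists_incl_comp_ne_zero {T : D} {f : X ⟶ T} (hf : f ≠ 0) : ∃ j, d.incl j ≫ f ≠ 0 := by
  by_contra! h
  exact hf (by rw [← d.comp_sum f]; simp [h])

/-- Morphisms into a direct sum are families of morphisms into the summands. -/
def homEquiv [Linear ℂ D] (T : D) : (T ⟶ X) ≃ₗ[ℂ] (∀ j, T ⟶ d.S j) where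
  toFun f j := f ≫ d.pr j
  invFun g := ∑ j, g j ≫ d.incl j
  map_add' _ _ := by ext; simp
  map_smul' _ _ := by ext; simp
  left_inv f := d.sum_comp f
  right_inv g := by
    ext k
    change (∑ j, g j ≫ d.incl j) ≫ d.pr k = g k
    rw [Preadditive.sum_comp, Finset.sum_eq_single k]
    · rw [Category.assoc, d.incl_pr_self, Category.comp_id]
    · intro j _ h
      rw [Category.assoc, d.incl_pr_ne h, comp_zero]
    · simp

open scoped Classical in
/-- The multiplicity of a simple object in a direct sum is the dimension of a space of morphisms. -/
lemma finrank_hom [Linear ℂ D] [HasKernels D] [∀ X Y : D, FiniteDimensional ℂ (X ⟶ Y)] (T : D)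
    [Simple T] :
    Module.finrank ℂ (T ⟶ X) = (Finset.univ.filter fun j => Nonempty (T ≅ d.S j)).card := by
  rw [(d.homEquiv T).finrank_eq, Module.finrank_pi_fintype, Finset.card_filter]
  refine Finset.sum_congr rfl fun j _ => ?_
  have := d.simple j
  exact finrank_hom_simple_simple ℂ T (d.S j)

/-- Transport of a decomposition along an isomorphism. -/
def ofIso {Y : D} (e : X ≅ Y) : SimpleDecomposition Y where
  ι := d.ι
  S := d.S
  simple := d.simple
  incl j := d.incl j ≫ e.hom
  pr j := e.inv ≫ d.pr j
  incl_pr_self j := by simp [d.incl_pr_self]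
  incl_pr_ne h := by simp [d.incl_pr_ne h]
  sum_pr_incl := by
    simp_rw [Category.assoc, ← Preadditive.comp_sum, ← Category.assoc (d.pr _),
      ← Preadditive.sum_comp, d.sum_pr_incl]
    simp

/-- The decomposition of a simple object with one summand. -/
def ofSimple (X : D) [h : Simple X] : SimpleDecomposition X where
  ι := Unit
  S _ := X
  simple _ := h
  incl _ := 𝟙 X
  pr _ := 𝟙 X
  incl_pr_self _ := by simp
  incl_pr_ne h := (h rfl).elim
  sum_pr_incl := by simp

/-- The empty decomposition of a zero object. -/
def ofZero (X : D) (h : 𝟙 X = 0) : SimpleDecomposition X where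
  ι := Empty
  S := Empty.elim
  simple := by rintro ⟨⟩
  incl := by rintro ⟨⟩
  pr := by rintro ⟨⟩
  incl_pr_self := by rintro ⟨⟩
  incl_pr_ne {j} := by cases j
  sum_pr_incl := by simp [h]

/-- The decomposition of a direct sum of two objects. -/
def sum {Y Z : D} (dY : SimpleDecomposition Y) (dZ : SimpleDecomposition Z)
    (i : Y ⟶ X) (p : X ⟶ Y) (k : Z ⟶ X) (s : X ⟶ Z) (hip : i ≫ p = 𝟙 Y) (hks : k ≫ s = 𝟙 Z)
    (his : i ≫ s = 0) (hkp : k ≫ p = 0) (h : p ≫ i + s ≫ k = 𝟙 X) : SimpleDecomposition X where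
  ι := dY.ι ⊕ dZ.ι
  S := Sum.elim dY.S dZ.S
  simple := by rintro (j | j); exacts [dY.simple j, dZ.simple j]
  incl := fun | .inl j => dY.incl j ≫ i | .inr j => dZ.incl j ≫ k
  pr := fun | .inl j => p ≫ dY.pr j | .inr j => s ≫ dZ.pr j
  incl_pr_self := by
    rintro (j | j)
    · simp [reassoc_of% hip, dY.incl_pr_self]
    · simp [reassoc_of% hks, dZ.incl_pr_self]
  incl_pr_ne := by
    rintro (j | j) (l | l) hjl
    · change (dY.incl j ≫ i) ≫ p ≫ dY.pr l = 0
      rw [Category.assoc, reassoc_of% hip, dY.incl_pr_ne (fun h => hjl (congrArg _ h))]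
    · change (dY.incl j ≫ i) ≫ s ≫ dZ.pr l = 0
      rw [Category.assoc, reassoc_of% his, zero_comp, comp_zero]
    · change (dZ.incl j ≫ k) ≫ p ≫ dY.pr l = 0
      rw [Category.assoc, reassoc_of% hkp, zero_comp, comp_zero]
    · change (dZ.incl j ≫ k) ≫ s ≫ dZ.pr l = 0
      rw [Category.assoc, reassoc_of% hks, dZ.incl_pr_ne (fun h => hjl (congrArg _ h))]
  sum_pr_incl := by
    refine (Fintype.sum_sum_type _).trans ?_
    change ∑ j, (p ≫ dY.pr j) ≫ dY.incl j ≫ i + ∑ j, (s ≫ dZ.pr j) ≫ dZ.incl j ≫ k = 𝟙 X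
    rw [← h]
    simp_rw [Category.assoc, ← Preadditive.comp_sum, ← Category.assoc (dY.pr _),
      ← Category.assoc (dZ.pr _), ← Preadditive.sum_comp, dY.sum_pr_incl, dZ.sum_pr_incl]
    simp

end SimpleDecomposition

end Decompositions

section SimpleHom

variable {D : Type u} [Category.{v} D] [Preadditive D] [Linear ℂ D]

/-- Morphisms out of a direct sum are families of morphisms out of the summands. -/
def SimpleDecomposition.homFromEquiv {X : D} (d : SimpleDecomposition X) (T : D) :
    (X ⟶ T) ≃ₗ[ℂ] (∀ j, d.S j ⟶ T) where
  toFun f j := d.incl j ≫ f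
  invFun g := ∑ j, d.pr j ≫ g j
  map_add' _ _ := by ext; simp
  map_smul' _ _ := by ext; simp
  left_inv f := d.comp_sum f
  right_inv g := by
    ext k
    change d.incl k ≫ (∑ j, d.pr j ≫ g j) = g k
    rw [Preadditive.comp_sum, Finset.sum_eq_single k]
    · rw [reassoc_of% d.incl_pr_self]
    · intro j _ h
      rw [← Category.assoc, d.incl_pr_ne h.symm, zero_comp]
    · simp

lemma SimpleDecomposition.finrank_hom_comm [HasKernels D]
    [∀ X Y : D, FiniteDimensional ℂ (X ⟶ Y)] {X : D} (d : SimpleDecomposition X) (T : D)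
    [Simple T] : Module.finrank ℂ (T ⟶ X) = Module.finrank ℂ (X ⟶ T) := by
  rw [(d.homEquiv T).finrank_eq, (d.homFromEquiv T).finrank_eq, Module.finrank_pi_fintype,
    Module.finrank_pi_fintype]
  refine Finset.sum_congr rfl fun j _ => ?_
  have := d.simple j
  classical
  rw [finrank_hom_simple_simple ℂ T (d.S j), finrank_hom_simple_simple ℂ (d.S j) T]
  exact if_congr ⟨fun ⟨e⟩ => ⟨e.symm⟩, fun ⟨e⟩ => ⟨e.symm⟩⟩ rfl rfl

end SimpleHom

section Classes

variable {D : Type u} [Category.{v} D] [Preadditive D]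

instance (X : SimpleClass D) : Simple X.rep := X.2

/-- The isomorphism class of a simple object. -/
def SimpleClass.mk (X : D) [Simple X] : SimpleClass D :=
  ⟨toSkeleton X, Simple.of_iso (fromSkeletonToSkeletonIso X)⟩

/-- The chosen representative of the class of `X` is isomorphic to `X`. -/
def SimpleClass.repMk (X : D) [Simple X] : (SimpleClass.mk X).rep ≅ X :=
  fromSkeletonToSkeletonIso X

lemma SimpleClass.eq_of_iso {X Y : SimpleClass D} (e : X.rep ≅ Y.rep) : X = Y :=
  Subtype.ext (skeleton_skeletal D ⟨(fromSkeleton D).preimageIso e⟩)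

lemma SimpleClass.mk_eq_iff {X : D} [Simple X] {Y : SimpleClass D} :
    SimpleClass.mk X = Y ↔ Nonempty (Y.rep ≅ X) := by
  constructor
  · rintro rfl
    exact ⟨SimpleClass.repMk X⟩
  · rintro ⟨e⟩
    exact SimpleClass.eq_of_iso (SimpleClass.repMk X ≪≫ e.symm)

variable [Linear ℂ D]

/-- An isomorphism invariant, summed over the summands of `X`, is the sum of its values at all
simple objects, weighted by multiplicities. -/
lemma SimpleDecomposition.sum_eq [HasKernels D] [∀ X Y : D, FiniteDimensional ℂ (X ⟶ Y)]
    [Fintype (SimpleClass D)] {X : D} (d : SimpleDecomposition X) (φ : D → ℂ)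
    (hφ : ∀ {Y Z : D}, (Y ≅ Z) → φ Y = φ Z) :
    ∑ j, φ (d.S j) = ∑ T : SimpleClass D, (Module.finrank ℂ (T.rep ⟶ X) : ℂ) * φ T.rep := by
  classical
  have := d.simple
  calc ∑ j, φ (d.S j) = ∑ j, ∑ T : SimpleClass D,
        if SimpleClass.mk (d.S j) = T then φ T.rep else 0 := by
        refine Finset.sum_congr rfl fun j _ => ?_
        rw [Finset.sum_ite_eq, if_pos (Finset.mem_univ _)]
        exact hφ (SimpleClass.repMk _).symm
    _ = ∑ T : SimpleClass D, ∑ j, if Nonempty (T.rep ≅ d.S j) then φ T.rep else 0 := by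
        rw [Finset.sum_comm]
        simp_rw [SimpleClass.mk_eq_iff]
    _ = _ := by
        refine Finset.sum_congr rfl fun T _ => ?_
        rw [d.finrank_hom, ← Finset.sum_filter, Finset.sum_const, nsmul_eq_mul]

lemma scalar_θ_congr [MonoidalCategory D] [BraidedCategory D] [Twist D]
    [HasKernels D] [∀ X Y : D, FiniteDimensional ℂ (X ⟶ Y)] {X Y : D}
    [Simple X] [Simple Y] (e : X ≅ Y) : scalar (θ X).hom = scalar (θ Y).hom :=
  scalar_conj e (id_nonzero X) (θ_naturality e.hom).symm
    ((endomorphism_simple_eq_smul_id ℂ (θ Y).hom).imp fun _ h => h.symm)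

end Classes

section Splitting

variable {C : Type u} [Category.{v} C] [Abelian C]

/-- Simple objects are projective: the pullback of `e` along `h` is semisimple and maps onto `S`, so
that `S` is one of its summands. -/
lemma exists_lift_of_simple (hss : ∀ X : C, Nonempty (SimpleDecomposition X)) {E X S : C}
    [Simple S] (e : E ⟶ X) [Epi e] (h : S ⟶ X) : ∃ s : S ⟶ E, s ≫ e = h := by
  obtain ⟨d⟩ := hss (pullback e h)
  have hne : pullback.snd e h ≠ 0 := by
    intro h0
    have : 𝟙 S = 0 := by
      rw [← cancel_epi (pullback.snd e h), h0, zero_comp, zero_comp]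
    exact id_nonzero S this
  obtain ⟨j, hj⟩ := d.exists_incl_comp_ne_zero hne
  have := d.simple j
  have := isIso_of_hom_simple hj
  refine ⟨inv (d.incl j ≫ pullback.snd e h) ≫ d.incl j ≫ pullback.fst e h, ?_⟩
  rw [Category.assoc, Category.assoc, pullback.condition, ← Category.assoc (d.incl j),
    IsIso.inv_hom_id_assoc]

lemma exists_section_of_epi (hss : ∀ X : C, Nonempty (SimpleDecomposition X)) {E X : C}
    (e : E ⟶ X) [Epi e] : ∃ s : X ⟶ E, s ≫ e = 𝟙 X := by
  obtain ⟨d⟩ := hss X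
  have := d.simple
  choose s hs using fun j => exists_lift_of_simple hss e (d.incl j)
  refine ⟨∑ j, d.pr j ≫ s j, ?_⟩
  simp_rw [Preadditive.sum_comp, Category.assoc, hs, d.sum_pr_incl]

lemma exists_retraction_of_mono (hss : ∀ X : C, Nonempty (SimpleDecomposition X)) {X Y : C}
    (f : X ⟶ Y) [Mono f] : ∃ r : Y ⟶ X, f ≫ r = 𝟙 X := by
  obtain ⟨s, hs⟩ := exists_section_of_epi hss (cokernel.π f)
  have h : (𝟙 Y - cokernel.π f ≫ s) ≫ cokernel.π f = 0 := by
    simp [Preadditive.sub_comp, hs]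
  obtain ⟨r, hr⟩ : ∃ r : Y ⟶ X, r ≫ f = 𝟙 Y - cokernel.π f ≫ s :=
    ⟨_, (Abelian.monoIsKernelOfCokernel
      (CokernelCofork.ofπ (cokernel.π f) (cokernel.condition f)) (cokernelIsCokernel f)).fac
        (KernelFork.ofι _ h) WalkingParallelPair.zero⟩
  refine ⟨r, ?_⟩
  rw [← cancel_mono f, Category.assoc, hr]
  simp [Preadditive.comp_sub]

end Splitting

section Premodular

attribute [local instance] Abelian.hasFiniteBiproducts

variable {C : Type u} [Category.{v} C] [Abelian C]

/-- The decomposition of a biproduct of simple objects. -/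
def SimpleDecomposition.ofBiproduct {m : ℕ} (S : Fin m → C) (h : ∀ i, Simple (S i)) :
    SimpleDecomposition (⨁ S) where
  ι := Fin m
  S := S
  simple := h
  incl := biproduct.ι S
  pr := biproduct.π S
  incl_pr_self j := biproduct.ι_π_self S j
  incl_pr_ne h := biproduct.ι_π_ne S h
  sum_pr_incl := biproduct.total

variable [Linear ℂ C] [MonoidalCategory C]
    [MonoidalPreadditive C] [MonoidalLinear ℂ C] [RigidCategory C] [BraidedCategory C]
    [Twist C] [IsPremodular C]

variable (C) in
lemma nonempty_simpleDecomposition (X : C) : Nonempty (SimpleDecomposition X) := by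
  obtain ⟨m, S, hS, ⟨e⟩⟩ := IsPremodular.semisimple X
  exact ⟨(SimpleDecomposition.ofBiproduct S hS).ofIso e.symm⟩

instance (X Y : C) : FiniteDimensional ℂ (X ⟶ Y) := IsPremodular.finite_hom X Y

instance : Simple (𝟙_ C) := IsPremodular.simple_unit

lemma exists_eq_smul_id (X : C) [Simple X] (f : X ⟶ X) : ∃ c : ℂ, f = c • 𝟙 X :=
  (endomorphism_simple_eq_smul_id ℂ f).imp fun _ h => h.symm

lemma SimpleDecomposition.qdim_eq {X : C} (d : SimpleDecomposition X) :
    qdim X = ∑ j, qdim (d.S j) :=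
  qdim_eq_sum (exists_eq_smul_id (𝟙_ C)) (id_nonzero _) d.incl d.pr d.incl_pr_self d.sum_pr_incl

end Premodular

/-! ### Special Frobenius algebras and the Galois condition -/

section Frobenius

open MonObj

variable {C : Type u} [Category.{v} C] [MonoidalCategory C]

/-- A comultiplication and a counit making the algebra `A` a special Frobenius algebra: the
comultiplication is a morphism of `A`-bimodules and a section of the multiplication. -/
structure SpecialFrobenius (A : Mon C) where
  /-- the comultiplication -/
  comul : A.X ⟶ A.X ⊗ A.X
  /-- the counit -/
  counit : A.X ⟶ 𝟙_ C
  comul_mul : comul ≫ μ[A.X] = 𝟙 A.X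
  mul_comul_left : A.X ◁ comul ≫ (α_ _ _ _).inv ≫ μ[A.X] ▷ A.X = μ[A.X] ≫ comul
  mul_comul_right : comul ▷ A.X ≫ (α_ _ _ _).hom ≫ A.X ◁ μ[A.X] = μ[A.X] ≫ comul
  comul_counit : comul ≫ counit ▷ A.X = (λ_ A.X).inv

namespace SpecialFrobenius

variable {A : Mon C} (Fr : SpecialFrobenius A)

/-- The morphism `a ⊗ m ↦ ∑ a₁ ⊗ a₂ m`. -/
def coactMul (M : Bimod A A) : A.X ⊗ M.X ⟶ A.X ⊗ M.X :=
  Fr.comul ▷ M.X ≫ (α_ _ _ _).hom ≫ A.X ◁ M.actLeft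

/-- The morphism `m ↦ ∑ e₁ ⊗ e₂ m` for the Casimir element `∑ e₁ ⊗ e₂`, the comultiplication of
the unit. It is a section of the action, as a morphism of left modules. -/
def coact (M : Bimod A A) : M.X ⟶ A.X ⊗ M.X :=
  (λ_ M.X).inv ≫ η[A.X] ▷ M.X ≫ Fr.coactMul M

lemma actLeft_coact (M : Bimod A A) : M.actLeft ≫ Fr.coact M = Fr.coactMul M := by
  have h : (λ_ A.X).inv ≫ η[A.X] ▷ A.X ≫ Fr.comul ▷ A.X ≫ (α_ _ _ _).hom ≫ A.X ◁ μ[A.X] =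
      Fr.comul := by
    rw [Fr.mul_comul_right, one_mul_assoc, Iso.inv_hom_id_assoc]
  calc _ = 𝟙 _ ⊗≫ (𝟙_ C ◁ M.actLeft ≫ (η[A.X] ≫ Fr.comul) ▷ M.X) ⊗≫ A.X ◁ M.actLeft := by
        simp only [coact, coactMul]
        monoidal
    _ = 𝟙 _ ⊗≫ (η[A.X] ≫ Fr.comul) ▷ A.X ▷ M.X ⊗≫
          A.X ◁ ((α_ A.X A.X M.X).hom ≫ A.X ◁ M.actLeft ≫ M.actLeft) := by
        rw [whisker_exchange]
        monoidal
    _ = ((λ_ A.X).inv ≫ η[A.X] ▷ A.X ≫ Fr.comul ▷ A.X ≫ (α_ _ _ _).hom ≫ A.X ◁ μ[A.X]) ▷ M.X ⊗≫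
          A.X ◁ M.actLeft := by
        rw [← M.left_assoc]
        monoidal
    _ = _ := by
        rw [h, coactMul]
        monoidal

lemma whiskerLeft_coact (M : Bimod A A) :
    A.X ◁ Fr.coact M ≫ (α_ _ _ _).inv ≫ μ[A.X] ▷ M.X = Fr.coactMul M := by
  have h : (ρ_ A.X).inv ≫ A.X ◁ η[A.X] ≫ A.X ◁ Fr.comul ≫ (α_ _ _ _).inv ≫ μ[A.X] ▷ A.X =
      Fr.comul := by
    rw [Fr.mul_comul_left, mul_one_assoc, Iso.inv_hom_id_assoc]
  calc _ = 𝟙 _ ⊗≫ A.X ◁ (η[A.X] ≫ Fr.comul) ▷ M.X ⊗≫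
          ((A.X ⊗ A.X) ◁ M.actLeft ≫ μ[A.X] ▷ M.X) := by
        simp only [coact, coactMul]
        monoidal
    _ = ((ρ_ A.X).inv ≫ A.X ◁ η[A.X] ≫ A.X ◁ Fr.comul ≫ (α_ _ _ _).inv ≫ μ[A.X] ▷ A.X) ▷ M.X ⊗≫
          A.X ◁ M.actLeft := by
        rw [whisker_exchange]
        monoidal
    _ = _ := by
        rw [h, coactMul]
        monoidal

lemma coactMul_actLeft (M : Bimod A A) : Fr.coactMul M ≫ M.actLeft = M.actLeft := by
  rw [coactMul, Category.assoc, Category.assoc, ← M.left_assoc, ← comp_whiskerRight_assoc,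
    Fr.comul_mul, id_whiskerRight, Category.id_comp]

lemma coact_actLeft (M : Bimod A A) : Fr.coact M ≫ M.actLeft = 𝟙 M.X := by
  rw [coact, Category.assoc, Category.assoc, coactMul_actLeft, M.one_actLeft, Iso.inv_hom_id]

lemma coact_counit (M : Bimod A A) : Fr.coact M ≫ Fr.counit ▷ M.X = (λ_ M.X).inv := by
  calc _ = 𝟙 _ ⊗≫ (η[A.X] ≫ Fr.comul) ▷ M.X ⊗≫ (A.X ◁ M.actLeft ≫ Fr.counit ▷ M.X) := by
        simp only [coact, coactMul]
        monoidal
    _ = 𝟙 _ ⊗≫ (η[A.X] ≫ Fr.comul ≫ Fr.counit ▷ A.X) ▷ M.X ⊗≫ 𝟙_ C ◁ M.actLeft := by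
        rw [whisker_exchange]
        monoidal
    _ = (λ_ M.X).inv ≫ (η[A.X] ▷ M.X ≫ M.actLeft) ⊗≫ 𝟙 _ := by
        rw [Fr.comul_counit]
        monoidal
    _ = _ := by
        rw [M.one_actLeft]
        monoidal

lemma coact_naturality {M N : Bimod A A} (f : M.X ⟶ N.X)
    (h : M.actLeft ≫ f = A.X ◁ f ≫ N.actLeft) : f ≫ Fr.coact N = Fr.coact M ≫ A.X ◁ f := by
  calc _ = 𝟙 _ ⊗≫ (𝟙_ C ◁ f ≫ (η[A.X] ≫ Fr.comul) ▷ N.X) ⊗≫ A.X ◁ N.actLeft := by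
        simp only [coact, coactMul]
        monoidal
    _ = 𝟙 _ ⊗≫ (η[A.X] ≫ Fr.comul) ▷ M.X ⊗≫ A.X ◁ (A.X ◁ f ≫ N.actLeft) := by
        rw [whisker_exchange]
        monoidal
    _ = _ := by
        rw [← h]
        simp only [coact, coactMul]
        monoidal

/-- The average of a morphism of `C` over the Casimir element, a morphism of left modules. -/
def average {M N : Bimod A A} (r : M.X ⟶ N.X) : M.X ⟶ N.X :=
  Fr.coact M ≫ A.X ◁ r ≫ N.actLeft

lemma average_linear {M N : Bimod A A} (r : M.X ⟶ N.X) :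
    M.actLeft ≫ Fr.average r = A.X ◁ Fr.average r ≫ N.actLeft := by
  calc _ = Fr.coactMul M ≫ A.X ◁ r ≫ N.actLeft := by
        rw [average, ← Category.assoc, actLeft_coact]
    _ = A.X ◁ Fr.coact M ≫ (α_ _ _ _).inv ≫ (μ[A.X] ▷ M.X ≫ A.X ◁ r) ≫ N.actLeft := by
        rw [← whiskerLeft_coact]
        simp only [Category.assoc]
    _ = A.X ◁ Fr.coact M ≫ A.X ◁ A.X ◁ r ≫ (α_ _ _ _).inv ≫ μ[A.X] ▷ N.X ≫ N.actLeft := by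
        rw [← whisker_exchange]
        simp
    _ = _ := by
        rw [N.left_assoc]
        simp [average]

lemma comp_average {M N : Bimod A A} (f : M.X ⟶ N.X) (h : M.actLeft ≫ f = A.X ◁ f ≫ N.actLeft)
    {r : N.X ⟶ M.X} (hr : f ≫ r = 𝟙 M.X) : f ≫ Fr.average r = 𝟙 M.X := by
  rw [average, ← Category.assoc, Fr.coact_naturality f h, Category.assoc, ← whiskerLeft_comp_assoc,
    hr, whiskerLeft_id, Category.id_comp, coact_actLeft]

end SpecialFrobenius

/-- A special Frobenius algebra that is a Galois algebra over the unit: for finitely many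
endomorphisms `p k` and `q k` of `A`, the sum of the morphisms `a ↦ (q k)(p k a)₁ ⊗ (p k a)₂` is
`a ↦ a ⊗ 1`. For `A = Fun(H)` these are the translations by the elements of `H` and their
inverses. -/
structure GaloisFrobenius [Preadditive C] (A : Mon C) extends SpecialFrobenius A where
  /-- the index set of the endomorphisms -/
  K : Type
  [fintype : Fintype K]
  /-- the translations -/
  p : K → (A.X ⟶ A.X)
  /-- the inverse translations -/
  q : K → (A.X ⟶ A.X)
  galois : ∑ k, p k ≫ comul ≫ q k ▷ A.X = (ρ_ A.X).inv ≫ A.X ◁ η[A.X]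

attribute [instance] GaloisFrobenius.fintype

variable [Preadditive C] [MonoidalPreadditive C]

/-- The Galois condition writes the identity of `A ⊗ M` as a sum of morphisms that begin with a
translated action of `A` on `M`, which does not see the double braiding if `M` is local. -/
lemma GaloisFrobenius.sum_translate {A : Mon C} (Ga : GaloisFrobenius A) (M : Bimod A A) :
    ∑ k, (Ga.p k ▷ M.X ≫ M.actLeft) ≫ Ga.coact M ≫ Ga.q k ▷ M.X = 𝟙 (A.X ⊗ M.X) := by
  calc _ = ∑ k, (Ga.p k ≫ Ga.comul ≫ Ga.q k ▷ A.X) ▷ M.X ≫ (α_ _ _ _).hom ≫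
          A.X ◁ M.actLeft := by
        refine Finset.sum_congr rfl fun k _ => ?_
        rw [Category.assoc, reassoc_of% Ga.actLeft_coact M, SpecialFrobenius.coactMul]
        simp only [Category.assoc, whisker_exchange, comp_whiskerRight]
        simp
    _ = (∑ k, Ga.p k ≫ Ga.comul ≫ Ga.q k ▷ A.X) ▷ M.X ≫ (α_ _ _ _).hom ≫ A.X ◁ M.actLeft := by
        rw [sum_whiskerRight, Preadditive.sum_comp]
    _ = 𝟙 _ ⊗≫ A.X ◁ (η[A.X] ▷ M.X ≫ M.actLeft) := by
        rw [Ga.galois]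
        monoidal
    _ = _ := by
        rw [M.one_actLeft]
        monoidal

/-- The underlying object of a local module centralizes `A`. -/
lemma GaloisFrobenius.monodromy_eq_id [BraidedCategory C] {A : Mon C} (Ga : GaloisFrobenius A)
    {M : Bimod A A} (hM : isLocal A M) : (β_ A.X M.X).hom ≫ (β_ M.X A.X).hom = 𝟙 _ := by
  rw [← Category.comp_id (_ ≫ _), ← Ga.sum_translate M, Preadditive.comp_sum]
  refine Finset.sum_congr rfl fun k _ => ?_
  have h : ((β_ A.X M.X).hom ≫ (β_ M.X A.X).hom) ≫ Ga.p k ▷ M.X ≫ M.actLeft =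
      Ga.p k ▷ M.X ≫ M.actLeft := by
    rw [Category.assoc, ← BraidedCategory.braiding_naturality_right_assoc,
      ← BraidedCategory.braiding_naturality_left_assoc, hM.2]
  rw [← Category.assoc, h]

end Frobenius

/-! ### Kernels and semisimplicity of local modules -/

section FinrankEnd

variable {D : Type u} [Category.{v} D] [Preadditive D] [Linear ℂ D]

/-- A proper retract has a smaller endomorphism space. -/
lemma finrank_end_lt {Q P : D} [FiniteDimensional ℂ (P ⟶ P)] {i : Q ⟶ P} {p : P ⟶ Q}
    (hip : i ≫ p = 𝟙 Q) (hpi : p ≫ i ≠ 𝟙 P) :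
    Module.finrank ℂ (Q ⟶ Q) < Module.finrank ℂ (P ⟶ P) := by
  let Φ : (Q ⟶ Q) →ₗ[ℂ] (P ⟶ P) :=
    { toFun g := p ≫ g ≫ i
      map_add' _ _ := by simp
      map_smul' _ _ := by simp }
  have hΦ : ∀ g, p ≫ g ≫ i = Φ g := fun _ => rfl
  have hinj : Function.Injective Φ := fun g h e => by
    have e' : i ≫ (p ≫ g ≫ i) ≫ p = i ≫ (p ≫ h ≫ i) ≫ p := by rw [hΦ, e, hΦ]
    simpa [hip, reassoc_of% hip] using e'
  rw [← LinearMap.finrank_range_of_inj hinj]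
  refine Submodule.finrank_lt (fun h => hpi ?_)
  obtain ⟨g, hg⟩ : 𝟙 P ∈ LinearMap.range Φ := h ▸ Submodule.mem_top
  rw [← hΦ] at hg
  -- the identity has the form `p ≫ g ≫ i`, which `p ≫ i` fixes
  rw [← Category.comp_id (p ≫ i), ← hg, Category.assoc, reassoc_of% hip]

end FinrankEnd

section LocalModuleKernels

open MonObj BraidedCategory

variable {C : Type u} [Category.{v} C] [MonoidalCategory C] [BraidedCategory C]

/-- The underlying object of a local module. -/
def forgetLocal (A : Mon C) : LocalModule A ⥤ C where
  obj M := M.obj.X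
  map f := f.hom.hom

variable {A : Mon C}

instance : (forgetLocal A).Faithful where
  map_injective h := ObjectProperty.hom_ext _ (Bimod.hom_ext _ _ h)

lemma localModule_hom_ext {M N : LocalModule A} {f g : M ⟶ N} (h : f.hom.hom = g.hom.hom) :
    f = g :=
  (forgetLocal A).map_injective h

variable [Preadditive C] [MonoidalPreadditive C]

instance : (forgetLocal A).Additive where
  map_add := rfl

instance [Linear ℂ C] [MonoidalLinear ℂ C] : (forgetLocal A).Linear ℂ where
  map_smul _ _ := rfl

instance [Linear ℂ C] [MonoidalLinear ℂ C] [∀ X Y : C, FiniteDimensional ℂ (X ⟶ Y)]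
    (M N : LocalModule A) : FiniteDimensional ℂ (M ⟶ N) :=
  FiniteDimensional.of_injective ((forgetLocal A).mapLinearMap ℂ) (forgetLocal A).map_injective

lemma comp_hom_eq_zero {M N P : LocalModule A} (f : M ⟶ N) {g : P ⟶ M} (h : g ≫ f = 0) :
    g.hom.hom ≫ f.hom.hom = 0 :=
  congrArg (forgetLocal A).map h

variable [HasKernels C]

section Kernel

variable {M N : LocalModule A} (f : M ⟶ N)

/-- The action of `A` on the kernel of a morphism of local modules. -/
def kernelAct : A.X ⊗ kernel f.hom.hom ⟶ kernel f.hom.hom :=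
  kernel.lift _ (A.X ◁ kernel.ι f.hom.hom ≫ M.obj.actLeft) (by
    rw [Category.assoc, f.hom.left_act_hom, ← whiskerLeft_comp_assoc, kernel.condition]
    simp)

lemma kernelAct_ι : kernelAct f ≫ kernel.ι f.hom.hom = A.X ◁ kernel.ι f.hom.hom ≫ M.obj.actLeft :=
  kernel.lift_ι _ _ _

lemma actLeft_kernel_lift {P : LocalModule A} (g : P ⟶ M) (h : g.hom.hom ≫ f.hom.hom = 0) :
    P.obj.actLeft ≫ kernel.lift f.hom.hom g.hom.hom h =
      A.X ◁ kernel.lift f.hom.hom g.hom.hom h ≫ kernelAct f := by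
  rw [← cancel_mono (kernel.ι f.hom.hom), Category.assoc, Category.assoc, kernelAct_ι,
    kernel.lift_ι, ← whiskerLeft_comp_assoc, kernel.lift_ι, g.hom.left_act_hom]

variable [IsCommMonObj A.X]

/-- The kernel of a morphism of local modules. -/
def kernelModule : LocalModule A :=
  LocalModule.ofLeft (kernel f.hom.hom) (kernelAct f)
    (by
      rw [← cancel_mono (kernel.ι f.hom.hom), Category.assoc, kernelAct_ι,
        ← whisker_exchange_assoc, M.obj.one_actLeft]
      simp)
    (by
      rw [← cancel_mono (kernel.ι f.hom.hom)]
      simp only [Category.assoc, kernelAct_ι]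
      rw [← whisker_exchange_assoc, M.obj.left_assoc, ← whiskerLeft_comp_assoc, kernelAct_ι]
      simp)
    (by
      rw [← cancel_mono (kernel.ι f.hom.hom)]
      simp only [Category.assoc, kernelAct_ι]
      rw [← braiding_naturality_left_assoc, ← braiding_naturality_right_assoc, M.property.2])

/-- The inclusion of the kernel of a morphism of local modules. -/
def kernelModuleι : kernelModule f ⟶ M :=
  LocalModule.homOfLeft (kernel.ι f.hom.hom) (kernelAct_ι f)

lemma kernelModuleι_comp : kernelModuleι f ≫ f = 0 :=
  localModule_hom_ext (kernel.condition f.hom.hom)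

/-- The universal property of the kernel of a morphism of local modules. -/
def kernelModuleLift {P : LocalModule A} (g : P ⟶ M) (h : g ≫ f = 0) : P ⟶ kernelModule f :=
  LocalModule.homOfLeft (kernel.lift f.hom.hom g.hom.hom (comp_hom_eq_zero f h))
    (actLeft_kernel_lift f g _)

lemma kernelModuleLift_ι {P : LocalModule A} (g : P ⟶ M) (h : g ≫ f = 0) :
    kernelModuleLift f g h ≫ kernelModuleι f = g :=
  localModule_hom_ext (kernel.lift_ι _ _ _)

instance : Mono (kernelModuleι f) where
  right_cancellation g h w := by
    apply localModule_hom_ext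
    refine (cancel_mono (kernel.ι f.hom.hom)).1 ?_
    exact congrArg (forgetLocal A).map w

end Kernel

variable [IsCommMonObj A.X]

instance : HasKernels (LocalModule A) where
  has_limit f := ⟨⟨⟨KernelFork.ofι (kernelModuleι f) (kernelModuleι_comp f),
    KernelFork.IsLimit.ofι' _ _ fun g h => ⟨kernelModuleLift f g h, kernelModuleLift_ι f g h⟩⟩⟩⟩

/-- Monomorphisms of local modules are monomorphisms of the ambient category. -/
lemma mono_hom_of_mono {M N : LocalModule A} (f : M ⟶ N) [Mono f] : Mono f.hom.hom := by
  apply Preadditive.mono_of_kernel_zero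
  have h : kernelModuleι f = 0 := by
    rw [← cancel_mono f, kernelModuleι_comp, zero_comp]
  exact congrArg (forgetLocal A).map h

end LocalModuleKernels

section LocalModuleSemisimple

variable {C : Type u} [Category.{v} C] [Abelian C] [MonoidalCategory C] [MonoidalPreadditive C]
  [BraidedCategory C] {A : Mon C} [IsCommMonObj A.X]

/-- Maschke's theorem: averaging a retraction in `C` gives a retraction of local modules. -/
lemma SpecialFrobenius.exists_retraction (Fr : SpecialFrobenius A)
    (hss : ∀ X : C, Nonempty (SimpleDecomposition X)) {M N : LocalModule A} (f : M ⟶ N) [Mono f] :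
    ∃ r : N ⟶ M, f ≫ r = 𝟙 M := by
  have := mono_hom_of_mono f
  obtain ⟨r, hr⟩ := exists_retraction_of_mono hss f.hom.hom
  exact ⟨LocalModule.homOfLeft (Fr.average r) (Fr.average_linear r),
    localModule_hom_ext (Fr.comp_average f.hom.hom f.hom.left_act_hom hr)⟩

variable [Linear ℂ C] [MonoidalLinear ℂ C] [∀ X Y : C, FiniteDimensional ℂ (X ⟶ Y)]

/-- Local modules are semisimple. By Maschke's theorem a module that is not simple is the direct sum
of two modules with smaller endomorphism spaces. -/
lemma SpecialFrobenius.nonempty_simpleDecomposition (Fr : SpecialFrobenius A)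
    (hss : ∀ X : C, Nonempty (SimpleDecomposition X)) (P : LocalModule A) :
    Nonempty (SimpleDecomposition P) := by
  induction hn : Module.finrank ℂ (P ⟶ P) using Nat.strong_induction_on generalizing P with
  | _ n ih =>
    by_cases h0 : 𝟙 P = 0
    · exact ⟨.ofZero P h0⟩
    by_cases hP : Simple P
    · exact ⟨.ofSimple P⟩
    obtain ⟨Q, f, hf, hf0, hfi⟩ : ∃ (Q : LocalModule A) (f : Q ⟶ P),
        Mono f ∧ f ≠ 0 ∧ ¬ IsIso f := by
      by_contra! h
      refine hP ⟨fun {Q} f hf => ⟨fun hi hf0 => h0 ?_, fun hf0 => h Q f hf hf0⟩⟩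
      rw [← IsIso.inv_hom_id f]
      simp [hf0]
    obtain ⟨r, hr⟩ := Fr.exists_retraction hss f
    have hrk : (𝟙 P - r ≫ f) ≫ r = 0 := by simp [Preadditive.sub_comp, hr]
    let k := kernel.ι r
    let s : P ⟶ kernel r := kernel.lift r (𝟙 P - r ≫ f) hrk
    have hsk : s ≫ k = 𝟙 P - r ≫ f := kernel.lift_ι _ _ _
    have hkr : k ≫ r = 0 := kernel.condition r
    have hks : k ≫ s = 𝟙 (kernel r) := by
      rw [← cancel_mono k, Category.assoc, hsk]
      simp [Preadditive.comp_sub, reassoc_of% hkr]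
    have hfs : f ≫ s = 0 := by
      rw [← cancel_mono k, Category.assoc, hsk]
      simp [Preadditive.comp_sub, reassoc_of% hr]
    have hsum : r ≫ f + s ≫ k = 𝟙 P := by rw [hsk]; abel
    have hQ : Module.finrank ℂ (Q ⟶ Q) < n := by
      rw [← hn]
      exact finrank_end_lt hr fun h => hfi ⟨r, hr, h⟩
    have hK : Module.finrank ℂ (kernel r ⟶ kernel r) < n := by
      rw [← hn]
      refine finrank_end_lt hks fun h => hf0 ?_
      rw [← Category.comp_id f, ← h, reassoc_of% hfs, zero_comp]
    obtain ⟨dQ⟩ := ih _ hQ Q rfl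
    obtain ⟨dK⟩ := ih _ hK (kernel r) rfl
    exact ⟨dQ.sum dK f r k s hr hks hfs hkr hsum⟩

end LocalModuleSemisimple

/-! ### Free modules -/

section FreeModules

open MonObj BraidedCategory

variable {C : Type u} [Category.{v} C] [MonoidalCategory C] [BraidedCategory C] {A : Mon C}
  [IsCommMonObj A.X]

lemma freeModule_isLocal {X : C} (hX : (β_ A.X X).hom ≫ (β_ X A.X).hom = 𝟙 _) :
    (β_ A.X (A.X ⊗ X)).hom ≫ (β_ (A.X ⊗ X) A.X).hom ≫ (α_ A.X A.X X).inv ≫ μ[A.X] ▷ X =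
      (α_ A.X A.X X).inv ≫ μ[A.X] ▷ X := by
  calc _ = (α_ A.X A.X X).inv ≫ (β_ A.X A.X).hom ▷ X ≫ (α_ A.X A.X X).hom ≫
        A.X ◁ ((β_ A.X X).hom ≫ (β_ X A.X).hom) ≫ (α_ A.X A.X X).inv ≫
          ((β_ A.X A.X).hom ≫ μ[A.X]) ▷ X := by
        rw [braiding_tensor_left_hom, braiding_tensor_right_hom]
        monoidal
    _ = (α_ A.X A.X X).inv ≫ ((β_ A.X A.X).hom ≫ (β_ A.X A.X).hom ≫ μ[A.X]) ▷ X := by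
        rw [hX]
        monoidal
    _ = _ := by rw [IsCommMonObj.mul_comm, IsCommMonObj.mul_comm]

/-- The free `A`-module on an object centralizing `A`, a local module. -/
def freeModule (X : C) (hX : (β_ A.X X).hom ≫ (β_ X A.X).hom = 𝟙 _) : LocalModule A :=
  LocalModule.ofLeft (A.X ⊗ X) ((α_ A.X A.X X).inv ≫ μ[A.X] ▷ X)
    (by
      rw [associator_inv_naturality_left_assoc, ← comp_whiskerRight, one_mul]
      monoidal)
    (by
      rw [associator_inv_naturality_left_assoc, ← comp_whiskerRight, mul_assoc]
      monoidal)
    (freeModule_isLocal hX)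

variable [Preadditive C] [MonoidalPreadditive C] [Linear ℂ C] [MonoidalLinear ℂ C]

/-- The underlying morphism of a morphism out of a free module. -/
def freeModuleHom {X : C} {hX : (β_ A.X X).hom ≫ (β_ X A.X).hom = 𝟙 _} {M : LocalModule A} :
    (freeModule X hX ⟶ M) →ₗ[ℂ] (A.X ⊗ X ⟶ M.obj.X) :=
  (forgetLocal A).mapLinearMap ℂ

lemma freeModuleHom_linear {X : C} {hX : (β_ A.X X).hom ≫ (β_ X A.X).hom = 𝟙 _}
    {M : LocalModule A} (f : freeModule X hX ⟶ M) :
    A.X ◁ freeModuleHom f ≫ M.obj.actLeft =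
      (α_ A.X A.X X).inv ≫ μ[A.X] ▷ X ≫ freeModuleHom f :=
  f.hom.left_act_hom.symm.trans (Category.assoc _ _ _)

/-- The morphism of modules `a ⊗ x ↦ a g(x)`. -/
def freeModuleLift {X : C} (hX : (β_ A.X X).hom ≫ (β_ X A.X).hom = 𝟙 _) {M : LocalModule A}
    (g : X ⟶ M.obj.X) : freeModule X hX ⟶ M :=
  LocalModule.homOfLeft (M := freeModule X hX) (A.X ◁ g ≫ M.obj.actLeft) (by
    change ((α_ A.X A.X X).inv ≫ μ[A.X] ▷ X) ≫ A.X ◁ g ≫ M.obj.actLeft =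
      A.X ◁ (A.X ◁ g ≫ M.obj.actLeft) ≫ M.obj.actLeft
    rw [Category.assoc, ← whisker_exchange_assoc, M.obj.left_assoc]
    simp)

lemma freeModuleHom_lift {X : C} (hX : (β_ A.X X).hom ≫ (β_ X A.X).hom = 𝟙 _)
    {M : LocalModule A} (g : X ⟶ M.obj.X) :
    freeModuleHom (freeModuleLift hX g) = A.X ◁ g ≫ M.obj.actLeft :=
  rfl

lemma freeModuleHom_injective {X : C} {hX : (β_ A.X X).hom ≫ (β_ X A.X).hom = 𝟙 _}
    {M : LocalModule A} {f g : freeModule X hX ⟶ M} (h : freeModuleHom f = freeModuleHom g) :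
    f = g :=
  localModule_hom_ext h

/-- Frobenius reciprocity: the free module is left adjoint to the forgetful functor. -/
def freeModuleHomEquiv (X : C) (hX : (β_ A.X X).hom ≫ (β_ X A.X).hom = 𝟙 _) (M : LocalModule A) :
    (freeModule X hX ⟶ M) ≃ₗ[ℂ] (X ⟶ M.obj.X) where
  toFun f := (λ_ X).inv ≫ η[A.X] ▷ X ≫ freeModuleHom f
  invFun g := freeModuleLift hX g
  map_add' f g := by simp
  map_smul' c f := by simp
  left_inv f := by
    apply freeModuleHom_injective
    rw [freeModuleHom_lift]
    calc _ = A.X ◁ (λ_ X).inv ≫ A.X ◁ η[A.X] ▷ X ≫ A.X ◁ freeModuleHom f ≫ M.obj.actLeft := by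
          simp
      _ = 𝟙 _ ⊗≫ (A.X ◁ η[A.X] ≫ μ[A.X]) ▷ X ≫ freeModuleHom f := by
          rw [freeModuleHom_linear]
          monoidal
      _ = _ := by
          rw [mul_one]
          monoidal
  right_inv g := by
    change (λ_ X).inv ≫ η[A.X] ▷ X ≫ freeModuleHom (freeModuleLift hX g) = g
    rw [freeModuleHom_lift, ← whisker_exchange_assoc, M.obj.one_actLeft]
    simp

end FreeModules

/-! ### Duals of local modules -/

section Duals

open MonObj BraidedCategory ExactPairing

variable {C : Type u} [Category.{v} C] [MonoidalCategory C]

/-- The morphism `W ⟶ X` corresponding to a pairing of `W` with the dual `Y` of `X`. -/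
def leftTranspose (X : C) {Y W : C} [ExactPairing X Y] (g : Y ⊗ W ⟶ 𝟙_ C) : W ⟶ X :=
  (λ_ W).inv ≫ η_ X Y ▷ W ≫ (α_ _ _ _).hom ≫ X ◁ g ≫ (ρ_ X).hom

lemma whiskerLeft_leftTranspose (X : C) {Y W : C} [ExactPairing X Y] (g : Y ⊗ W ⟶ 𝟙_ C) :
    Y ◁ leftTranspose X g ≫ ε_ X Y = g := by
  calc _ = 𝟙 _ ⊗≫ Y ◁ η_ X Y ▷ W ⊗≫ ((Y ⊗ X) ◁ g ≫ ε_ X Y ▷ 𝟙_ C) ⊗≫ 𝟙 _ := by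
        rw [leftTranspose]
        monoidal
    _ = 𝟙 _ ⊗≫ (Y ◁ η_ X Y ⊗≫ ε_ X Y ▷ Y) ▷ W ⊗≫ g := by
        rw [whisker_exchange]
        monoidal
    _ = g := by
        rw [coevaluation_evaluation'']
        monoidal

/-- If `η` and `ε` satisfy one of the two triangle identities, then the composite `z` in the other
one is absorbed by `ε`. -/
lemma whiskerLeft_zigzag_comp {X Y : C} (η' : 𝟙_ C ⟶ X ⊗ Y) (ε' : Y ⊗ X ⟶ 𝟙_ C)
    (h : Y ◁ η' ≫ (α_ _ _ _).inv ≫ ε' ▷ Y = (ρ_ Y).hom ≫ (λ_ Y).inv) :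
    Y ◁ ((λ_ X).inv ≫ η' ▷ X ≫ (α_ _ _ _).hom ≫ X ◁ ε' ≫ (ρ_ X).hom) ≫ ε' = ε' := by
  calc _ = 𝟙 _ ⊗≫ Y ◁ η' ▷ X ⊗≫ ((Y ⊗ X) ◁ ε' ≫ ε' ▷ 𝟙_ C) ⊗≫ 𝟙 _ := by monoidal
    _ = 𝟙 _ ⊗≫ (Y ◁ η' ≫ (α_ _ _ _).inv ≫ ε' ▷ Y) ▷ X ⊗≫ ε' := by
        rw [whisker_exchange]
        monoidal
    _ = ε' := by
        rw [h]
        monoidal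

section Action

variable {A : Mon C} (M : Bimod A A) (N : C) [ExactPairing N M.X]

/-- The left action of `A` on the dual of a bimodule, the transpose of the right action. -/
def dualAct : A.X ⊗ N ⟶ N :=
  leftTranspose N ((α_ M.X A.X N).inv ≫ M.actRight ▷ N ≫ ε_ N M.X)

lemma whiskerLeft_dualAct :
    M.X ◁ dualAct M N ≫ ε_ N M.X = (α_ M.X A.X N).inv ≫ M.actRight ▷ N ≫ ε_ N M.X :=
  whiskerLeft_leftTranspose _ _

lemma one_dualAct : η[A.X] ▷ N ≫ dualAct M N = (λ_ N).hom := by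
  apply leftDual_hom_ext (Y := M.X)
  rw [whiskerLeft_comp, Category.assoc, whiskerLeft_dualAct]
  calc _ = 𝟙 _ ⊗≫ (M.X ◁ η[A.X] ≫ M.actRight) ▷ N ≫ ε_ N M.X := by monoidal
    _ = _ := by
      rw [M.actRight_one]
      monoidal

lemma mul_dualAct : μ[A.X] ▷ N ≫ dualAct M N =
    (α_ A.X A.X N).hom ≫ A.X ◁ dualAct M N ≫ dualAct M N := by
  apply leftDual_hom_ext (Y := M.X)
  calc _ = 𝟙 _ ⊗≫ (M.X ◁ μ[A.X] ≫ M.actRight) ▷ N ≫ ε_ N M.X := by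
        rw [whiskerLeft_comp, Category.assoc, whiskerLeft_dualAct]
        monoidal
    _ = 𝟙 _ ⊗≫ M.actRight ▷ A.X ▷ N ⊗≫ (M.actRight ▷ N ≫ ε_ N M.X) := by
        rw [M.right_assoc]
        monoidal
    _ = 𝟙 _ ⊗≫ (M.actRight ▷ (A.X ⊗ N) ≫ M.X ◁ dualAct M N) ≫ ε_ N M.X := by
        rw [Category.assoc, whiskerLeft_dualAct]
        monoidal
    _ = 𝟙 _ ⊗≫ M.X ◁ A.X ◁ dualAct M N ≫ (α_ _ _ _).inv ≫ M.actRight ▷ N ≫ ε_ N M.X := by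
        rw [← whisker_exchange]
        monoidal
    _ = _ := by
        rw [← whiskerLeft_dualAct]
        monoidal

end Action

variable [BraidedCategory C]

/-- If `Y` centralizes `Z`, then so does its dual. -/
lemma monodromy_dual_eq_id (X : C) {Y Z : C} [ExactPairing X Y]
    (h : (β_ Z Y).hom ≫ (β_ Y Z).hom = 𝟙 _) : (β_ Z X).hom ≫ (β_ X Z).hom = 𝟙 _ := by
  have h1 : (β_ Z Y).hom ▷ X ⊗≫ Y ◁ (β_ Z X).hom ⊗≫ ε_ X Y ▷ Z =
      𝟙 _ ⊗≫ Z ◁ ε_ X Y ⊗≫ 𝟙 _ := by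
    have := braiding_naturality_right Z (ε_ X Y)
    rw [braiding_tensor_right_hom, braiding_tensorUnit_right] at this
    calc _ = 𝟙 _ ⊗≫ (((α_ Z Y X).inv ≫ (β_ Z Y).hom ▷ X ≫ (α_ Y Z X).hom ≫
          Y ◁ (β_ Z X).hom ≫ (α_ Y X Z).inv) ≫ ε_ X Y ▷ Z) ⊗≫ 𝟙 _ := by monoidal
      _ = _ := by
        rw [← this]
        monoidal
  have h2 : (β_ Z Y).hom ▷ X ⊗≫ Y ◁ (β_ X Z).inv ⊗≫ ε_ X Y ▷ Z =
      𝟙 _ ⊗≫ Z ◁ ε_ X Y ⊗≫ 𝟙 _ := by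
    have := braiding_inv_naturality_right Z (ε_ X Y)
    rw [braiding_tensor_left_inv, braiding_inv_tensorUnit_left] at this
    have hZY : (β_ Z Y).hom = (β_ Y Z).inv := by
      rw [← cancel_mono (β_ Y Z).hom, h, Iso.inv_hom_id]
    calc _ = 𝟙 _ ⊗≫ (((α_ Z Y X).inv ≫ (β_ Y Z).inv ▷ X ≫ (α_ Y Z X).hom ≫
          Y ◁ (β_ X Z).inv ≫ (α_ Y X Z).inv) ≫ ε_ X Y ▷ Z) ⊗≫ 𝟙 _ := by
          rw [hZY]
          monoidal
      _ = _ := by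
        rw [← this]
        monoidal
  have h3 : (β_ Z X).hom = (β_ X Z).inv := by
    apply (tensorLeftHomEquiv (Z ⊗ X) X Y Z).symm.injective
    change Y ◁ (β_ Z X).hom ≫ (α_ _ _ _).inv ≫ ε_ X Y ▷ Z ≫ (λ_ Z).hom =
      Y ◁ (β_ X Z).inv ≫ (α_ _ _ _).inv ≫ ε_ X Y ▷ Z ≫ (λ_ Z).hom
    rw [← cancel_epi (α_ Y Z X).hom, ← cancel_epi ((β_ Z Y).hom ▷ X)]
    simpa [monoidalComp] using (h1.trans h2.symm) =≫ (λ_ Z).hom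
  rw [h3, Iso.inv_hom_id]

end Duals

section DualModules

open MonObj BraidedCategory ExactPairing

variable {C : Type u} [Category.{v} C] [MonoidalCategory C] {A : Mon C}

lemma SpecialFrobenius.actRight_coact (Fr : SpecialFrobenius A) (M : Bimod A A) :
    M.actRight ≫ Fr.coact M = Fr.coact M ▷ A.X ≫ (α_ _ _ _).hom ≫ A.X ◁ M.actRight := by
  calc _ = 𝟙 _ ⊗≫ (𝟙_ C ◁ M.actRight ≫ (η[A.X] ≫ Fr.comul) ▷ M.X) ⊗≫ A.X ◁ M.actLeft := by
        simp only [SpecialFrobenius.coact, SpecialFrobenius.coactMul]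
        monoidal
    _ = 𝟙 _ ⊗≫ (η[A.X] ≫ Fr.comul) ▷ M.X ▷ A.X ⊗≫ A.X ◁ ((α_ _ _ _).hom ≫
          A.X ◁ M.actRight ≫ M.actLeft) := by
        rw [whisker_exchange]
        monoidal
    _ = _ := by
        rw [← M.middle_assoc]
        simp only [SpecialFrobenius.coact, SpecialFrobenius.coactMul]
        monoidal

section Pairing

variable (Fr : SpecialFrobenius A) (M N : Bimod A A) [ExactPairing N.X M.X]

/-- The `A`-valued pairing `m ⊗ n ↦ ∑ e₁ ⟨e₂ m, n⟩` of a module with its dual. -/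
def pairing : M.X ⊗ N.X ⟶ A.X :=
  Fr.coact M ▷ N.X ≫ (α_ _ _ _).hom ≫ A.X ◁ ε_ N.X M.X ≫ (ρ_ A.X).hom

lemma pairing_counit : pairing Fr M N ≫ Fr.counit = ε_ N.X M.X := by
  calc _ = 𝟙 _ ⊗≫ Fr.coact M ▷ N.X ⊗≫ (A.X ◁ ε_ N.X M.X ≫ Fr.counit ▷ 𝟙_ C) ⊗≫ 𝟙 _ := by
        rw [pairing]
        monoidal
    _ = 𝟙 _ ⊗≫ (Fr.coact M ≫ Fr.counit ▷ M.X) ▷ N.X ⊗≫ ε_ N.X M.X := by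
        rw [whisker_exchange]
        monoidal
    _ = _ := by
        rw [Fr.coact_counit]
        monoidal

lemma actLeft_pairing : (α_ _ _ _).inv ≫ M.actLeft ▷ N.X ≫ pairing Fr M N =
    A.X ◁ pairing Fr M N ≫ μ[A.X] := by
  calc _ = 𝟙 _ ⊗≫ (M.actLeft ≫ Fr.coact M) ▷ N.X ⊗≫ A.X ◁ ε_ N.X M.X ⊗≫ 𝟙 _ := by
        rw [pairing]
        monoidal
    _ = 𝟙 _ ⊗≫ A.X ◁ Fr.coact M ▷ N.X ⊗≫ (μ[A.X] ▷ (M.X ⊗ N.X) ≫ A.X ◁ ε_ N.X M.X) ⊗≫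
          𝟙 _ := by
        rw [Fr.actLeft_coact, ← Fr.whiskerLeft_coact]
        monoidal
    _ = _ := by
        rw [← whisker_exchange, pairing]
        monoidal

/-- The triangle identity in `C`, read through the `A`-valued pairing. -/
lemma coevaluation_pairing : (ρ_ M.X).inv ≫ M.X ◁ η_ N.X M.X ≫ (α_ _ _ _).inv ≫
    pairing Fr M N ▷ M.X ≫ M.actLeft = 𝟙 M.X := by
  calc _ = 𝟙 _ ⊗≫ (M.X ◁ η_ N.X M.X ≫ Fr.coact M ▷ (N.X ⊗ M.X)) ⊗≫
        A.X ◁ ε_ N.X M.X ▷ M.X ⊗≫ M.actLeft := by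
        rw [pairing]
        monoidal
    _ = 𝟙 _ ⊗≫ Fr.coact M ⊗≫ A.X ◁ (M.X ◁ η_ N.X M.X ⊗≫ ε_ N.X M.X ▷ M.X) ⊗≫ M.actLeft := by
        rw [whisker_exchange]
        monoidal
    _ = Fr.coact M ≫ M.actLeft := by
        rw [coevaluation_evaluation'']
        monoidal
    _ = _ := Fr.coact_actLeft M

variable (hMN : M.X ◁ N.actLeft ≫ ε_ N.X M.X = (α_ _ _ _).inv ≫ M.actRight ▷ N.X ≫ ε_ N.X M.X)
include hMN

lemma pairing_balanced : M.actRight ▷ N.X ≫ pairing Fr M N =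
    (α_ _ _ _).hom ≫ M.X ◁ N.actLeft ≫ pairing Fr M N := by
  calc _ = (M.actRight ≫ Fr.coact M) ▷ N.X ⊗≫ A.X ◁ ε_ N.X M.X ⊗≫ 𝟙 _ := by
        rw [pairing]
        monoidal
    _ = Fr.coact M ▷ A.X ▷ N.X ⊗≫ A.X ◁ ((α_ _ _ _).inv ≫ M.actRight ▷ N.X ≫
          ε_ N.X M.X) ⊗≫ 𝟙 _ := by
        rw [Fr.actRight_coact]
        monoidal
    _ = 𝟙 _ ⊗≫ (Fr.coact M ▷ (A.X ⊗ N.X) ≫ (A.X ⊗ M.X) ◁ N.actLeft) ⊗≫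
          A.X ◁ ε_ N.X M.X ⊗≫ 𝟙 _ := by
        rw [← hMN]
        monoidal
    _ = _ := by
        rw [← whisker_exchange, pairing]
        monoidal

end Pairing

/-- The morphism `A ⟶ N ⊗ M` of left modules extending the coevaluation in `C`. -/
def coevalAux (M N : Bimod A A) [ExactPairing N.X M.X] : A.X ⟶ N.X ⊗ M.X :=
  (ρ_ A.X).inv ≫ A.X ◁ η_ N.X M.X ≫ (α_ _ _ _).inv ≫ N.actLeft ▷ M.X

lemma one_coevalAux (M N : Bimod A A) [ExactPairing N.X M.X] :
    η[A.X] ≫ coevalAux M N = η_ N.X M.X := by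
  calc _ = 𝟙 _ ⊗≫ (η[A.X] ▷ 𝟙_ C ≫ A.X ◁ η_ N.X M.X) ⊗≫ N.actLeft ▷ M.X := by
        rw [coevalAux]
        monoidal
    _ = 𝟙 _ ⊗≫ η_ N.X M.X ⊗≫ (η[A.X] ▷ N.X ≫ N.actLeft) ▷ M.X := by
        rw [← whisker_exchange]
        monoidal
    _ = _ := by
        rw [N.one_actLeft]
        monoidal

lemma mul_coevalAux (M N : Bimod A A) [ExactPairing N.X M.X] :
    μ[A.X] ≫ coevalAux M N =
      A.X ◁ coevalAux M N ≫ (α_ _ _ _).inv ≫ N.actLeft ▷ M.X := by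
  calc _ = 𝟙 _ ⊗≫ (μ[A.X] ▷ 𝟙_ C ≫ A.X ◁ η_ N.X M.X) ⊗≫ N.actLeft ▷ M.X := by
        rw [coevalAux]
        monoidal
    _ = 𝟙 _ ⊗≫ A.X ◁ A.X ◁ η_ N.X M.X ⊗≫ (μ[A.X] ▷ N.X ≫ N.actLeft) ▷ M.X := by
        rw [← whisker_exchange]
        monoidal
    _ = _ := by
        rw [N.left_assoc, coevalAux]
        monoidal

variable [HasCoequalizers C] [∀ X : C, PreservesColimitsOfSize.{0, 0} (tensorLeft X)]
  [∀ X : C, PreservesColimitsOfSize.{0, 0} (tensorRight X)]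

/-- The evaluation `M ⊗_A N ⟶ A`, as a morphism of `C`. -/
def evalAux (Fr : SpecialFrobenius A) (M N : Bimod A A) [ExactPairing N.X M.X]
    (hMN : M.X ◁ N.actLeft ≫ ε_ N.X M.X = (α_ _ _ _).inv ≫ M.actRight ▷ N.X ≫ ε_ N.X M.X) :
    (M ⊗ N).X ⟶ A.X :=
  descTensor (pairing Fr M N) (pairing_balanced Fr M N hMN)

lemma proj_evalAux (Fr : SpecialFrobenius A) (M N : Bimod A A) [ExactPairing N.X M.X]
    (hMN : M.X ◁ N.actLeft ≫ ε_ N.X M.X = (α_ _ _ _).inv ≫ M.actRight ▷ N.X ≫ ε_ N.X M.X) :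
    proj M N ≫ evalAux Fr M N hMN = pairing Fr M N :=
  proj_descTensor _ (pairing_balanced Fr M N hMN)

lemma actLeft_evalAux (Fr : SpecialFrobenius A) (M N : Bimod A A) [ExactPairing N.X M.X]
    (hMN : M.X ◁ N.actLeft ≫ ε_ N.X M.X = (α_ _ _ _).inv ≫ M.actRight ▷ N.X ≫ ε_ N.X M.X) :
    (M ⊗ N).actLeft ≫ evalAux Fr M N hMN = A.X ◁ evalAux Fr M N hMN ≫ μ[A.X] := by
  rw [← cancel_epi (A.X ◁ proj M N), reassoc_of% whiskerLeft_proj_actLeft, evalAux,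
    proj_descTensor, actLeft_pairing, ← whiskerLeft_comp_assoc, proj_descTensor]

lemma coevalAux_proj_linear (M N : Bimod A A) [ExactPairing N.X M.X] :
    μ[A.X] ≫ coevalAux M N ≫ proj N M =
      A.X ◁ (coevalAux M N ≫ proj N M) ≫ (N ⊗ M).actLeft := by
  rw [reassoc_of% mul_coevalAux, whiskerLeft_comp, Category.assoc, whiskerLeft_proj_actLeft]

lemma proj_leftUnitor_hom (M : Bimod A A) :
    proj (𝟙_ (Bimod A A)) M ≫ (λ_ M).hom.hom = M.actLeft :=
  coequalizer.π_desc _ _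

/-- The first triangle identity for modules follows from the one in `C`. -/
lemma zigzag_bimod (Fr : SpecialFrobenius A) (M N : Bimod A A) [ExactPairing N.X M.X]
    (c : 𝟙_ (Bimod A A) ⟶ N ⊗ M) (e : M ⊗ N ⟶ 𝟙_ (Bimod A A))
    (hc : η[A.X] ≫ c.hom = η_ N.X M.X ≫ proj N M) (he : proj M N ≫ e.hom = pairing Fr M N) :
    M ◁ c ≫ (α_ _ _ _).inv ≫ e ▷ M = (ρ_ M).hom ≫ (λ_ M).inv := by
  rw [Iso.eq_comp_inv, ← Iso.inv_comp_eq_id]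
  apply Bimod.hom_ext
  change ((ρ_ M.X).inv ≫ M.X ◁ η[A.X] ≫ proj M (𝟙_ (Bimod A A))) ≫
    ((M ◁ c).hom ≫ (α_ M N M).inv.hom ≫ (e ▷ M).hom) ≫ (λ_ M).hom.hom = 𝟙 M.X
  have h1 : (M.X ◁ η[A.X] ≫ proj M (𝟙_ (Bimod A A))) ≫ (M ◁ c).hom =
      M.X ◁ η_ N.X M.X ≫ M.X ◁ proj N M ≫ proj M (N ⊗ M) :=
    calc _ = M.X ◁ η[A.X] ≫ proj M (𝟙_ (Bimod A A)) ≫ (M ◁ c).hom := Category.assoc _ _ _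
      _ = M.X ◁ η[A.X] ≫ M.X ◁ c.hom ≫ proj M (N ⊗ M) :=
          congrArg (M.X ◁ η[A.X] ≫ ·) (proj_whiskerLeft M c)
      _ = M.X ◁ (η[A.X] ≫ c.hom) ≫ proj M (N ⊗ M) := (whiskerLeft_comp_assoc _ _ _ _).symm
      _ = _ := by rw [hc, whiskerLeft_comp, Category.assoc]
  have h2 : proj M N ▷ M.X ≫ proj (M ⊗ N) M ≫ (e ▷ M).hom ≫ (λ_ M).hom.hom =
      pairing Fr M N ▷ M.X ≫ M.actLeft :=
    calc _ = proj M N ▷ M.X ≫ (e.hom ▷ M.X ≫ proj (𝟙_ (Bimod A A)) M) ≫ (λ_ M).hom.hom := by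
          rw [← proj_whiskerRight, Category.assoc]
      _ = proj M N ▷ M.X ≫ e.hom ▷ M.X ≫ M.actLeft := by
          rw [Category.assoc, proj_leftUnitor_hom]
      _ = (proj M N ≫ e.hom) ▷ M.X ≫ M.actLeft := (comp_whiskerRight_assoc _ _ _ _).symm
      _ = _ := by
          rw [he]
          rfl
  have h3 {Z : C} (k : (M ⊗ (N ⊗ M)).X ⟶ Z) :
      (M.X ◁ η[A.X] ≫ proj M (𝟙_ (Bimod A A))) ≫ (M ◁ c).hom ≫ k =
        M.X ◁ η_ N.X M.X ≫ M.X ◁ proj N M ≫ proj M (N ⊗ M) ≫ k :=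
    ((Category.assoc _ _ k).symm.trans (congrArg (· ≫ k) h1)).trans (by simp only [Category.assoc])
  simp only [Category.assoc]
  refine (congrArg ((ρ_ M.X).inv ≫ ·) (h3 _)).trans ?_
  rw [reassoc_of% proj_associator_inv, h2]
  exact coevaluation_pairing Fr M N

variable [BraidedCategory C] [IsCommMonObj A.X]

section LocalDuals

variable (Fr : SpecialFrobenius A) (M N : LocalModule A) [ExactPairing N.obj.X M.obj.X]
  (hMN : M.obj.X ◁ N.obj.actLeft ≫ ε_ N.obj.X M.obj.X =
    (α_ _ _ _).inv ≫ M.obj.actRight ▷ N.obj.X ≫ ε_ N.obj.X M.obj.X)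

/-- The coevaluation `A ⟶ N ⊗_A M` of local modules. -/
def coevalModule : 𝟙_ (LocalModule A) ⟶ N ⊗ M :=
  LocalModule.homOfLeft (M := 𝟙_ (LocalModule A)) (N := N ⊗ M)
    (coevalAux M.obj N.obj ≫ proj N.obj M.obj) (coevalAux_proj_linear M.obj N.obj)

/-- The evaluation `M ⊗_A N ⟶ A` of local modules. -/
def evalModule : M ⊗ N ⟶ 𝟙_ (LocalModule A) :=
  LocalModule.homOfLeft (M := M ⊗ N) (N := 𝟙_ (LocalModule A))
    (evalAux Fr M.obj N.obj hMN) (actLeft_evalAux Fr M.obj N.obj hMN)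

lemma one_coevalModule :
    η[A.X] ≫ (coevalModule M N).hom.hom = η_ N.obj.X M.obj.X ≫ proj N.obj M.obj := by
  change η[A.X] ≫ coevalAux M.obj N.obj ≫ proj N.obj M.obj = _
  rw [reassoc_of% one_coevalAux]

lemma proj_evalModule :
    proj M.obj N.obj ≫ (evalModule Fr M N hMN).hom.hom = pairing Fr M.obj N.obj :=
  proj_evalAux Fr M.obj N.obj hMN

lemma coevalModule_evalModule :
    M ◁ coevalModule M N ≫ (α_ _ _ _).inv ≫ evalModule Fr M N hMN ▷ M =
      (ρ_ M).hom ≫ (λ_ M).inv :=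
  ObjectProperty.hom_ext _ (zigzag_bimod Fr M.obj N.obj (coevalModule M N).hom
    (evalModule Fr M N hMN).hom (one_coevalModule M N) (proj_evalModule Fr M N hMN))

lemma evalModule_coevalModule :
    coevalModule M N ▷ N ≫ (α_ _ _ _).hom ≫ N ◁ evalModule Fr M N hMN =
      (λ_ N).hom ≫ (ρ_ N).inv := by
  have h := whiskerLeft_zigzag_comp _ _ (coevalModule_evalModule Fr M N hMN)
  rw [← cancel_mono (ρ_ N).hom, ← cancel_epi (λ_ N).inv]
  simp only [Category.assoc, Iso.inv_hom_id, Iso.inv_hom_id_assoc]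
  set z := (λ_ N).inv ≫ coevalModule M N ▷ N ≫ (α_ _ _ _).hom ≫ N ◁ evalModule Fr M N hMN ≫
    (ρ_ N).hom with hz
  have h' : M.obj.X ◁ z.hom.hom ≫ pairing Fr M.obj N.obj = pairing Fr M.obj N.obj := by
    have h'' : (M.obj ◁ z.hom).hom ≫ evalAux Fr M.obj N.obj hMN = evalAux Fr M.obj N.obj hMN :=
      congrArg (fun f => f.hom.hom) h
    rw [← proj_evalAux Fr M.obj N.obj hMN, ← reassoc_of% proj_whiskerLeft, h'']
  apply localModule_hom_ext
  change z.hom.hom = 𝟙 N.obj.X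
  apply leftDual_hom_ext (Y := M.obj.X)
  rw [← pairing_counit Fr M.obj N.obj, reassoc_of% h']
  simp

/-- A left dual of `M` in `C`, with the transposed action, is a left dual in local modules. -/
abbrev localExactPairing : ExactPairing N M where
  coevaluation' := coevalModule M N
  evaluation' := evalModule Fr M N hMN
  coevaluation_evaluation' := coevalModule_evalModule Fr M N hMN
  evaluation_coevaluation' := evalModule_coevalModule Fr M N hMN

end LocalDuals

end DualModules

/-! ### Dimensions of local modules -/

section LocalDimensions

open MonObj BraidedCategory ExactPairing

section Swap

variable {D : Type u} [Category.{v} D] [MonoidalCategory D] [BraidedCategory D] [Twist D]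

/-- The dimension of `X`, computed with a left dual `Y` of `X`. -/
lemma exists_exactPairing_traceHom_eq (X Y : D) [ExactPairing Y X] :
    ∃ _ : ExactPairing X Y,
      traceHom X Y (𝟙 X) = η_ Y X ≫ Y ◁ (θ X).hom ≫ (β_ Y X).hom ≫ ε_ Y X := by
  refine ⟨BraidedCategory.exactPairing_swap Y X, ?_⟩
  change (η_ Y X ≫ (β_ X Y).inv) ≫ (𝟙 X ≫ (θ X).hom) ▷ Y ≫ (β_ X Y).hom ≫ (β_ Y X).hom ≫
    ε_ Y X = _
  rw [Category.id_comp, braiding_naturality_left_assoc, Category.assoc, Iso.inv_hom_id_assoc]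

end Swap

variable {C : Type u} [Category.{v} C] [Preadditive C] [Linear ℂ C] [MonoidalCategory C]
  [MonoidalPreadditive C] [MonoidalLinear ℂ C] {A : Mon C}
  [HasCoequalizers C] [∀ X : C, PreservesColimitsOfSize.{0, 0} (tensorLeft X)]
  [∀ X : C, PreservesColimitsOfSize.{0, 0} (tensorRight X)]
  [BraidedCategory C] [IsCommMonObj A.X]

/-- Endomorphisms of the regular module are scalars if the algebra is connected. -/
lemma exists_eq_smul_id_unit (hconn : ∀ f : 𝟙_ C ⟶ A.X, ∃ c : ℂ, f = c • η[A.X])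
    (f : 𝟙_ (LocalModule A) ⟶ 𝟙_ (LocalModule A)) : ∃ c : ℂ, f = c • 𝟙 _ := by
  let g : A.X ⟶ A.X := f.hom.hom
  have hg : μ[A.X] ≫ g = A.X ◁ g ≫ μ[A.X] := f.hom.left_act_hom
  obtain ⟨c, hc⟩ := hconn (η[A.X] ≫ g)
  refine ⟨c, localModule_hom_ext ?_⟩
  change g = c • 𝟙 A.X
  calc g = ((ρ_ A.X).inv ≫ A.X ◁ η[A.X] ≫ μ[A.X]) ≫ g := by simp
    _ = (ρ_ A.X).inv ≫ A.X ◁ (η[A.X] ≫ g) ≫ μ[A.X] := by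
      rw [Category.assoc, Category.assoc, hg, whiskerLeft_comp_assoc]
    _ = c • 𝟙 A.X := by
      rw [hc]
      simp

variable [Twist C] [TrivialTwist A.X]

/-- The object `N` of `C`, dual to a local module `M`, as a local module. -/
def dualModule (M : LocalModule A) (N : C) [ExactPairing N M.obj.X]
    (hM : (β_ A.X M.obj.X).hom ≫ (β_ M.obj.X A.X).hom = 𝟙 _) : LocalModule A :=
  LocalModule.ofLeft N (dualAct M.obj N) (one_dualAct M.obj N) (mul_dualAct M.obj N) (by
    rw [← Category.assoc, monodromy_dual_eq_id N hM, Category.id_comp])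

/-- A local module that centralizes the algebra has a dual in the category of local modules, and
its dimension is proportional to the one in `C`: unit, trace over `A` and counit compose to the
trace in `C`, and the trace over `A` is a scalar because `A` is connected. -/
lemma exists_dual_qdim_eq (Fr : SpecialFrobenius A)
    (hconn : ∀ f : 𝟙_ C ⟶ A.X, ∃ c : ℂ, f = c • η[A.X])
    (h1 : 𝟙 (𝟙_ C) ≠ 0) (hA : η[A.X] ≠ 0) {d : ℂ} (hd : η[A.X] ≫ Fr.counit = d • 𝟙 _)
    (M : LocalModule A) (N : C) [ExactPairing N M.obj.X]
    (hM : (β_ A.X M.obj.X).hom ≫ (β_ M.obj.X A.X).hom = 𝟙 _) :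
    Nonempty (HasRightDual M) ∧ qdim M.obj.X = d * qdim M := by
  let N' : LocalModule A := dualModule M N hM
  let i1 : ExactPairing N'.obj.X M.obj.X := ‹ExactPairing N M.obj.X›
  have hMN : M.obj.X ◁ N'.obj.actLeft ≫ ε_ N'.obj.X M.obj.X =
      (α_ _ _ _).inv ≫ M.obj.actRight ▷ N'.obj.X ≫ ε_ N'.obj.X M.obj.X :=
    whiskerLeft_dualAct M.obj N
  let i2 : ExactPairing N' M := localExactPairing Fr M N' hMN
  obtain ⟨e, he⟩ := exists_exactPairing_traceHom_eq M N'
  obtain ⟨e', he'⟩ := exists_exactPairing_traceHom_eq M.obj.X N'.obj.X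
  refine ⟨⟨⟨N'⟩⟩, ?_⟩
  obtain ⟨c, hc⟩ := exists_eq_smul_id_unit hconn (traceHom M N' (𝟙 M))
  have hid : 𝟙 (𝟙_ (LocalModule A)) ≠ 0 := by
    intro h
    have h' : 𝟙 A.X = 0 := congrArg (fun f => f.hom.hom) h
    apply hA
    rw [← Category.comp_id η[A.X], h', comp_zero]
  rw [qdim_eq_scalar_traceHom M N', hc, scalar_smul_id hid,
    qdim_eq_scalar_traceHom M.obj.X N'.obj.X]
  suffices h : traceHom M.obj.X N'.obj.X (𝟙 M.obj.X) = (d * c) • 𝟙 _ by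
    rw [h, scalar_smul_id h1]
  have key : η[A.X] ≫ ((coevalAux M.obj N'.obj ≫ proj N'.obj M.obj) ≫
      (N' ◁ (θ M).hom).hom.hom ≫ (β_ N' M).hom.hom.hom ≫ evalAux Fr M.obj N'.obj hMN) ≫
        Fr.counit = traceHom M.obj.X N'.obj.X (𝟙 M.obj.X) := by
    have t1 : proj N'.obj M.obj ≫ (N' ◁ (θ M).hom).hom.hom =
        N'.obj.X ◁ (θ M.obj.X).hom ≫ proj N'.obj M.obj :=
      proj_whiskerLeft N'.obj (θ M).hom.hom
    have t2 : proj N'.obj M.obj ≫ (β_ N' M).hom.hom.hom =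
        (β_ N'.obj.X M.obj.X).hom ≫ proj M.obj N'.obj := proj_localBraiding N' M
    simp only [Category.assoc]
    rw [he', reassoc_of% one_coevalAux, reassoc_of% t1, reassoc_of% t2,
      reassoc_of% proj_evalAux, pairing_counit]
  have key' : η[A.X] ≫ (traceHom M N' (𝟙 M)).hom.hom ≫ Fr.counit =
      traceHom M.obj.X N'.obj.X (𝟙 M.obj.X) := by
    rw [he, ← key]
    rfl
  rw [← key', hc, mul_comm, mul_smul, ← hd]
  change η[A.X] ≫ (c • 𝟙 A.X) ≫ Fr.counit = _
  simp

end LocalDimensions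

/-! ### The algebra of functions on a finite group -/

section MapFrobenius

open MonObj Functor

variable {D : Type*} [Category D] [MonoidalCategory D]
  {C : Type*} [Category C] [MonoidalCategory C]

open scoped Obj in
/-- A monoidal functor preserves special Frobenius algebras. -/
def SpecialFrobenius.map (F : D ⥤ C) [F.Monoidal] {A : Mon D} (Fr : SpecialFrobenius A) :
    SpecialFrobenius (Mon.mk (F.obj A.X)) where
  comul := F.map Fr.comul ≫ OplaxMonoidal.δ F _ _
  counit := F.map Fr.counit ≫ OplaxMonoidal.η F
  comul_mul := by
    change (F.map Fr.comul ≫ OplaxMonoidal.δ F _ _) ≫ LaxMonoidal.μ F _ _ ≫ F.map μ[A.X] = 𝟙 _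
    rw [Category.assoc, Monoidal.δ_μ_assoc, ← F.map_comp, Fr.comul_mul, F.map_id]
  mul_comul_left := by
    change F.obj A.X ◁ (F.map Fr.comul ≫ OplaxMonoidal.δ F _ _) ≫ (α_ _ _ _).inv ≫
      (LaxMonoidal.μ F _ _ ≫ F.map μ[A.X]) ▷ F.obj A.X =
        (LaxMonoidal.μ F _ _ ≫ F.map μ[A.X]) ≫ F.map Fr.comul ≫ OplaxMonoidal.δ F _ _
    have h := congrArg (fun f => LaxMonoidal.μ F _ _ ≫ F.map f ≫ OplaxMonoidal.δ F _ _)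
      Fr.mul_comul_left
    simp only [F.map_comp, Category.assoc] at h
    rw [Category.assoc, ← h]
    simp only [Monoidal.map_whiskerLeft, Monoidal.map_whiskerRight, Monoidal.map_associator_inv,
      Category.assoc, Monoidal.μ_δ_assoc, Monoidal.μ_δ, Category.comp_id,
      MonoidalCategory.whiskerLeft_comp,
      comp_whiskerRight]
  mul_comul_right := by
    change (F.map Fr.comul ≫ OplaxMonoidal.δ F _ _) ▷ F.obj A.X ≫ (α_ _ _ _).hom ≫
      F.obj A.X ◁ (LaxMonoidal.μ F _ _ ≫ F.map μ[A.X]) =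
        (LaxMonoidal.μ F _ _ ≫ F.map μ[A.X]) ≫ F.map Fr.comul ≫ OplaxMonoidal.δ F _ _
    have h := congrArg (fun f => LaxMonoidal.μ F _ _ ≫ F.map f ≫ OplaxMonoidal.δ F _ _)
      Fr.mul_comul_right
    simp only [F.map_comp, Category.assoc] at h
    rw [Category.assoc, ← h]
    simp only [Monoidal.map_whiskerLeft, Monoidal.map_whiskerRight, Monoidal.map_associator,
      Category.assoc, Monoidal.μ_δ_assoc, Monoidal.μ_δ, Category.comp_id,
      MonoidalCategory.whiskerLeft_comp,
      comp_whiskerRight]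
  comul_counit := by
    have h := congrArg F.map Fr.comul_counit
    rw [F.map_comp, Monoidal.map_whiskerRight, Monoidal.map_leftUnitor_inv] at h
    have h' := h =≫ (OplaxMonoidal.δ F _ _ ≫ OplaxMonoidal.η F ▷ F.obj A.X)
    simpa using h'

open scoped Obj in
/-- An additive monoidal functor preserves the Galois condition. -/
def GaloisFrobenius.map [Preadditive D] [Preadditive C] (F : D ⥤ C) [F.Monoidal] [F.Additive]
    {A : Mon D} (Ga : GaloisFrobenius A) : GaloisFrobenius (Mon.mk (F.obj A.X)) where
  toSpecialFrobenius := Ga.toSpecialFrobenius.map F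
  K := Ga.K
  p k := F.map (Ga.p k)
  q k := F.map (Ga.q k)
  galois := by
    change ∑ k, F.map (Ga.p k) ≫ (F.map Ga.comul ≫ OplaxMonoidal.δ F _ _) ≫
      F.map (Ga.q k) ▷ F.obj A.X =
        (ρ_ (F.obj A.X)).inv ≫ F.obj A.X ◁ (LaxMonoidal.ε F ≫ F.map η[A.X])
    have h := congrArg (fun f => F.map f ≫ OplaxMonoidal.δ F _ _) Ga.galois
    rw [F.map_comp, Monoidal.map_whiskerLeft, Monoidal.map_rightUnitor_inv, F.map_sum,
      Preadditive.sum_comp] at h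
    simp only [F.map_comp, Monoidal.map_whiskerRight, Category.assoc, Monoidal.μ_δ,
      Category.comp_id] at h
    simpa using h

end MapFrobenius

section FunRep

open TannakaDuality.FiniteGroup MonObj TensorProduct

variable (H : Type) [Group H] [Finite H]

omit [Finite H] in
lemma fdRep_hom_ext {V W : FDRep ℂ H} {f g : V ⟶ W} (h : f.hom.hom.hom = g.hom.hom.hom) :
    f = g :=
  Action.Hom.ext (ObjectProperty.hom_ext _ (ModuleCat.hom_ext h))

attribute [local instance] Fintype.ofFinite
open scoped Classical

/-- The comultiplication of `Fun(H)`: the delta function at `h` is group-like. -/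
def funComulLin : (H → ℂ) →ₗ[ℂ] (H → ℂ) ⊗[ℂ] (H → ℂ) :=
  (Pi.basisFun ℂ H).constr ℂ fun h => Pi.single h (1 : ℂ) ⊗ₜ[ℂ] Pi.single h (1 : ℂ)

omit [Group H] in
lemma funComulLin_single (h : H) :
    funComulLin H (Pi.single h 1) = Pi.single h (1 : ℂ) ⊗ₜ[ℂ] Pi.single h (1 : ℂ) := by
  rw [funComulLin, ← Pi.basisFun_apply, Module.Basis.constr_basis, Pi.basisFun_apply]

omit [Finite H] in
lemma rightRegular_single (s h : H) :
    rightRegular (k := ℂ) s (Pi.single h 1) = Pi.single (h * s⁻¹) 1 := by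
  ext t
  simp [rightRegular_apply, Pi.single_apply, eq_mul_inv_iff_mul_eq]

omit [Finite H] in
lemma leftRegular_single (s h : H) :
    leftRegular (k := ℂ) s (Pi.single h 1) = Pi.single (s * h) 1 := by
  ext t
  simp [leftRegular_apply, Pi.single_apply, inv_mul_eq_iff_eq_mul]

/-- The comultiplication of `Fun(H)` as a morphism of representations. -/
def funComul : funRep H ⟶ funRep H ⊗ funRep H where
  hom := InducedCategory.homMk (ModuleCat.ofHom (funComulLin H))
  comm s := by
    apply ObjectProperty.hom_ext
    apply ModuleCat.hom_ext
    apply (Pi.basisFun ℂ H).ext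
    intro h
    rw [Pi.basisFun_apply]
    change funComulLin H (rightRegular s (Pi.single h 1)) =
      TensorProduct.map (rightRegular s) (rightRegular s) (funComulLin H (Pi.single h 1))
    rw [funComulLin_single, rightRegular_single, funComulLin_single, TensorProduct.map_tmul,
      rightRegular_single]

/-- The counit of `Fun(H)`: summation over `H`. -/
def funCounit : funRep H ⟶ 𝟙_ (FDRep ℂ H) where
  hom := InducedCategory.homMk (ModuleCat.ofHom
    ((Fintype.linearCombination ℂ (fun _ : H => (1 : ℂ))) : (H → ℂ) →ₗ[ℂ] ℂ))
  comm s := by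
    apply ObjectProperty.hom_ext
    apply ModuleCat.hom_ext
    apply (Pi.basisFun ℂ H).ext
    intro h
    rw [Pi.basisFun_apply]
    change Fintype.linearCombination ℂ (fun _ : H => (1 : ℂ)) (rightRegular s (Pi.single h 1)) =
      Fintype.linearCombination ℂ (fun _ : H => (1 : ℂ)) (Pi.single h 1)
    rw [rightRegular_single, Fintype.linearCombination_apply_single,
      Fintype.linearCombination_apply_single]

lemma funUnit_funCounit : η[funRep H] ≫ funCounit H = (Nat.card H : ℂ) • 𝟙 _ := by
  apply fdRep_hom_ext
  apply LinearMap.ext_ring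
  change Fintype.linearCombination ℂ (fun _ : H => (1 : ℂ)) (Algebra.linearMap ℂ (H → ℂ) 1) =
    (Nat.card H : ℂ) • (1 : ℂ)
  simp [Fintype.linearCombination_apply]

/-- The algebra `Fun(H)` is special Frobenius, and Galois with respect to the translations. -/
def funGalois : GaloisFrobenius (Mon.mk (funRep H)) where
  comul := funComul H
  counit := funCounit H
  comul_mul := by
    apply fdRep_hom_ext
    apply (Pi.basisFun ℂ H).ext
    intro h
    rw [Pi.basisFun_apply]
    change LinearMap.mul' ℂ (H → ℂ) (funComulLin H (Pi.single h 1)) = Pi.single h 1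
    rw [funComulLin_single, LinearMap.mul'_apply, ← Pi.single_mul, _root_.mul_one]
  mul_comul_left := by
    apply fdRep_hom_ext
    apply TensorProduct.ext
    apply (Pi.basisFun ℂ H).ext
    intro g
    apply (Pi.basisFun ℂ H).ext
    intro h
    rw [Pi.basisFun_apply, Pi.basisFun_apply]
    have e : (funRep H ◁ funComul H).hom.hom.hom
        ((Pi.single g (1 : ℂ) : H → ℂ) ⊗ₜ[ℂ] (Pi.single h (1 : ℂ) : H → ℂ)) =
        (Pi.single g (1 : ℂ) : H → ℂ) ⊗ₜ[ℂ] ((Pi.single h (1 : ℂ) : H → ℂ) ⊗ₜ[ℂ]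
          (Pi.single h (1 : ℂ) : H → ℂ)) :=
      congrArg ((Pi.single g (1 : ℂ) : H → ℂ) ⊗ₜ[ℂ] ·) (funComulLin_single H h)
    refine (congrArg (fun x => (μ[funRep H] ▷ funRep H).hom.hom.hom
      ((α_ (funRep H) (funRep H) (funRep H)).inv.hom.hom.hom x)) e).trans ?_
    change ((Pi.single g (1 : ℂ) : H → ℂ) * Pi.single h 1) ⊗ₜ[ℂ] (Pi.single h (1 : ℂ) : H → ℂ) =
      funComulLin H ((Pi.single g (1 : ℂ) : H → ℂ) * Pi.single h 1)
    by_cases hgh : g = h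
    · subst hgh
      rw [← Pi.single_mul, _root_.mul_one, funComulLin_single]
    · have h0 : (Pi.single g (1 : ℂ) : H → ℂ) * Pi.single h 1 = 0 := by
        ext t
        simp only [Pi.mul_apply, Pi.single_apply, Pi.zero_apply]
        grind
      rw [h0]
      simp
  mul_comul_right := by
    apply fdRep_hom_ext
    apply TensorProduct.ext
    apply (Pi.basisFun ℂ H).ext
    intro g
    apply (Pi.basisFun ℂ H).ext
    intro h
    rw [Pi.basisFun_apply, Pi.basisFun_apply]
    have e : (funComul H ▷ funRep H).hom.hom.hom
        ((Pi.single g (1 : ℂ) : H → ℂ) ⊗ₜ[ℂ] (Pi.single h (1 : ℂ) : H → ℂ)) =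
        ((Pi.single g (1 : ℂ) : H → ℂ) ⊗ₜ[ℂ] (Pi.single g (1 : ℂ) : H → ℂ)) ⊗ₜ[ℂ]
          (Pi.single h (1 : ℂ) : H → ℂ) :=
      congrArg (· ⊗ₜ[ℂ] (Pi.single h (1 : ℂ) : H → ℂ)) (funComulLin_single H g)
    refine (congrArg (fun x => (funRep H ◁ μ[funRep H]).hom.hom.hom
      ((α_ (funRep H) (funRep H) (funRep H)).hom.hom.hom.hom x)) e).trans ?_
    change (Pi.single g (1 : ℂ) : H → ℂ) ⊗ₜ[ℂ] ((Pi.single g (1 : ℂ) : H → ℂ) * Pi.single h 1) =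
      funComulLin H ((Pi.single g (1 : ℂ) : H → ℂ) * Pi.single h 1)
    by_cases hgh : g = h
    · subst hgh
      rw [← Pi.single_mul, _root_.mul_one, funComulLin_single]
    · have h0 : (Pi.single g (1 : ℂ) : H → ℂ) * Pi.single h 1 = 0 := by
        ext t
        simp only [Pi.mul_apply, Pi.single_apply, Pi.zero_apply]
        grind
      rw [h0]
      simp
  comul_counit := by
    apply fdRep_hom_ext
    apply (Pi.basisFun ℂ H).ext
    intro h
    rw [Pi.basisFun_apply]
    change (Fintype.linearCombination ℂ (fun _ : H => (1 : ℂ))).rTensor (H → ℂ)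
      (funComulLin H (Pi.single h 1)) = (1 : ℂ) ⊗ₜ (Pi.single h (1 : ℂ) : H → ℂ)
    rw [funComulLin_single, LinearMap.rTensor_tmul, Fintype.linearCombination_apply_single,
      one_smul]
  K := H
  p k := leftRegularFDRepHom k
  q k := leftRegularFDRepHom k⁻¹
  galois := by
    apply fdRep_hom_ext
    apply (Pi.basisFun ℂ H).ext
    intro h
    rw [Pi.basisFun_apply]
    have h1 (k : H) : (leftRegularFDRepHom k ≫ funComul H ≫
        leftRegularFDRepHom k⁻¹ ▷ funRep H).hom.hom.hom (Pi.single h (1 : ℂ) : H → ℂ) =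
        (Pi.single h (1 : ℂ) : H → ℂ) ⊗ₜ[ℂ] (Pi.single (k * h) (1 : ℂ) : H → ℂ) := by
      have e : funComulLin H (leftRegular k (Pi.single h 1)) =
          Pi.single (k * h) (1 : ℂ) ⊗ₜ[ℂ] Pi.single (k * h) (1 : ℂ) := by
        rw [leftRegular_single, funComulLin_single]
      refine (congrArg ((leftRegular k⁻¹).rTensor (H → ℂ)) e).trans ?_
      rw [LinearMap.rTensor_tmul, leftRegular_single, inv_mul_cancel_left]
    let Φ : (funRep H ⟶ funRep H ⊗ funRep H) →+ ((H → ℂ) →ₗ[ℂ] (H → ℂ) ⊗[ℂ] (H → ℂ)) :=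
      { toFun f := f.hom.hom.hom
        map_zero' := rfl
        map_add' _ _ := rfl }
    change Φ (∑ k, leftRegularFDRepHom k ≫ funComul H ≫ leftRegularFDRepHom k⁻¹ ▷ funRep H)
      (Pi.single h 1) = (Pi.single h (1 : ℂ) : H → ℂ) ⊗ₜ[ℂ] (algebraMap ℂ (H → ℂ) 1)
    rw [map_sum, LinearMap.sum_apply]
    have h2 : ∑ k : H, (Pi.single h (1 : ℂ) : H → ℂ) ⊗ₜ[ℂ] (Pi.single (k * h) (1 : ℂ) : H → ℂ) =
        (Pi.single h (1 : ℂ) : H → ℂ) ⊗ₜ[ℂ] (algebraMap ℂ (H → ℂ) 1) := by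
      rw [← TensorProduct.tmul_sum, map_one]
      congr 1
      ext t
      simp [Pi.single_apply, Finset.sum_apply, ← mul_inv_eq_iff_eq_mul]
    exact (Finset.sum_congr rfl fun k _ => h1 k).trans h2

end FunRep

section FunRepHom

open TannakaDuality.FiniteGroup MonObj TensorProduct

variable (H : Type) [Group H] [Finite H]

attribute [local instance] Fintype.ofFinite
open scoped Classical

/-- `Fun(H)` is the free representation of rank one. -/
def funRepHomEquiv (V : FDRep ℂ H) : (funRep H ⟶ V) ≃ₗ[ℂ] V where
  toFun f := f.hom.hom.hom (Pi.single (1 : H) (1 : ℂ) : H → ℂ)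
  invFun v := ofRightFDRep V v
  map_add' _ _ := rfl
  map_smul' _ _ := rfl
  left_inv f := by
    apply fdRep_hom_ext
    apply (Pi.basisFun ℂ H).ext
    intro h
    rw [Pi.basisFun_apply]
    have h1 : V.ρ h⁻¹ (f.hom.hom.hom (Pi.single (1 : H) (1 : ℂ) : H → ℂ)) =
        f.hom.hom.hom (rightRegular h⁻¹ (Pi.single (1 : H) (1 : ℂ)) : H → ℂ) :=
      (congrArg (fun g => g.hom.hom (Pi.single (1 : H) (1 : ℂ) : H → ℂ)) (f.comm h⁻¹)).symm
    rw [rightRegular_single, _root_.one_mul, inv_inv] at h1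
    refine Eq.trans ?_ h1
    change sumSMulInv (f.hom.hom.hom (Pi.single (1 : H) (1 : ℂ) : H → ℂ)) (Pi.single h (1 : ℂ)) = _
    simp [sumSMulInv_apply, Pi.single_apply]
  right_inv v := sumSMulInv_single_id v

lemma finrank_funRep_hom (V : FDRep ℂ H) :
    Module.finrank ℂ (funRep H ⟶ V) = Module.finrank ℂ V :=
  (funRepHomEquiv H V).finrank_eq

omit [Finite H] in
lemma fdRep_finrank_eq_one {V W : FDRep ℂ H} (e : V ⊗ W ≅ 𝟙_ (FDRep ℂ H)) :
    Module.finrank ℂ V = 1 := by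
  have h : Module.finrank ℂ (V ⊗[ℂ] W) = Module.finrank ℂ ℂ :=
    (FDRep.isoToLinearEquiv e).finrank_eq
  rw [Module.finrank_tensorProduct, Module.finrank_self] at h
  exact Nat.eq_one_of_mul_eq_one_right h

omit [Finite H] in
lemma fdRep_braiding_eq_id {V : FDRep ℂ H} (hV : Module.finrank ℂ V = 1) :
    (β_ V V).hom = 𝟙 _ := by
  obtain ⟨v, -, hv⟩ := finrank_eq_one_iff'.1 hV
  apply fdRep_hom_ext
  apply TensorProduct.ext'
  intro x y
  change y ⊗ₜ[ℂ] x = x ⊗ₜ[ℂ] y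
  obtain ⟨a, rfl⟩ := hv x
  obtain ⟨b, rfl⟩ := hv y
  rw [TensorProduct.smul_tmul_smul, TensorProduct.smul_tmul_smul, mul_comm]

lemma exists_eq_smul_funUnit (f : 𝟙_ (FDRep ℂ H) ⟶ funRep H) : ∃ c : ℂ, f = c • η[funRep H] := by
  let φ : H → ℂ := f.hom.hom.hom (1 : ℂ)
  have hφ : ∀ s : H, rightRegular s φ = φ := fun s =>
    (congrArg (fun g => g.hom.hom (1 : ℂ)) (f.comm s)).symm
  refine ⟨φ 1, ?_⟩
  apply fdRep_hom_ext
  apply LinearMap.ext_ring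
  change φ = φ 1 • algebraMap ℂ (H → ℂ) 1
  ext s
  have h := congrFun (hφ s) 1
  rw [rightRegular_apply, _root_.one_mul] at h
  simp [h]

end FunRepHom

/-! ### Invertible objects -/

section Invertible

lemma simple_obj_of_isEquivalence {D D' : Type*} [Category D] [Category D'] [Preadditive D]
    [Preadditive D'] (F : D ⥤ D') [F.IsEquivalence] [F.Additive] (X : D) [Simple X] :
    Simple (F.obj X) where
  mono_isIso_iff_nonzero {Y} f hf := by
    let i := F.objObjPreimageIso Y
    let f' : F.objPreimage Y ⟶ X := F.preimage (i.hom ≫ f)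
    have hf' : F.map f' = i.hom ≫ f := F.map_preimage _
    have hm : Mono f' := F.mono_of_mono_map (by rw [hf']; infer_instance)
    have h1 : IsIso f ↔ IsIso f' := by
      rw [← isIso_iff_of_reflects_iso f' F, hf', isIso_comp_left_iff]
    have h2 : f = 0 ↔ f' = 0 := by
      rw [← F.map_eq_zero_iff, hf', ← Preadditive.IsIso.comp_left_eq_zero i.hom]
    rw [h1, Simple.mono_isIso_iff_nonzero f', Ne, Ne, h2]

variable {C : Type u} [Category.{v} C] [MonoidalCategory C]

/-- Tensoring with an invertible object is an equivalence. -/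
lemma isEquivalence_tensorLeft {L L' : C} (e : L' ⊗ L ≅ 𝟙_ C) (e' : L ⊗ L' ≅ 𝟙_ C) :
    (tensorLeft L).IsEquivalence :=
  (CategoryTheory.Equivalence.mk (tensorLeft L) (tensorLeft L')
    (NatIso.ofComponents (fun X => (λ_ X).symm ≪≫ whiskerRightIso e.symm X ≪≫ α_ _ _ _) (by
      intro X Y f
      change f ≫ (λ_ Y).inv ≫ e.inv ▷ Y ≫ (α_ L' L Y).hom =
        ((λ_ X).inv ≫ e.inv ▷ X ≫ (α_ L' L X).hom) ≫ L' ◁ L ◁ f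
      calc _ = 𝟙 _ ⊗≫ (𝟙_ C ◁ f ≫ e.inv ▷ Y) ⊗≫ 𝟙 _ := by monoidal
        _ = _ := by
          rw [whisker_exchange]
          monoidal))
    (NatIso.ofComponents (fun X => (α_ _ _ _).symm ≪≫ whiskerRightIso e' X ≪≫ λ_ X) (by
      intro X Y f
      change L ◁ L' ◁ f ≫ (α_ L L' Y).inv ≫ e'.hom ▷ Y ≫ (λ_ Y).hom =
        ((α_ L L' X).inv ≫ e'.hom ▷ X ≫ (λ_ X).hom) ≫ f
      calc _ = 𝟙 _ ⊗≫ ((L ⊗ L') ◁ f ≫ e'.hom ▷ Y) ⊗≫ 𝟙 _ := by monoidal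
        _ = _ := by
          rw [whisker_exchange]
          monoidal))).isEquivalence_functor

end Invertible

/-! ### The regular algebra and the objects of `G` -/

section Tannakian

open MonObj

variable {C : Type u} [Category.{v} C] [Abelian C] [Linear ℂ C] [MonoidalCategory C]
  [MonoidalPreadditive C] [MonoidalLinear ℂ C] [RigidCategory C] [BraidedCategory C]
  [Twist C] [IsPremodular C] {G : Subgroup (Skeleton C)ˣ}

/-- The objects whose isomorphism class lies in `G`. -/
def classIn (G : Subgroup (Skeleton C)ˣ) (L : C) : Prop := ∃ g ∈ G, toSkeleton L = (g : Skeleton C)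

/-- Objects of `G` are invertible, with inverses in `G`. -/
lemma classIn.exists_inverse {L : C} (hL : classIn G L) :
    ∃ L' : C, classIn G L' ∧ Nonempty (L ⊗ L' ≅ 𝟙_ C) := by
  obtain ⟨g, hg, h⟩ := hL
  let L' : C := (fromSkeleton C).obj (g⁻¹ : (Skeleton C)ˣ)
  have hL' : toSkeleton L' = (g⁻¹ : (Skeleton C)ˣ) := toSkeleton_fromSkeleton_obj _
  refine ⟨L', ⟨g⁻¹, inv_mem hg, hL'⟩, toSkeleton_eq_toSkeleton_iff.1 ?_⟩
  rw [Skeleton.toSkeleton_tensorObj, h, hL', Units.mul_inv, Skeleton.one_eq]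

lemma classIn.isEquivalence_tensorLeft {L : C} (hL : classIn G L) :
    (tensorLeft L).IsEquivalence := by
  obtain ⟨L', -, ⟨e⟩⟩ := hL.exists_inverse
  exact Premodular.isEquivalence_tensorLeft (β_ L' L ≪≫ e) e

lemma classIn.simple_tensor {L : C} (hL : classIn G L) (X : C) [Simple X] : Simple (L ⊗ X) := by
  have := hL.isEquivalence_tensorLeft
  exact simple_obj_of_isEquivalence (tensorLeft L) X

lemma classIn.simple {L : C} (hL : classIn G L) : Simple L := by
  have := hL.simple_tensor (𝟙_ C)
  exact Simple.of_iso (ρ_ L).symm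

namespace TannakianEquivalence

variable (E : TannakianEquivalence G)

/-- The regular algebra is a special Frobenius algebra with the Galois property. -/
def galoisFrobenius : GaloisFrobenius E.regularAlgebra := (funGalois E.H).map E.F

lemma one_counit :
    η[E.regularAlgebra.X] ≫ E.galoisFrobenius.counit = (Nat.card E.H : ℂ) • 𝟙 _ := by
  change (Functor.LaxMonoidal.ε E.F ≫ E.F.map η[funRep E.H]) ≫ E.F.map (funCounit E.H) ≫
    Functor.OplaxMonoidal.η E.F = _
  rw [Category.assoc, ← E.F.map_comp_assoc, funUnit_funCounit, E.F.map_smul]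
  simp

lemma one_ne_zero : η[E.regularAlgebra.X] ≠ 0 := by
  intro h
  have h1 := E.one_counit
  rw [h, zero_comp] at h1
  have h2 : (Nat.card E.H : ℂ) ≠ 0 := Nat.cast_ne_zero.2 Nat.card_pos.ne'
  exact id_nonzero (𝟙_ C) ((smul_eq_zero.1 h1.symm).resolve_left h2)

/-- The regular algebra is connected. -/
lemma exists_eq_smul_one (f : 𝟙_ C ⟶ E.regularAlgebra.X) :
    ∃ c : ℂ, f = c • η[E.regularAlgebra.X] := by
  let f' : 𝟙_ C ⟶ E.F.obj (funRep E.H) := f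
  obtain ⟨g, hg⟩ := E.F.map_surjective (Functor.OplaxMonoidal.η E.F ≫ f')
  obtain ⟨c, rfl⟩ := exists_eq_smul_funUnit E.H g
  refine ⟨c, ?_⟩
  change f' = c • (Functor.LaxMonoidal.ε E.F ≫ E.F.map η[funRep E.H])
  rw [← Linear.comp_smul, ← E.F.map_smul, hg, Functor.Monoidal.ε_η_assoc]

/-- Every object of `G` is the image of a representation. -/
lemma exists_iso_obj {L : C} (hL : classIn G L) :
    ∃ V, Nonempty (E.F.obj V ≅ L) := by
  have h : generatedBy G L :=
    ⟨1, fun _ => L, fun _ => hL, ⟨(biproductUniqueIso fun _ : Fin 1 => L).symm⟩⟩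
  rw [← E.essImage_eq] at h
  exact h

lemma finrank_eq_one {V : FDRep ℂ E.H} (hV : classIn G (E.F.obj V)) : Module.finrank ℂ V = 1 := by
  obtain ⟨L', hL', ⟨e⟩⟩ := hV.exists_inverse
  obtain ⟨W, ⟨i⟩⟩ := E.exists_iso_obj hL'
  exact fdRep_finrank_eq_one E.H (E.F.preimageIso ((Functor.Monoidal.μIso E.F V W).symm ≪≫
    whiskerLeftIso _ i ≪≫ e ≪≫ Functor.Monoidal.εIso E.F))

lemma classIn_of_iso {L L' : C} (e : L ≅ L') (h : classIn G L) : classIn G L' := by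
  obtain ⟨g, hg, h⟩ := h
  exact ⟨g, hg, (congr_toSkeleton_of_iso e).symm.trans h⟩

/-- Each object of `G` occurs in the regular algebra exactly once, as `Fun(H)` is free of rank one
and the objects of `G` come from one-dimensional representations. -/
lemma finrank_hom_regularAlgebra {L : C} (hL : classIn G L) :
    Module.finrank ℂ (E.regularAlgebra.X ⟶ L) = 1 := by
  obtain ⟨V, ⟨i⟩⟩ := E.exists_iso_obj hL
  rw [← E.finrank_eq_one (classIn_of_iso i.symm hL), ← finrank_funRep_hom]
  let φ : (funRep E.H ⟶ V) ≃ₗ[ℂ] (E.F.obj (funRep E.H) ⟶ E.F.obj V) :=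
    LinearEquiv.ofBijective (E.F.mapLinearMap ℂ) ⟨E.F.map_injective, E.F.map_surjective⟩
  exact (φ.trans (Linear.homCongr ℂ (Iso.refl _) i)).finrank_eq.symm

lemma qdim_eq_one (E : TannakianEquivalence G) {L : C} (hL : classIn G L) : qdim L = 1 := by
  obtain ⟨V, ⟨i⟩⟩ := E.exists_iso_obj hL
  have hV := classIn_of_iso i.symm hL
  have := hV.simple
  rw [← qdim_congr i]
  refine Premodular.qdim_eq_one (exists_eq_smul_id (𝟙_ C)) _ (id_nonzero _) ?_ ?_
  · exact (E.map_twist V).symm.trans (E.F.map_id _)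
  · have h := E.F.map_braiding V V
    rw [fdRep_braiding_eq_id E.H (E.finrank_eq_one hV), E.F.map_id] at h
    have h' := (Functor.LaxMonoidal.μ E.F V V ≫= h) =≫ Functor.OplaxMonoidal.δ E.F V V
    simpa using h'.symm

lemma twist_eq_id (E : TannakianEquivalence G) {L : C} (hL : classIn G L) : (θ L).hom = 𝟙 L := by
  obtain ⟨V, ⟨i⟩⟩ := E.exists_iso_obj hL
  rw [← cancel_epi i.hom, θ_naturality, ← E.map_twist V, Category.comp_id]
  exact (congrArg (· ≫ i.hom) (E.F.map_id _)).trans (Category.id_comp _)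

attribute [local instance] Abelian.hasFiniteBiproducts

lemma exists_decomposition : ∃ d : SimpleDecomposition E.regularAlgebra.X,
    ∀ j, classIn G (d.S j) := by
  have h : generatedBy G E.regularAlgebra.X := by
    rw [← E.essImage_eq]
    exact E.F.obj_mem_essImage _
  obtain ⟨m, L, hL, ⟨e⟩⟩ := h
  exact ⟨(SimpleDecomposition.ofBiproduct L fun i => classIn.simple (hL i)).ofIso e.symm, hL⟩

/-- The dimension of the regular algebra is the order of `G`. -/
lemma qdim_regularAlgebra [Finite G] : qdim E.regularAlgebra.X = Nat.card G := by
  classical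
  obtain ⟨d, hd⟩ := E.exists_decomposition
  let L : G → C := fun g => (fromSkeleton C).obj (g : (Skeleton C)ˣ)
  have hL : ∀ g : G, classIn G (L g) := fun g => ⟨g, g.2, toSkeleton_fromSkeleton_obj _⟩
  have : Fintype G := Fintype.ofFinite G
  choose c hcG hc using hd
  have hmult : ∀ g : G, (Finset.univ.filter fun j => (⟨c j, hcG j⟩ : G) = g).card = 1 := by
    intro g
    have := (hL g).simple
    rw [← E.finrank_hom_regularAlgebra (hL g), ← d.finrank_hom_comm, d.finrank_hom]
    congr 1
    ext j
    simp only [Finset.mem_filter, Finset.mem_univ, true_and]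
    rw [← toSkeleton_eq_toSkeleton_iff, toSkeleton_fromSkeleton_obj, hc, Subtype.ext_iff,
      Units.ext_iff, eq_comm]
  rw [d.qdim_eq]
  simp_rw [E.qdim_eq_one ⟨_, hcG _, hc _⟩]
  rw [Finset.sum_const, nsmul_eq_mul, _root_.mul_one, Finset.card_eq_sum_card_fiberwise
    (f := fun j => (⟨c j, hcG j⟩ : G)) (t := Finset.univ) (by simp)]
  simp [hmult]

end TannakianEquivalence

end Tannakian

/-! ### The characters given by the double braiding -/

section Monodromy

open BraidedCategory

variable {C : Type u} [Category.{v} C] [MonoidalCategory C] [BraidedCategory C]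

/-- The double braiding `c_{X,L} ∘ c_{L,X}`. -/
def monodromy (L X : C) : L ⊗ X ⟶ L ⊗ X := (β_ L X).hom ≫ (β_ X L).hom

lemma monodromy_naturality_left {L L' : C} (f : L ⟶ L') (X : C) :
    monodromy L X ≫ f ▷ X = f ▷ X ≫ monodromy L' X := by
  simp only [monodromy, Category.assoc, braiding_naturality_right, braiding_naturality_left_assoc]

lemma monodromy_naturality_right (L : C) {X X' : C} (f : X ⟶ X') :
    monodromy L X ≫ L ◁ f = L ◁ f ≫ monodromy L X' := by
  simp only [monodromy, Category.assoc, braiding_naturality_left, braiding_naturality_right_assoc]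

lemma monodromy_tensor (L L' X : C) : monodromy (L ⊗ L') X =
    (α_ L L' X).hom ≫ L ◁ (β_ L' X).hom ≫ (α_ L X L').inv ≫ monodromy L X ▷ L' ≫
      (α_ L X L').hom ≫ L ◁ (β_ X L').hom ≫ (α_ L L' X).inv := by
  simp [monodromy, braiding_tensor_left_hom, braiding_tensor_right_hom]

lemma monodromy_unit (X : C) : monodromy (𝟙_ C) X = 𝟙 _ := by
  simp [monodromy, braiding_tensorUnit_left, braiding_tensorUnit_right]

lemma braiding_unit_unit : (β_ (𝟙_ C) (𝟙_ C)).hom = 𝟙 _ := by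
  rw [braiding_tensorUnit_left, unitors_equal, Iso.hom_inv_id]

end Monodromy

section Characters

variable {C : Type u} [Category.{v} C] [Abelian C] [Linear ℂ C] [MonoidalCategory C]
  [MonoidalPreadditive C] [MonoidalLinear ℂ C] [RigidCategory C] [BraidedCategory C]
  [Twist C] [IsPremodular C] {G : Subgroup (Skeleton C)ˣ}

lemma classIn.monodromy_eq_smul {L : C} (hL : classIn G L) (X : C) [Simple X] :
    monodromy L X = scalar (monodromy L X) • 𝟙 _ := by
  have := hL.simple_tensor X
  exact eq_scalar_smul (exists_eq_smul_id _ _)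

lemma classIn.tensor {L L' : C} (hL : classIn G L) (hL' : classIn G L') : classIn G (L ⊗ L') := by
  obtain ⟨g, hg, h⟩ := hL
  obtain ⟨g', hg', h'⟩ := hL'
  exact ⟨g * g', mul_mem hg hg', by rw [Skeleton.toSkeleton_tensorObj, h, h', Units.val_mul]⟩

lemma scalar_monodromy_congr {L L' : C} (e : L ≅ L') (hL : classIn G L) (X : C) [Simple X] :
    scalar (monodromy L X) = scalar (monodromy L' X) := by
  have := hL.simple_tensor X
  have := (TannakianEquivalence.classIn_of_iso e hL).simple_tensor X
  exact scalar_conj (whiskerRightIso e X) (id_nonzero _) (monodromy_naturality_left e.hom X)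
    (exists_eq_smul_id _ _)

lemma scalar_monodromy_tensor {L L' : C} (hL : classIn G L) (hL' : classIn G L') (X : C)
    [Simple X] : scalar (monodromy (L ⊗ L') X) =
      scalar (monodromy L X) * scalar (monodromy L' X) := by
  have := (hL.tensor hL').simple_tensor X
  have h : monodromy (L ⊗ L') X =
      (scalar (monodromy L X) * scalar (monodromy L' X)) • 𝟙 _ := by
    rw [monodromy_tensor, hL.monodromy_eq_smul X]
    have h' : L ◁ (β_ L' X).hom ≫ L ◁ (β_ X L').hom = scalar (monodromy L' X) • 𝟙 _ := by
      rw [← whiskerLeft_comp, ← monodromy, hL'.monodromy_eq_smul X]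
      simp only [MonoidalLinear.whiskerLeft_smul, whiskerLeft_id,
        scalar_smul_id (@id_nonzero _ _ _ _ (hL'.simple_tensor X))]
    simp only [MonoidalLinear.smul_whiskerRight, id_whiskerRight, Linear.smul_comp,
      Linear.comp_smul, Category.id_comp, Iso.inv_hom_id_assoc, reassoc_of% h',
      scalar_smul_id (@id_nonzero _ _ _ _ (hL.simple_tensor X)), Iso.hom_inv_id, smul_smul]
  rw [h, scalar_smul_id (id_nonzero _)]

/-- An object in the class `g`. -/
def groupObj (g : G) : C := (fromSkeleton C).obj (g : (Skeleton C)ˣ)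

lemma toSkeleton_groupObj (g : G) : toSkeleton (groupObj g) = (g : (Skeleton C)ˣ) :=
  toSkeleton_fromSkeleton_obj _

lemma classIn_groupObj (g : G) : classIn G (groupObj g) := ⟨g, g.2, toSkeleton_groupObj g⟩

/-- The character of `G` given by the double braiding with a simple object `X`. -/
def monodromyChar (G : Subgroup (Skeleton C)ˣ) (X : C) [Simple X] : G →* ℂ where
  toFun g := scalar (monodromy (groupObj g) X)
  map_one' := by
    obtain ⟨e⟩ : Nonempty (groupObj (1 : G) ≅ 𝟙_ C) := by
      rw [← toSkeleton_eq_toSkeleton_iff, toSkeleton_groupObj]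
      rfl
    have := (TannakianEquivalence.classIn_of_iso e (classIn_groupObj _)).simple_tensor X
    rw [scalar_monodromy_congr e (classIn_groupObj _), monodromy_unit]
    simpa using scalar_smul_id (id_nonzero (𝟙_ C ⊗ X)) 1
  map_mul' g h := by
    obtain ⟨e⟩ : Nonempty (groupObj (g * h) ≅ groupObj g ⊗ groupObj h) := by
      rw [← toSkeleton_eq_toSkeleton_iff, Skeleton.toSkeleton_tensorObj, toSkeleton_groupObj,
        toSkeleton_groupObj, toSkeleton_groupObj]
      rfl
    rw [scalar_monodromy_congr e (classIn_groupObj _),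
      scalar_monodromy_tensor (classIn_groupObj g) (classIn_groupObj h)]

/-- The balancing axiom, for an object `L` of trivial twist. -/
lemma scalar_θ_tensor (E : TannakianEquivalence G) {L : C} (hL : classIn G L) (X : C) [Simple X] :
    scalar (θ (L ⊗ X)).hom = scalar (θ X).hom * scalar (monodromy L X) := by
  have := hL.simple_tensor X
  have h : (θ (L ⊗ X)).hom = (scalar (θ X).hom * scalar (monodromy L X)) • 𝟙 _ := by
    rw [θ_tensor, E.twist_eq_id hL, ← monodromy, id_tensorHom, hL.monodromy_eq_smul X,
      eq_scalar_smul (exists_eq_smul_id X (θ X).hom)]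
    simp only [MonoidalLinear.whiskerLeft_smul, whiskerLeft_id, Linear.comp_smul,
      Category.comp_id, smul_smul, scalar_smul_id (id_nonzero _), mul_comm]
  rw [h, scalar_smul_id (id_nonzero _)]

/-- The action of an invertible object on the set of isomorphism classes of simple objects. -/
def tensorClass {L : C} (hL : classIn G L) (X : SimpleClass C) : SimpleClass C :=
  have := hL.simple_tensor X.rep
  SimpleClass.mk (L ⊗ X.rep)

lemma tensorClass_bijective {L : C} (hL : classIn G L) : Function.Bijective (tensorClass hL) := by
  refine Finite.injective_iff_bijective.1 fun X Y h => ?_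
  have := hL.simple_tensor X.rep
  have := hL.simple_tensor Y.rep
  have := hL.isEquivalence_tensorLeft
  let i : L ⊗ X.rep ≅ L ⊗ Y.rep := (SimpleClass.repMk (L ⊗ X.rep)).symm ≪≫
    eqToIso (congrArg SimpleClass.rep h) ≪≫ SimpleClass.repMk (L ⊗ Y.rep)
  exact SimpleClass.eq_of_iso ((tensorLeft L).preimageIso i)

/-- Tensoring `X` with `L` multiplies the summand of the Gauss sum at `X` by the `n`-th power of the
double braiding of `L` and `X`. -/
lemma summand_tensorClass (E : TannakianEquivalence G) {L : C} (hL : classIn G L)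
    (X : SimpleClass C) (n : ℤ) :
    scalar (θ (tensorClass hL X).rep).hom ^ n * qdim (tensorClass hL X).rep ^ 2 =
      scalar (θ X.rep).hom ^ n * qdim X.rep ^ 2 * scalar (monodromy L X.rep) ^ n := by
  have := hL.simple_tensor X.rep
  have e : (tensorClass hL X).rep ≅ L ⊗ X.rep := SimpleClass.repMk (L ⊗ X.rep)
  rw [scalar_θ_congr e, qdim_congr e, scalar_θ_tensor E hL, mul_zpow,
    qdim_tensor (exists_eq_smul_id (𝟙_ C)) (id_nonzero _), E.qdim_eq_one hL]
  ring

lemma scalar_θ_pow_ordT (X : SimpleClass C) : scalar (θ X.rep).hom ^ ordT C = 1 := by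
  classical
  let _ := Fintype.ofFinite (SimpleClass C)
  have h0 : ordT C =
      orderOf (Matrix.diagonal fun X : SimpleClass C => scalar (θ X.rep).hom) := by
    unfold ordT
    congr!
  have h := pow_orderOf_eq_one (Matrix.diagonal fun X : SimpleClass C => scalar (θ X.rep).hom)
  rw [← h0, Matrix.diagonal_pow, ← Matrix.diagonal_one] at h
  exact congrFun (Matrix.diagonal_injective h) X

/-- The double braiding is the ratio `θ_{gX} / θ_X`. -/
lemma monodromyChar_pow_ordT (E : TannakianEquivalence G) (X : SimpleClass C) (g : G) :
    monodromyChar G X.rep g ^ ordT C = 1 := by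
  have hL := classIn_groupObj g
  have := hL.simple_tensor X.rep
  have e : (tensorClass hL X).rep ≅ groupObj g ⊗ X.rep := SimpleClass.repMk _
  have h := scalar_θ_pow_ordT (tensorClass hL X)
  rw [scalar_θ_congr e, scalar_θ_tensor E hL, mul_pow, scalar_θ_pow_ordT, one_mul] at h
  exact h

open scoped Classical in
/-- Only the simple objects that centralize `G` contribute to the Gauss sum. -/
lemma gaussSum_eq_sum_centralizing [Finite G] [Fintype (SimpleClass C)]
    (E : TannakianEquivalence G) (n : ℤ) (hn : IsCoprime n (ordT C : ℤ)) :
    gaussSum C n = ∑ X : SimpleClass C, if monodromyChar G X.rep = 1 then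
      scalar (θ X.rep).hom ^ n * qdim X.rep ^ 2 else 0 := by
  have : Fintype G := Fintype.ofFinite G
  have h1 (g : G) : gaussSum C n = ∑ X : SimpleClass C,
      scalar (θ X.rep).hom ^ n * qdim X.rep ^ 2 * monodromyChar G X.rep g ^ n := by
    rw [gaussSum, finsum_eq_sum_of_fintype,
      ← (tensorClass_bijective (classIn_groupObj g)).sum_comp]
    exact Finset.sum_congr rfl fun X _ => summand_tensorClass E (classIn_groupObj g) X n
  have h2 (X : SimpleClass C) : ∑ g, monodromyChar G X.rep g ^ n =
      if monodromyChar G X.rep = 1 then (Nat.card G : ℂ) else 0 := by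
    let f : G →* ℂ :=
      (Units.coeHom ℂ).comp ((zpowGroupHom n).comp (monodromyChar G X.rep).toHomUnits)
    have hf : ∀ g, f g = monodromyChar G X.rep g ^ n := fun g => by simp [f]
    simp_rw [← hf]
    split_ifs with h
    · simp [hf, h]
    · refine sum_hom_units_eq_zero f fun hf1 => h (MonoidHom.ext fun g => ?_)
      -- the values of the character are killed by the coprime exponents `n` and `ordT C`
      obtain ⟨a, b, hab⟩ := hn
      have hg : monodromyChar G X.rep g ^ n = 1 := by rw [← hf, hf1, MonoidHom.one_apply]
      have hg' := monodromyChar_pow_ordT E X g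
      have hne : monodromyChar G X.rep g ≠ 0 :=
        ((Group.isUnit g).map (monodromyChar G X.rep)).ne_zero
      rw [MonoidHom.one_apply, ← zpow_one (monodromyChar G X.rep g), ← hab, zpow_add₀ hne,
        mul_comm a, mul_comm b, zpow_mul, zpow_mul, hg, zpow_natCast, hg']
      simp
  have hG : (Nat.card G : ℂ) ≠ 0 := Nat.cast_ne_zero.2 Nat.card_pos.ne'
  rw [← mul_right_inj' hG, Finset.mul_sum]
  calc (Nat.card G : ℂ) * gaussSum C n = ∑ _g : G, gaussSum C n := by simp
    _ = ∑ g : G, ∑ X : SimpleClass C, scalar (θ X.rep).hom ^ n * qdim X.rep ^ 2 *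
          monodromyChar G X.rep g ^ n := Finset.sum_congr rfl fun g _ => h1 g
    _ = _ := by
      rw [Finset.sum_comm]
      refine Finset.sum_congr rfl fun X _ => ?_
      rw [← Finset.mul_sum, h2]
      split_ifs <;> ring

/-- A simple object centralizes the regular algebra if and only if its character is trivial. -/
lemma monodromy_eq_id_iff (E : TannakianEquivalence G) (X : C) [Simple X] :
    monodromy E.regularAlgebra.X X = 𝟙 _ ↔ monodromyChar G X = 1 := by
  obtain ⟨d, hd⟩ := E.exists_decomposition
  constructor
  · intro h
    ext g
    have hL := classIn_groupObj g
    have := hL.simple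
    have hfr : Module.finrank ℂ (groupObj g ⟶ E.regularAlgebra.X) = 1 := by
      rw [d.finrank_hom_comm, E.finrank_hom_regularAlgebra hL]
    obtain ⟨f, hf, -⟩ := finrank_eq_one_iff'.1 hfr
    have := mono_of_nonzero_from_simple hf
    obtain ⟨r, hr⟩ := exists_retraction_of_mono (nonempty_simpleDecomposition C) f
    have hm : monodromy (groupObj g) X = 𝟙 _ := by
      rw [← Category.comp_id (monodromy _ _), ← id_whiskerRight, ← hr, comp_whiskerRight,
        ← Category.assoc, monodromy_naturality_left, h, Category.comp_id]
    have := hL.simple_tensor X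
    change scalar (monodromy (groupObj g) X) = 1
    rw [hm]
    simpa using scalar_smul_id (id_nonzero (groupObj g ⊗ X)) 1
  · intro h
    have hj (j : d.ι) : monodromy (d.S j) X = 𝟙 _ := by
      obtain ⟨g, hg, hgj⟩ := hd j
      obtain ⟨e⟩ : Nonempty (d.S j ≅ groupObj (⟨g, hg⟩ : G)) := by
        rw [← toSkeleton_eq_toSkeleton_iff, toSkeleton_groupObj, hgj]
      have hs : scalar (monodromy (d.S j) X) = 1 :=
        (scalar_monodromy_congr e (hd j) X).trans (DFunLike.congr_fun h ⟨g, hg⟩)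
      rw [(hd j).monodromy_eq_smul X, hs, one_smul]
    have hsum : ∑ j, d.pr j ▷ X ≫ d.incl j ▷ X = 𝟙 (E.regularAlgebra.X ⊗ X) := by
      simp_rw [← comp_whiskerRight]
      rw [← sum_whiskerRight, d.sum_pr_incl, id_whiskerRight]
    rw [← Category.comp_id (monodromy _ _), ← hsum, Preadditive.comp_sum]
    refine Finset.sum_congr rfl fun j _ => ?_
    rw [← Category.assoc, monodromy_naturality_left, hj, Category.comp_id]

end Characters

/-! ### The category of local modules over the regular algebra -/

section MonoidalPreadditive

variable {C : Type u} [Category.{v} C] [Preadditive C] [Linear ℂ C] [MonoidalCategory C]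
  [MonoidalPreadditive C] [MonoidalLinear ℂ C] {A : Mon C}
  [HasCoequalizers C] [∀ X : C, PreservesColimitsOfSize.{0, 0} (tensorLeft X)]
  [∀ X : C, PreservesColimitsOfSize.{0, 0} (tensorRight X)]
  [BraidedCategory C] [IsCommMonObj A.X]

lemma proj_local_whiskerLeft (P : LocalModule A) {M N : LocalModule A} (f : M ⟶ N) :
    proj P.obj M.obj ≫ (P ◁ f).hom.hom = P.obj.X ◁ f.hom.hom ≫ proj P.obj N.obj :=
  proj_whiskerLeft P.obj f.hom

lemma proj_local_whiskerRight {M N : LocalModule A} (f : M ⟶ N) (P : LocalModule A) :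
    proj M.obj P.obj ≫ (f ▷ P).hom.hom = f.hom.hom ▷ P.obj.X ≫ proj N.obj P.obj :=
  proj_whiskerRight f.hom P.obj

instance : MonoidalPreadditive (LocalModule A) where
  whiskerLeft_zero {P M N} := local_hom_ext (by
    rw [proj_local_whiskerLeft]
    change P.obj.X ◁ (0 : M.obj.X ⟶ N.obj.X) ≫ _ = _ ≫ (0 : (P.obj ⊗ M.obj).X ⟶ (P.obj ⊗ N.obj).X)
    simp)
  zero_whiskerRight {P M N} := local_hom_ext (by
    rw [proj_local_whiskerRight]
    change (0 : M.obj.X ⟶ N.obj.X) ▷ P.obj.X ≫ _ = _ ≫ (0 : (M.obj ⊗ P.obj).X ⟶ (N.obj ⊗ P.obj).X)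
    simp)
  whiskerLeft_add {P M N} f g := local_hom_ext (by
    rw [proj_local_whiskerLeft]
    change P.obj.X ◁ (f.hom.hom + g.hom.hom) ≫ _ = _ ≫ ((P ◁ f).hom.hom + (P ◁ g).hom.hom)
    rw [Preadditive.comp_add, proj_local_whiskerLeft, proj_local_whiskerLeft,
      MonoidalPreadditive.whiskerLeft_add, Preadditive.add_comp])
  add_whiskerRight {P M N} f g := local_hom_ext (by
    rw [proj_local_whiskerRight]
    change (f.hom.hom + g.hom.hom) ▷ P.obj.X ≫ _ = _ ≫ ((f ▷ P).hom.hom + (g ▷ P).hom.hom)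
    rw [Preadditive.comp_add, proj_local_whiskerRight, proj_local_whiskerRight,
      MonoidalPreadditive.add_whiskerRight, Preadditive.add_comp])

instance : MonoidalLinear ℂ (LocalModule A) where
  whiskerLeft_smul P {M N} c f := local_hom_ext (by
    rw [proj_local_whiskerLeft]
    change P.obj.X ◁ (c • f.hom.hom) ≫ _ = _ ≫ (c • (P ◁ f).hom.hom)
    rw [Linear.comp_smul, proj_local_whiskerLeft, MonoidalLinear.whiskerLeft_smul,
      Linear.smul_comp])
  smul_whiskerRight c {M N} f P := local_hom_ext (by
    rw [proj_local_whiskerRight]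
    change (c • f.hom.hom) ▷ P.obj.X ≫ _ = _ ≫ (c • (f ▷ P).hom.hom)
    rw [Linear.comp_smul, proj_local_whiskerRight, MonoidalLinear.smul_whiskerRight,
      Linear.smul_comp])

end MonoidalPreadditive

section Condensation

open MonObj

variable {C : Type u} [Category.{v} C] [Abelian C] [Linear ℂ C] [MonoidalCategory C]
  [MonoidalPreadditive C] [MonoidalLinear ℂ C] [RigidCategory C] [BraidedCategory C]
  [Twist C] [IsPremodular C] {G : Subgroup (Skeleton C)ˣ}

namespace TannakianEquivalence

variable (E : TannakianEquivalence G)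

lemma nonempty_simpleDecomposition (M : E.Condensation) : Nonempty (SimpleDecomposition M) :=
  E.galoisFrobenius.nonempty_simpleDecomposition (Premodular.nonempty_simpleDecomposition C) M

lemma monodromy_eq_id (M : E.Condensation) : monodromy E.regularAlgebra.X M.obj.X = 𝟙 _ :=
  E.galoisFrobenius.monodromy_eq_id M.property

/-- Local modules are rigid, and `dim_C M = |H| dim M`; here the counit of `Fun(H)` takes the unit
to `|H|`. -/
lemma hasRightDual_and_qdim (M : E.Condensation) :
    Nonempty (HasRightDual M) ∧ qdim M.obj.X = Nat.card E.H * qdim M :=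
  exists_dual_qdim_eq E.galoisFrobenius.toSpecialFrobenius E.exists_eq_smul_one (id_nonzero _)
    E.one_ne_zero E.one_counit M (ᘁM.obj.X) (E.monodromy_eq_id M)

instance : RightRigidCategory E.Condensation where
  rightDual M := (E.hasRightDual_and_qdim M).1.some

lemma exists_eq_smul_id_unit (f : 𝟙_ E.Condensation ⟶ 𝟙_ E.Condensation) :
    ∃ c : ℂ, f = c • 𝟙 _ :=
  Premodular.exists_eq_smul_id_unit E.exists_eq_smul_one f

lemma id_unit_ne_zero : 𝟙 (𝟙_ E.Condensation) ≠ 0 := by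
  intro h
  have h' : 𝟙 E.regularAlgebra.X = 0 := congrArg (fun f => f.hom.hom) h
  apply E.one_ne_zero
  rw [← Category.comp_id η[E.regularAlgebra.X], h', comp_zero]

/-- The regular algebra is the unit of the category of local modules, where it has dimension `1`, so
its dimension in `C` is both `|H|` and `|G|`. -/
lemma card_eq [Finite G] : (Nat.card E.H : ℂ) = Nat.card G := by
  have h := (E.hasRightDual_and_qdim (𝟙_ E.Condensation)).2
  have h1 : qdim (𝟙_ E.Condensation) = 1 :=
    Premodular.qdim_eq_one E.exists_eq_smul_id_unit _ E.id_unit_ne_zero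
      (localModule_hom_ext (TrivialTwist.twist_eq (X := E.regularAlgebra.X))) braiding_unit_unit
  rw [h1, _root_.mul_one] at h
  exact h.symm.trans E.qdim_regularAlgebra

/-- The dimension of a local module in `C` is `|G|` times its dimension as a local module. -/
lemma qdim_obj [Finite G] (M : E.Condensation) : qdim M.obj.X = Nat.card G * qdim M := by
  rw [(E.hasRightDual_and_qdim M).2, E.card_eq]

/-- A simple object with a nonzero morphism to a local module is a summand of it, and centralizes
the regular algebra with it. -/
lemma monodromy_eq_id_of_hom {X : C} [Simple X] {M : E.Condensation} {f : X ⟶ M.obj.X}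
    (hf : f ≠ 0) : monodromy E.regularAlgebra.X X = 𝟙 _ := by
  have := mono_of_nonzero_from_simple hf
  obtain ⟨r, hr⟩ := exists_retraction_of_mono (Premodular.nonempty_simpleDecomposition C) f
  rw [← Category.comp_id (monodromy _ _), ← whiskerLeft_id, ← hr, whiskerLeft_comp,
    ← Category.assoc, monodromy_naturality_right, E.monodromy_eq_id, Category.comp_id]

lemma exists_hom_ne_zero (M : E.Condensation) [Simple M] :
    ∃ (X : SimpleClass C) (f : X.rep ⟶ M.obj.X), f ≠ 0 := by
  obtain ⟨d⟩ := Premodular.nonempty_simpleDecomposition C M.obj.X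
  have hM : 𝟙 M.obj.X ≠ 0 := fun h => id_nonzero M (localModule_hom_ext h)
  obtain ⟨j, hj⟩ := d.exists_incl_comp_ne_zero hM
  have := d.simple j
  refine ⟨SimpleClass.mk (d.S j), (SimpleClass.repMk (d.S j)).hom ≫ d.incl j, fun h => hj ?_⟩
  rw [Preadditive.IsIso.comp_left_eq_zero] at h
  rw [h, zero_comp]

/-- There are finitely many simple local modules. -/
lemma finite_simpleClass : Finite (SimpleClass E.Condensation) := by
  have d (X : {X : SimpleClass C // monodromy E.regularAlgebra.X X.rep = 𝟙 _}) :
      SimpleDecomposition (freeModule X.1.rep X.2 : E.Condensation) :=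
    (E.nonempty_simpleDecomposition _).some
  let Φ : (Σ X, (d X).ι) → SimpleClass E.Condensation := fun p =>
    have := (d p.1).simple p.2
    SimpleClass.mk ((d p.1).S p.2)
  refine Finite.of_surjective Φ fun M => ?_
  obtain ⟨X, f, hf⟩ := E.exists_hom_ne_zero M.rep
  let X' : {X : SimpleClass C // monodromy E.regularAlgebra.X X.rep = 𝟙 _} :=
    ⟨X, E.monodromy_eq_id_of_hom hf⟩
  let f' : freeModule X'.1.rep X'.2 ⟶ M.rep := (freeModuleHomEquiv X.rep X'.2 M.rep).symm f
  have hf' : f' ≠ 0 := by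
    rw [Ne, LinearEquiv.map_eq_zero_iff]
    exact hf
  obtain ⟨j, hj⟩ := (d X').exists_incl_comp_ne_zero hf'
  have := (d X').simple j
  have := isIso_of_hom_simple hj
  exact ⟨⟨X', j⟩, SimpleClass.mk_eq_iff.2 ⟨(asIso ((d X').incl j ≫ f')).symm⟩⟩

/-- The multiplicity of a simple object in a simple local module. -/
def mult (X : SimpleClass C) (M : SimpleClass E.Condensation) : ℂ :=
  Module.finrank ℂ (X.rep ⟶ M.rep.obj.X)

/-- The dimension of a local module in `C`, computed from its simple summands in `C`. -/
lemma card_mul_qdim [Finite G] [Fintype (SimpleClass C)] (M : SimpleClass E.Condensation) :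
    Nat.card G * qdim M.rep = ∑ X : SimpleClass C, E.mult X M * qdim X.rep := by
  obtain ⟨d⟩ := Premodular.nonempty_simpleDecomposition C M.rep.obj.X
  rw [← E.qdim_obj, d.qdim_eq]
  exact d.sum_eq qdim fun e => qdim_congr e

/-- The dimension of the free module `A ⊗ X` is the dimension of `X`, and by Frobenius reciprocity
`mult X M` is the multiplicity of `M` in `A ⊗ X`. -/
lemma qdim_eq_sum_mult [Finite G] [Fintype (SimpleClass E.Condensation)] (X : SimpleClass C)
    (hX : monodromy E.regularAlgebra.X X.rep = 𝟙 _) :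
    qdim X.rep = ∑ M : SimpleClass E.Condensation, E.mult X M * qdim M.rep := by
  let P : E.Condensation := freeModule X.rep hX
  have hP : qdim P = qdim X.rep := by
    have h := E.qdim_obj P
    have h' : qdim P.obj.X = qdim (E.regularAlgebra.X ⊗ X.rep) := rfl
    rw [h', qdim_tensor (exists_eq_smul_id (𝟙_ C)) (id_nonzero _), E.qdim_regularAlgebra] at h
    exact (mul_left_cancel₀ (Nat.cast_ne_zero.2 Nat.card_pos.ne') h).symm
  obtain ⟨d⟩ := E.nonempty_simpleDecomposition P
  rw [← hP, qdim_eq_sum E.exists_eq_smul_id_unit E.id_unit_ne_zero d.incl d.pr d.incl_pr_self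
    d.sum_pr_incl, d.sum_eq qdim fun e => qdim_congr e]
  refine Finset.sum_congr rfl fun M _ => ?_
  rw [d.finrank_hom_comm, (freeModuleHomEquiv X.rep hX M.rep).finrank_eq, mult]

lemma exists_hom_of_mult_ne_zero {X : SimpleClass C} {M : SimpleClass E.Condensation}
    (h : E.mult X M ≠ 0) : ∃ f : X.rep ⟶ M.rep.obj.X, f ≠ 0 := by
  by_contra! hf
  have : Subsingleton (X.rep ⟶ M.rep.obj.X) := ⟨fun f g => (hf f).trans (hf g).symm⟩
  exact h (by rw [mult, Module.finrank_zero_of_subsingleton, Nat.cast_zero])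

/-- The twist of a local module is its twist in `C`, and is natural. -/
lemma scalar_θ_eq_of_mult_ne_zero {X : SimpleClass C} {M : SimpleClass E.Condensation}
    (h : E.mult X M ≠ 0) : scalar (θ X.rep).hom = scalar (θ M.rep).hom := by
  obtain ⟨f, hf⟩ := E.exists_hom_of_mult_ne_zero h
  obtain ⟨c, hc⟩ := endomorphism_simple_eq_smul_id ℂ (θ M.rep).hom
  obtain ⟨s, hs⟩ := exists_eq_smul_id X.rep (θ X.rep).hom
  have hc' : (θ M.rep.obj.X).hom = c • 𝟙 M.rep.obj.X := congrArg (fun g => g.hom.hom) hc.symm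
  have h1 := θ_naturality f
  rw [hc', hs, Linear.comp_smul, Linear.smul_comp, Category.comp_id, Category.id_comp] at h1
  rw [hs, ← hc, scalar_smul_id (id_nonzero _), scalar_smul_id (id_nonzero _)]
  exact (smul_left_injective ℂ hf h1).symm

open scoped Classical in
/-- The sum over the simple local modules is a sum over the simple objects of `C` that centralize
the regular algebra, counted through multiplicities. -/
lemma card_mul_gaussSum [Finite G] [Fintype (SimpleClass C)] (n : ℤ) :
    Nat.card G * gaussSum E.Condensation n = ∑ X : SimpleClass C,
      if monodromyChar G X.rep = 1 then scalar (θ X.rep).hom ^ n * qdim X.rep ^ 2 else 0 := by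
  have := E.finite_simpleClass
  have : Fintype (SimpleClass E.Condensation) := Fintype.ofFinite _
  rw [gaussSum, finsum_eq_sum_of_fintype, Finset.mul_sum]
  calc _ = ∑ M : SimpleClass E.Condensation, ∑ X : SimpleClass C,
        scalar (θ X.rep).hom ^ n * qdim X.rep * (E.mult X M * qdim M.rep) := by
        refine Finset.sum_congr rfl fun M _ => ?_
        calc _ = scalar (θ M.rep).hom ^ n * qdim M.rep * (Nat.card G * qdim M.rep) := by ring
          _ = _ := by
            rw [E.card_mul_qdim, Finset.mul_sum]
            refine Finset.sum_congr rfl fun X _ => ?_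
            by_cases h : E.mult X M = 0
            · simp [h]
            · rw [E.scalar_θ_eq_of_mult_ne_zero h]
              ring
    _ = _ := by
        rw [Finset.sum_comm]
        refine Finset.sum_congr rfl fun X _ => ?_
        rw [← Finset.mul_sum]
        split_ifs with h
        · rw [← E.qdim_eq_sum_mult X ((monodromy_eq_id_iff E X.rep).2 h)]
          ring
        · have h0 (M : SimpleClass E.Condensation) : E.mult X M = 0 := by
            by_contra h'
            obtain ⟨f, hf⟩ := E.exists_hom_of_mult_ne_zero h'
            exact h ((monodromy_eq_id_iff E X.rep).1 (E.monodromy_eq_id_of_hom hf))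
          simp [h0]

end TannakianEquivalence

end Condensation

end

end Premodular

theorem theorem5p5 {C : Type u} [Category.{v} C] [Abelian C] [Linear ℂ C] [MonoidalCategory C]
    [MonoidalPreadditive C] [MonoidalLinear ℂ C] [RigidCategory C] [BraidedCategory C]
    [Premodular.Twist C] [Premodular.IsPremodular C]
    (G : Subgroup (Skeleton C)ˣ) [Finite G] (E : Premodular.TannakianEquivalence G)
    (n : ℤ) (hn : IsCoprime n (Premodular.ordT C : ℤ)) :
    Premodular.gaussSum C n = (Nat.card G : ℂ) * Premodular.gaussSum E.Condensation n ∧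
      (Premodular.gaussSum C n ≠ 0 →
        Premodular.centralCharge E.Condensation n = Premodular.centralCharge C n) := by
  have : Fintype (Premodular.SimpleClass C) := Fintype.ofFinite _
  have h := (Premodular.gaussSum_eq_sum_centralizing E n hn).trans (E.card_mul_gaussSum n).symm
  refine ⟨h, fun _ => ?_⟩
  have hG : (Nat.card G : ℂ) ≠ 0 := Nat.cast_ne_zero.2 Nat.card_pos.ne'
  rw [Premodular.centralCharge, Premodular.centralCharge, h, norm_mul, Complex.norm_natCast,
    Complex.ofReal_mul, Complex.ofReal_natCast, mul_div_mul_left _ _ hG]
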